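/- **Conventions.** A model category is assumed to be complete and cocomplete. A functor $F:\mathcal N\to\mathcal M$ between model categories exhibits the model structure of $\mathcal N$ as *lifted* (right-induced) along $F$ if a map $f$ of $\mathcal N$ is a weak equivalence (respectively a fibration) if and only if $F(f)$ is one in $\mathcal M$. A model category is *cofibrantly generated* if there are sets of maps $I$ and $J$, each permitting the small object argument (the domains of the maps in $I$ are small relative to the relative $I$-cell complexes, and likewise for $J$), such that the fibrations are the maps with the right lifting property against $J$ and the acyclic fibrations are the maps with the right lifting property against $I$. A symmetric monoidal model category is a closed symmetric monoidal category with a model structure satisfying the pushout-product axiom and the unit axiom. For a symmetric monoidal category $\mathcal M$, the category of $\mathbb N$-modules is $\mathcal M^{\mathbb N}$; if $\mathcal M$ is a model category it carries the levelwise model structure. An operad in $\mathcal M$ is an $\mathbb N$-module $P$ with right actions of $\Sigma_n$ on $P(n)$, a unit $\mathbf 1\to P(1)$ and partial compositions $\circ_i:P(m)\otimes P(n)\to P(m+n-1)$, $1\le i\le m$, $n\ge 0$, satisfying the usual unit, associativity and equivariance axioms. A cyclic operad is an operad together with an extension of the $\Sigma_n$-action on $P(n)$ to a right action of $\mathrm{Aut}\{0,1,\dots,n\}$,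 for every $n\geq 0$, such that, writing $p\tau$ for the action of the cyclic permutation $\tau:a\mapsto a+1 \bmod (n+1)$, one has $\mathrm{id}\,\tau=\mathrm{id}$ for the unit; $(p\circ_i q)\tau=(p\tau)\circ_{i-1}q$ for $i\ge 2$; and $(p\circ_1 q)\tau=(q\tau)\circ_n(p\tau)$ for $q$ of arity $n\ge 1$ (where the symmetry of $\mathcal M$ is understood). Morphisms of operads and of cyclic operads are the levelwise maps preserving all the structure. **Proposition.** Let $\mathcal M$ be a symmetric monoidal model category such that the category of operads in $\mathcal M$ has a cofibrantly generated model structure lifted from $\mathbb N$-modules in $\mathcal M$ along the forgetful functor. Then the category of cyclic operads in $\mathcal M$ is complete and cocomplete and has a model structure, with functorial factorizations, that is lifted from operads in $\mathcal M$ and also from $\mathbb N$-modules in $\mathcal M$, along the respective forgetful functors. -/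

import Mathlib

open CategoryTheory Limits MonoidalCategory HomotopicalAlgebra

universe v u

section ModelStructures

variable {C : Type u} [Category.{v} C]

/-- Relative `I`-cell complexes: transfinite compositions of pushouts of maps in `I`. -/
def relativeCells (I : MorphismProperty C) : MorphismProperty C :=
  MorphismProperty.transfiniteCompositions.{v} I.pushouts

/-- `A` is small relative to the class `W`: there is a cardinal `κ` such that for every regular
cardinal `μ ≥ κ` and every `μ`-sequence (a colimit-preserving diagram on the ordinal `μ`) all of
whose successor maps are in `W`, the functor `Hom(A, -)` preserves the colimit of the sequence. -/
def IsSmallRelativeTo (A : C) (W : MorphismProperty C) : Prop :=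
  ∃ κ : Cardinal.{v}, ∀ μ : Cardinal.{v}, μ.IsRegular → κ ≤ μ →
    ∀ F : μ.ord.ToType ⥤ C, F.IsWellOrderContinuous →
      (∀ (j j' : μ.ord.ToType) (h : j ⋖ j'), W (F.map (homOfLE h.le))) →
        PreservesColimit F (coyoneda.obj (Opposite.op A))

/-- `I` permits the small object argument: the domains of the maps in `I` are small relative to
the relative `I`-cell complexes. -/
def PermitsSmallObjectArgument (I : MorphismProperty C) : Prop :=
  ∀ ⦃A B : C⦄ (i : A ⟶ B), I i → IsSmallRelativeTo A (relativeCells I)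

variable (C) in
/-- A model category is cofibrantly generated if there are sets of maps `I` and `J`, both
permitting the small object argument, such that the fibrations are the maps with the right lifting
property with respect to `J` and the acyclic fibrations are those with the right lifting property
with respect to `I`. -/
def IsCofibrantlyGenerated [ModelCategory C] : Prop :=
  ∃ I J : MorphismProperty C,
    MorphismProperty.IsSmall.{v} I ∧ MorphismProperty.IsSmall.{v} J ∧
    PermitsSmallObjectArgument I ∧ PermitsSmallObjectArgument J ∧
    fibrations C = J.rlp ∧ trivialFibrations C = I.rlp

/-- The functor `F` creates weak equivalences and fibrations, that is, the model structure of its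
source is right-induced (lifted) along `F`. -/
structure IsRightInduced {N : Type*} {M : Type*} [Category* N] [Category* M]
    [ModelCategory N] [ModelCategory M] (F : N ⥤ M) : Prop where
  weakEquivalence_iff : ∀ {X Y : N} (f : X ⟶ Y), WeakEquivalence f ↔ WeakEquivalence (F.map f)
  fibration_iff : ∀ {X Y : N} (f : X ⟶ Y), Fibration f ↔ Fibration (F.map f)

/-- The axioms relating the closed symmetric monoidal structure and the model structure of a
symmetric monoidal model category: the pushout-product axiom and the unit axiom. -/
class IsMonoidalModelCategory (M : Type u) [Category.{v} M] [MonoidalCategory M]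
    [SymmetricCategory M] [MonoidalClosed M] [ModelCategory M] : Prop where
  cofibration_pushoutProduct : ∀ {A B X Y : M} (f : A ⟶ B) (g : X ⟶ Y)
    [Cofibration f] [Cofibration g],
    Cofibration ((Arrow.pushoutProduct.obj (Arrow.mk f)).obj (Arrow.mk g)).hom
  weakEquivalence_pushoutProduct : ∀ {A B X Y : M} (f : A ⟶ B) (g : X ⟶ Y)
    [Cofibration f] [Cofibration g], WeakEquivalence f ∨ WeakEquivalence g →
    WeakEquivalence ((Arrow.pushoutProduct.obj (Arrow.mk f)).obj (Arrow.mk g)).hom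
  unit : ∀ {Q : M} (q : Q ⟶ 𝟙_ M) [IsCofibrant Q] [Fibration q] [WeakEquivalence q]
    (X : M) [IsCofibrant X], WeakEquivalence (q ▷ X)

end ModelStructures

/-- `ℕ`-modules in `M`: sequences of objects of `M`, with sequences of morphisms. -/
abbrev NModule (M : Type u) : Type u := ℕ → M

namespace NModule

variable (M : Type u) [Category.{v} M]

instance categoryWithFibrations [CategoryWithFibrations M] :
    CategoryWithFibrations (NModule M) where
  fibrations := MorphismProperty.pi fun _ => fibrations M

instance categoryWithCofibrations [CategoryWithCofibrations M] :
    CategoryWithCofibrations (NModule M) where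
  cofibrations := MorphismProperty.pi fun _ => cofibrations M

instance categoryWithWeakEquivalences [CategoryWithWeakEquivalences M] :
    CategoryWithWeakEquivalences (NModule M) where
  weakEquivalences := MorphismProperty.pi fun _ => weakEquivalences M

variable {M} in
theorem fibration_iff [CategoryWithFibrations M] {X Y : NModule M} (f : X ⟶ Y) :
    Fibration f ↔ ∀ n, Fibration (f n) :=
  ⟨fun h n => ⟨h.mem n⟩, fun h => ⟨fun n => (h n).mem⟩⟩

variable {M} in
theorem cofibration_iff [CategoryWithCofibrations M] {X Y : NModule M} (f : X ⟶ Y) :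
    Cofibration f ↔ ∀ n, Cofibration (f n) :=
  ⟨fun h n => ⟨h.mem n⟩, fun h => ⟨fun n => (h n).mem⟩⟩

variable {M} in
theorem weakEquivalence_iff [CategoryWithWeakEquivalences M] {X Y : NModule M} (f : X ⟶ Y) :
    WeakEquivalence f ↔ ∀ n, WeakEquivalence (f n) :=
  ⟨fun h n => ⟨h.mem n⟩, fun h => ⟨fun n => (h n).mem⟩⟩

theorem isStableUnderRetracts_pi (W : MorphismProperty M) [W.IsStableUnderRetracts] :
    (MorphismProperty.pi fun _ : ℕ => W).IsStableUnderRetracts where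
  of_retract h hg n := MorphismProperty.of_retract (h.map (Pi.eval (fun _ : ℕ => M) n)) (hg n)

theorem hasTwoOutOfThreeProperty_pi (W : MorphismProperty M) [W.HasTwoOutOfThreeProperty] :
    (MorphismProperty.pi fun _ : ℕ => W).HasTwoOutOfThreeProperty where
  comp_mem _ _ hf hg n := W.comp_mem _ _ (hf n) (hg n)
  of_postcomp _ _ hg hfg n := W.of_postcomp _ _ (hg n) (hfg n)
  of_precomp _ _ hf hfg n := W.of_precomp _ _ (hf n) (hfg n)

variable {M} in
theorem hasLiftingProperty {A B X Y : NModule M} (i : A ⟶ B) (p : X ⟶ Y)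
    (h : ∀ n, HasLiftingProperty (i n) (p n)) : HasLiftingProperty i p where
  sq_hasLift {f g} sq := by
    have sq' : ∀ n, CommSq (f n) (i n) (p n) (g n) := fun n => ⟨congrFun sq.w n⟩
    have := fun n => (h n).sq_hasLift (sq' n)
    exact ⟨⟨⟨fun n => (sq' n).lift, funext fun n => (sq' n).fac_left,
      funext fun n => (sq' n).fac_right⟩⟩⟩

theorem hasFactorization_pi (W W' : MorphismProperty M) [W.HasFactorization W'] :
    (MorphismProperty.pi fun _ : ℕ => W).HasFactorization
      (MorphismProperty.pi fun _ : ℕ => W') where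
  nonempty_mapFactorizationData f :=
    ⟨{ Z := fun n => (MorphismProperty.factorizationData W W' (f n)).Z
       i := fun n => (MorphismProperty.factorizationData W W' (f n)).i
       p := fun n => (MorphismProperty.factorizationData W W' (f n)).p
       fac := funext fun n => (MorphismProperty.factorizationData W W' (f n)).fac
       hi := fun n => (MorphismProperty.factorizationData W W' (f n)).hi
       hp := fun n => (MorphismProperty.factorizationData W W' (f n)).hp }⟩

theorem trivialCofibrations_eq [ModelCategory M] :
    trivialCofibrations (NModule M) = MorphismProperty.pi fun _ => trivialCofibrations M := by
  ext X Y f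
  exact ⟨fun h n => ⟨h.1 n, h.2 n⟩, fun h => ⟨fun n => (h n).1, fun n => (h n).2⟩⟩

theorem trivialFibrations_eq [ModelCategory M] :
    trivialFibrations (NModule M) = MorphismProperty.pi fun _ => trivialFibrations M := by
  ext X Y f
  exact ⟨fun h n => ⟨h.1 n, h.2 n⟩, fun h => ⟨fun n => (h n).1, fun n => (h n).2⟩⟩

/-- The product (levelwise) model structure on `ℕ`-modules. -/
instance modelCategory [ModelCategory M] : ModelCategory (NModule M) where
  categoryWithFibrations := categoryWithFibrations M
  categoryWithCofibrations := categoryWithCofibrations M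
  categoryWithWeakEquivalences := categoryWithWeakEquivalences M
  cm1a := ⟨fun _ _ _ => Adjunction.hasLimitsOfShape_of_equivalence
    (piEquivalenceFunctorDiscrete ℕ M).functor⟩
  cm1b := ⟨fun _ _ _ => Adjunction.hasColimitsOfShape_of_equivalence
    (piEquivalenceFunctorDiscrete ℕ M).functor⟩
  cm2 := hasTwoOutOfThreeProperty_pi M (weakEquivalences M)
  cm3a := isStableUnderRetracts_pi M (weakEquivalences M)
  cm3b := isStableUnderRetracts_pi M (fibrations M)
  cm3c := isStableUnderRetracts_pi M (cofibrations M)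
  cm4a i p hi hi' hp := hasLiftingProperty i p fun n => by
    have := (cofibration_iff i).1 hi n
    have := (weakEquivalence_iff i).1 hi' n
    have := (fibration_iff p).1 hp n
    infer_instance
  cm4b i p hi hp hp' := hasLiftingProperty i p fun n => by
    have := (cofibration_iff i).1 hi n
    have := (weakEquivalence_iff p).1 hp' n
    have := (fibration_iff p).1 hp n
    infer_instance
  cm5a := by
    rw [trivialCofibrations_eq]
    exact hasFactorization_pi M _ _
  cm5b := by
    rw [trivialFibrations_eq]
    exact hasFactorization_pi M _ _

end NModule

section Operads

variable (M : Type u) [Category.{v} M] [MonoidalCategory M] [SymmetricCategory M]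

/-- In `p ∘ᵢ q`, with `q` of arity `n` (inputs numbered from `0`), the position of the input
`a ≠ i` of `p`. The input `b` of `q` has position `i + b`. -/
def outerPos (n i a : ℕ) : ℕ := if a < i then a else a + n - 1

/-- A (unital, symmetric) operad in a symmetric monoidal category, presented by partial
compositions `∘ᵢ : P(m) ⊗ P(n) ⟶ P(m + n - 1)`, a unit, and right actions of the symmetric groups.
Inputs are numbered from `0`. The arity of a composite is any `k` with `m + n = k + 1`, which
avoids transport along equalities of natural numbers. -/
structure Operad where
  /-- The object of operations of arity `n`. -/
  obj : ℕ → M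
  /-- The right action of the symmetric group: the input `b` of `p · σ` is the input `σ b`
  of `p`. -/
  act : ∀ {n : ℕ}, Equiv.Perm (Fin n) → (obj n ⟶ obj n)
  /-- The unit. -/
  one : 𝟙_ M ⟶ obj 1
  /-- The partial composition `∘ᵢ`. -/
  comp : ∀ {m n k : ℕ}, m + n = k + 1 → Fin m → (obj m ⊗ obj n ⟶ obj k)
  act_one : ∀ n : ℕ, act (1 : Equiv.Perm (Fin n)) = 𝟙 (obj n)
  act_mul : ∀ {n : ℕ} (σ ρ : Equiv.Perm (Fin n)), act (σ * ρ) = act σ ≫ act ρ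
  one_comp : ∀ {n : ℕ} (h : 1 + n = n + 1),
    (one ▷ obj n) ≫ comp h 0 = (λ_ (obj n)).hom
  comp_one : ∀ {m : ℕ} (i : Fin m),
    (obj m ◁ one) ≫ comp rfl i = (ρ_ (obj m)).hom
  /-- `(p ∘ᵢ q) ∘ᵢ₊ⱼ r = p ∘ᵢ (q ∘ⱼ r)` -/
  assoc_seq : ∀ {l m n a b k : ℕ} (hlm : l + m = a + 1) (han : a + n = k + 1)
    (hmn : m + n = b + 1) (hlb : l + b = k + 1) (i : Fin l) (j : Fin m) (c : Fin a),
    (c : ℕ) = i + j →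
    (comp hlm i ▷ obj n) ≫ comp han c =
      (α_ (obj l) (obj m) (obj n)).hom ≫ (obj l ◁ comp hmn j) ≫ comp hlb i
  /-- `(p ∘ᵢ q) ∘ⱼ₊ₘ₋₁ r = (p ∘ⱼ r) ∘ᵢ q` for `i < j`, where `m` is the arity of `q` -/
  assoc_par : ∀ {l m n a b k : ℕ} (hlm : l + m = a + 1) (han : a + n = k + 1)
    (hln : l + n = b + 1) (hbm : b + m = k + 1) (i j : Fin l), i < j →
    ∀ (c : Fin a) (d : Fin b), (c : ℕ) + 1 = j + m → (d : ℕ) = i →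
    (comp hlm i ▷ obj n) ≫ comp han c =
      (α_ (obj l) (obj m) (obj n)).hom ≫ (obj l ◁ (β_ (obj m) (obj n)).hom) ≫
        (α_ (obj l) (obj n) (obj m)).inv ≫ (comp hln j ▷ obj m) ≫ comp hbm d
  /-- `(p · σ) ∘ᵢ (q · ρ) = (p ∘_{σ i} q) · π`, where `π` is the permutation of the inputs of the
  composite that is induced by `σ` and `ρ` -/
  equivariance : ∀ {m n k : ℕ} (h : m + n = k + 1) (i : Fin m) (σ : Equiv.Perm (Fin m))
    (ρ : Equiv.Perm (Fin n)) (π : Equiv.Perm (Fin k)),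
    (∀ (a : Fin m) (c : Fin k), a ≠ i → (c : ℕ) = outerPos n i a →
      (π c : ℕ) = outerPos n (σ i) (σ a)) →
    (∀ (b : Fin n) (c : Fin k), (c : ℕ) = i + b → (π c : ℕ) = σ i + ρ b) →
    (act σ ⊗ₘ act ρ) ≫ comp h i = comp h (σ i) ≫ act π

variable {M}

namespace Operad

/-- A morphism of operads. -/
@[ext]
structure Hom (P Q : Operad M) where
  /-- The component in arity `n`. -/
  app : ∀ n : ℕ, P.obj n ⟶ Q.obj n
  app_act : ∀ {n : ℕ} (σ : Equiv.Perm (Fin n)), P.act σ ≫ app n = app n ≫ Q.act σ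
  app_one : P.one ≫ app 1 = Q.one
  app_comp : ∀ {m n k : ℕ} (h : m + n = k + 1) (i : Fin m),
    P.comp h i ≫ app k = (app m ⊗ₘ app n) ≫ Q.comp h i

instance category : Category.{v} (Operad M) where
  Hom := Hom
  id P :=
    { app := fun n => 𝟙 (P.obj n)
      app_act := by simp
      app_one := by simp
      app_comp := by simp }
  comp f g :=
    { app := fun n => f.app n ≫ g.app n
      app_act := fun σ => by
        rw [← Category.assoc, f.app_act, Category.assoc, g.app_act, Category.assoc]
      app_one := by rw [← Category.assoc, f.app_one, g.app_one]
      app_comp := fun h i => by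
        rw [← Category.assoc, f.app_comp, Category.assoc, g.app_comp, ← Category.assoc,
          MonoidalCategory.tensorHom_comp_tensorHom] }
  id_comp f := Hom.ext (funext fun _ => Category.id_comp _)
  comp_id f := Hom.ext (funext fun _ => Category.comp_id _)
  assoc f g h := Hom.ext (funext fun _ => Category.assoc _ _ _)

variable (M) in
/-- The forgetful functor from operads to `ℕ`-modules. -/
def forget : Operad M ⥤ NModule M where
  obj P := P.obj
  map f := f.app

end Operad

variable (M) in
/-- A cyclic operad: an operad `P` with an extension of the right `Σₙ`-action on `P(n)` to the
group `Aut {0, …, n}`, where `0` is the output and `a + 1` is the input numbered `a`, such that the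
unit is invariant and the partial compositions are compatible with the cyclic permutation
`finRotate (n + 1) : a ↦ a + 1`, whose action turns the first input into the output and the output
into the last input. -/
structure CyclicOperad extends Operad M where
  /-- The right action of `Aut {0, …, n}` on `P(n)`. -/
  cact : ∀ {n : ℕ}, Equiv.Perm (Fin (n + 1)) → (obj n ⟶ obj n)
  cact_one : ∀ n : ℕ, cact (1 : Equiv.Perm (Fin (n + 1))) = 𝟙 (obj n)
  cact_mul : ∀ {n : ℕ} (σ ρ : Equiv.Perm (Fin (n + 1))), cact (σ * ρ) = cact σ ≫ cact ρ
  /-- On the permutations that fix the output, the action is that of the operad. -/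
  cact_extend : ∀ {n : ℕ} (σ : Equiv.Perm (Fin n)) (σ' : Equiv.Perm (Fin (n + 1))),
    σ' 0 = 0 → (∀ a : Fin n, σ' a.succ = (σ a).succ) → cact σ' = act σ
  one_rotate : one ≫ cact (finRotate 2) = one
  /-- `(p ∘ᵢ q) · τ = (p · τ) ∘ᵢ₋₁ q` if `i` is not the first input of `p` -/
  comp_rotate : ∀ {m n k : ℕ} (h : m + n = k + 1) (i j : Fin m), (i : ℕ) = j + 1 →
    comp h i ≫ cact (finRotate (k + 1)) =
      (cact (finRotate (m + 1)) ▷ obj n) ≫ comp h j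
  /-- `(p ∘ q) · τ = (q · τ) ∘ (p · τ)`, where the composition on the left is at the first input
  of `p` and that on the right is at the last input of `q`, if `q` has an input -/
  comp_rotate_first : ∀ {m n k : ℕ} (h : m + n = k + 1) (h' : n + m = k + 1) (i : Fin m)
    (j : Fin n), (i : ℕ) = 0 → (j : ℕ) + 1 = n →
    comp h i ≫ cact (finRotate (k + 1)) =
      (β_ (obj m) (obj n)).hom ≫
        (cact (finRotate (n + 1)) ⊗ₘ cact (finRotate (m + 1))) ≫ comp h' j

namespace CyclicOperad

/-- A morphism of cyclic operads: a morphism of operads that is compatible with the extended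
actions. -/
@[ext]
structure Hom (P Q : CyclicOperad M) where
  /-- The underlying morphism of operads. -/
  hom : P.toOperad ⟶ Q.toOperad
  hom_cact : ∀ {n : ℕ} (σ : Equiv.Perm (Fin (n + 1))),
    P.cact σ ≫ hom.app n = hom.app n ≫ Q.cact σ

instance category : Category.{v} (CyclicOperad M) where
  Hom := Hom
  id P :=
    { hom := 𝟙 P.toOperad
      hom_cact := fun {n} σ => (Category.comp_id _).trans (Category.id_comp _).symm }
  comp f g :=
    { hom := f.hom ≫ g.hom
      hom_cact := fun {n} σ => by
        change _ ≫ f.hom.app n ≫ g.hom.app n = (f.hom.app n ≫ g.hom.app n) ≫ _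
        rw [← Category.assoc, f.hom_cact, Category.assoc, g.hom_cact, Category.assoc] }
  id_comp f := Hom.ext (Category.id_comp _)
  comp_id f := Hom.ext (Category.comp_id _)
  assoc f g h := Hom.ext (Category.assoc _ _ _)

variable (M) in
/-- The forgetful functor from cyclic operads to operads. -/
def forget : CyclicOperad M ⥤ Operad M where
  obj P := P.toOperad
  map f := f.hom

end CyclicOperad

end Operads

/-! The forgetful functor `U` from cyclic operads to operads has adjoints on both sides, and the
right adjoint `R` is explicit enough to make the transfer of the model structure almost formal.

The group Aut {0, …, n} is a union of n + 1 cosets of Σₙ, one for each choice of output, so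
coinducing `P(n)` gives a product of n + 1 copies of `P(n)` (`Operad.coind`). These products carry a
cyclic operad structure. To glue a leg of one operation to a leg of another and to read off the
result with a given output, the vertex carrying that output is taken as the root, the other vertex
is turned so that its glued leg is its output, and the two are composed in `P` (`Operad.root`,
`Operad.glue`). Gluing treats both vertices alike, so a single statement, `Operad.glue_assoc`,
contains both associativity axioms. The universal property rests on `CyclicOperad.compatibleAt`: the
axioms of a cyclic operad determine every re-rooting of a composite.

By `Operad.cofree_map_app`, `U R` takes a map to products of copies of itself; hence it preserves
fibrations and trivial fibrations. Through the adjunction `U ⊣ R` this says that `U` sends the maps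
generated by the transferred cells to cofibrations, respectively trivial cofibrations
(`rlp_llp_le_inverseImage`). That is the acyclicity condition for transfer, obtained without path
objects.

The left adjoint is built from formal terms modulo relations (`Operad.freeCyclic`); closedness of
the monoidal structure makes the tensor product compatible with these quotients. Limits of cyclic
operads are levelwise, and `U` is comonadic, so it creates colimits.

What remains is smallness. Since `U` preserves colimits, the free object on `A` is small relative to
maps whose image under `U` lies in a class for which `A` is small. However, `U` is only known to
send new cells into `I.rlp.llp`, not into relative `I`-cell complexes. So smallness has to be
extended from the latter class to the former: a sequence in `I.rlp.llp` is a retract of a sequence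
of relative cell complexes (`exists_retract_relativeCells`), and colimit preservation passes to
retracts. The small object argument attaches many cells at once, while `relativeCells` attaches them
one at a time; well-ordering the cells, refining lexicographically and deleting isomorphisms
reconciles the two (`RelativeCellComplex.relativeCells`). -/

/-! ### Inputs of a partial composite, and equivariance in terms of labels. -/

section Legs

/-- The inputs of a composite `p ∘ᵢ q`, as inputs of `p` or of `q`. -/
def legs {m n k : ℕ} (h : m + n = k + 1) (i : Fin m) (c : Fin k) : Fin m ⊕ Fin n :=
  if h₁ : (c : ℕ) < i then .inl ⟨c, h₁.trans i.2⟩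
  else if h₂ : (c : ℕ) < i + n then .inr ⟨c - i, by omega⟩
  else .inl ⟨c + 1 - n, by omega⟩

variable {m n k : ℕ} (h : m + n = k + 1) (i : Fin m)

theorem legs_eq_inl_iff (c : Fin k) (a : Fin m) :
    legs h i c = .inl a ↔ a ≠ i ∧ (c : ℕ) = outerPos n i a := by
  have := i.2; have := a.2; have := c.2
  unfold legs outerPos
  split_ifs <;> simp only [Sum.inl.injEq, Fin.ext_iff, ne_eq, false_iff, not_and] <;> omega

theorem legs_eq_inr_iff (c : Fin k) (b : Fin n) :
    legs h i c = .inr b ↔ (c : ℕ) = i + b := by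
  have := i.2; have := b.2; have := c.2
  unfold legs
  split_ifs <;> simp only [Sum.inr.injEq, Fin.ext_iff, false_iff] <;> omega

theorem legs_ne (c : Fin k) : legs h i c ≠ .inl i := by
  rw [Ne, legs_eq_inl_iff]; tauto

theorem legs_injective : Function.Injective (legs h i) := by
  intro c c' hc
  cases hx : legs h i c' with
  | inl a =>
    rw [hx] at hc
    rw [legs_eq_inl_iff] at hc hx
    exact Fin.ext (hc.2.trans hx.2.symm)
  | inr b =>
    rw [hx] at hc
    rw [legs_eq_inr_iff] at hc hx
    exact Fin.ext (hc.trans hx.symm)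

theorem exists_legs_eq (x : Fin m ⊕ Fin n) (hx : x ≠ .inl i) : ∃ c, legs h i c = x := by
  have := i.2
  cases x with
  | inl a =>
    have ha : a ≠ i := fun e => hx (e ▸ rfl)
    have ha' : (a : ℕ) ≠ i := fun e => ha (Fin.ext e)
    have := a.2
    refine ⟨⟨outerPos n i a, ?_⟩, (legs_eq_inl_iff ..).2 ⟨ha, rfl⟩⟩
    unfold outerPos; split_ifs <;> omega
  | inr b =>
    have := b.2
    exact ⟨⟨i + b, by omega⟩, (legs_eq_inr_iff ..).2 rfl⟩

/-- An injective map that avoids the input `i` differs from `legs h i` by a permutation. -/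
theorem exists_perm_legs (e : Fin k → Fin m ⊕ Fin n) (he : Function.Injective e)
    (he' : ∀ c, e c ≠ .inl i) : ∃ π : Equiv.Perm (Fin k), ∀ c, legs h i (π c) = e c := by
  choose f hf using fun c => exists_legs_eq h i (e c) (he' c)
  have hinj : Function.Injective f := fun c c' hc => he (by rw [← hf, ← hf, hc])
  exact ⟨Equiv.ofBijective f (Finite.injective_iff_bijective.1 hinj), hf⟩

end Legs

namespace Operad

variable {M : Type u} [Category.{v} M] [MonoidalCategory M] [SymmetricCategory M] (P : Operad M)

/-- The axiom `equivariance`, applied to `π' * π⁻¹`. The hypothesis only tracks which input of which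
factor each input comes from; later comparisons of permutations thereby become comparisons of
injective labellings instead of arithmetic with `outerPos`. -/
theorem comp_act_equivariance {m n k : ℕ} (h : m + n = k + 1) (i j : Fin m)
    (σ : Equiv.Perm (Fin m)) (ρ : Equiv.Perm (Fin n)) (π π' : Equiv.Perm (Fin k)) (hj : σ i = j)
    (H : ∀ c, legs h j (π' c) = Sum.map σ ρ (legs h i (π c))) :
    (P.act σ ⊗ₘ P.act ρ) ≫ P.comp h i ≫ P.act π = P.comp h j ≫ P.act π' := by
  subst hj
  have key : (P.act σ ⊗ₘ P.act ρ) ≫ P.comp h i = P.comp h (σ i) ≫ P.act (π' * π⁻¹) := by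
    apply P.equivariance
    · intro a c ha hc
      have h1 : legs h i (π (π⁻¹ c)) = .inl a := by
        rw [Equiv.Perm.coe_inv, Equiv.apply_symm_apply, legs_eq_inl_iff]; exact ⟨ha, hc⟩
      have h2 := H (π⁻¹ c)
      rw [h1, Sum.map_inl, legs_eq_inl_iff] at h2
      exact h2.2
    · intro b c hc
      have h1 : legs h i (π (π⁻¹ c)) = .inr b := by
        rw [Equiv.Perm.coe_inv, Equiv.apply_symm_apply, legs_eq_inr_iff]; exact hc
      have h2 := H (π⁻¹ c)
      rw [h1, Sum.map_inr, legs_eq_inr_iff] at h2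
      exact h2
  rw [← Category.assoc, key, Category.assoc, ← P.act_mul, inv_mul_cancel_right]

theorem exists_perm_equivariance {m n k : ℕ} (h : m + n = k + 1) (i : Fin m)
    (σ : Equiv.Perm (Fin m)) (ρ : Equiv.Perm (Fin n)) (π : Equiv.Perm (Fin k)) :
    ∃ π' : Equiv.Perm (Fin k), (∀ c, legs h (σ i) (π' c) = Sum.map σ ρ (legs h i (π c))) ∧
      (P.act σ ⊗ₘ P.act ρ) ≫ P.comp h i ≫ P.act π = P.comp h (σ i) ≫ P.act π' := by
  obtain ⟨π', hπ'⟩ := exists_perm_legs h (σ i) (fun c => Sum.map σ ρ (legs h i (π c)))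
    ((Sum.map_injective.2 ⟨σ.injective, ρ.injective⟩).comp
      ((legs_injective h i).comp π.injective)) (fun c hc => by
        cases hx : legs h i (π c) with
        | inl a =>
          rw [hx] at hc
          simp only [Sum.map_inl, Sum.inl.injEq, EmbeddingLike.apply_eq_iff_eq] at hc
          exact legs_ne h i _ (hc ▸ hx)
        | inr b => rw [hx] at hc; simp at hc)
  exact ⟨π', hπ', P.comp_act_equivariance h i _ σ ρ π π' rfl hπ'⟩

theorem act_comp_left {m n k : ℕ} (h : m + n = k + 1) (i : Fin m)
    (σ : Equiv.Perm (Fin m)) (π : Equiv.Perm (Fin k)) :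
    ∃ π' : Equiv.Perm (Fin k), (∀ c, legs h (σ i) (π' c) = Sum.map σ id (legs h i (π c))) ∧
      (P.act σ ▷ _) ≫ P.comp h i ≫ P.act π = P.comp h (σ i) ≫ P.act π' := by
  obtain ⟨π', h1, h2⟩ := P.exists_perm_equivariance h i σ 1 π
  exact ⟨π', h1, by rw [← h2, P.act_one, MonoidalCategory.tensorHom_id]⟩

theorem act_comp_right {m n k : ℕ} (h : m + n = k + 1) (i : Fin m)
    (ρ : Equiv.Perm (Fin n)) (π : Equiv.Perm (Fin k)) :
    ∃ π' : Equiv.Perm (Fin k), (∀ c, legs h i (π' c) = Sum.map id ρ (legs h i (π c))) ∧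
      (_ ◁ P.act ρ) ≫ P.comp h i ≫ P.act π = P.comp h i ≫ P.act π' := by
  obtain ⟨π', h1, h2⟩ := P.exists_perm_equivariance h i 1 ρ π
  exact ⟨π', h1, by rw [← MonoidalCategory.id_tensorHom, ← P.act_one]; exact h2⟩

end Operad

/-! ### Inputs of a double composite, and associativity up to permutations. -/

section TotalLegs

variable {l m n a b k : ℕ}

/-- The inputs of `(p ∘ᵢ q) ∘_c r`. -/
def legsLeft (e : Fin a → Fin l ⊕ Fin m) (f : Fin k → Fin a ⊕ Fin n) (t : Fin k) :
    Fin l ⊕ (Fin m ⊕ Fin n) :=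
  Equiv.sumAssoc _ _ _ (Sum.map e id (f t))

/-- The inputs of `p ∘ᵢ (q ∘ⱼ r)`. -/
def legsRight (e : Fin b → Fin m ⊕ Fin n) (f : Fin k → Fin l ⊕ Fin b) (t : Fin k) :
    Fin l ⊕ (Fin m ⊕ Fin n) :=
  Sum.map id e (f t)

theorem legsLeft_injective {e : Fin a → Fin l ⊕ Fin m} {f : Fin k → Fin a ⊕ Fin n}
    (he : Function.Injective e) (hf : Function.Injective f) :
    Function.Injective (legsLeft e f) :=
  (Equiv.injective _).comp ((Sum.map_injective.2 ⟨he, Function.injective_id⟩).comp hf)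

theorem legs_assoc_seq (hlm : l + m = a + 1) (han : a + n = k + 1)
    (hmn : m + n = b + 1) (hlb : l + b = k + 1) (i : Fin l) (j : Fin m) (c : Fin a)
    (hc : (c : ℕ) = i + j) (t : Fin k) :
    legsLeft (legs hlm i) (legs han c) t = legsRight (legs hmn j) (legs hlb i) t := by
  have := i.2; have := j.2; have := c.2; have := t.2
  unfold legsLeft legsRight
  simp only [legs]
  split_ifs <;> simp only [Sum.map_inl, Sum.map_inr, legs] <;> (try split_ifs) <;>
    simp only [Equiv.sumAssoc_apply_inl_inl, Equiv.sumAssoc_apply_inl_inr,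
      Equiv.sumAssoc_apply_inr, id, Sum.inl.injEq, Sum.inr.injEq, Fin.mk.injEq,
      reduceCtorEq] <;> omega

theorem legs_assoc_par (hlm : l + m = a + 1) (han : a + n = k + 1)
    (hln : l + n = b + 1) (hbm : b + m = k + 1) (i j : Fin l) (hij : i < j)
    (c : Fin a) (d : Fin b) (hc : (c : ℕ) + 1 = j + m) (hd : (d : ℕ) = i) (t : Fin k) :
    legsLeft (legs hlm i) (legs han c) t =
      Sum.map id Sum.swap (legsLeft (legs hln j) (legs hbm d) t) := by
  have := i.2; have := j.2; have := c.2; have := t.2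
  have : (i : ℕ) < j := hij
  unfold legsLeft
  simp only [legs]
  split_ifs <;> simp only [Sum.map_inl, Sum.map_inr, legs] <;> (try split_ifs) <;>
    simp only [Equiv.sumAssoc_apply_inl_inl, Equiv.sumAssoc_apply_inl_inr,
      Equiv.sumAssoc_apply_inr, id, Sum.inl.injEq, Sum.inr.injEq, Fin.mk.injEq,
      Sum.map_inl, Sum.map_inr, Sum.swap_inl, Sum.swap_inr,
      reduceCtorEq] <;> omega

end TotalLegs

namespace Operad

variable {M : Type u} [Category.{v} M] [MonoidalCategory M] [SymmetricCategory M] (P : Operad M)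

/-- All permutations can be moved past the compositions to the outside. The two outer permutations
so obtained induce the same labelling of the inputs by those of the three factors; as labellings are
injective, they agree, and the plain axiom applies. -/
theorem assoc_seq_act {l m n a b k : ℕ} (hlm : l + m = a + 1) (han : a + n = k + 1)
    (hmn : m + n = b + 1) (hlb : l + b = k + 1) (i : Fin l) (j : Fin m) (c : Fin a)
    (π₁ : Equiv.Perm (Fin a)) (π₂ : Equiv.Perm (Fin b)) (π π' : Equiv.Perm (Fin k))
    (hc : legs hlm i (π₁ c) = .inr j)
    (H : ∀ t, legsLeft (legs hlm i ∘ π₁) (legs han c ∘ π) t =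
      legsRight (legs hmn j ∘ π₂) (legs hlb i ∘ π') t) :
    ((P.comp hlm i ≫ P.act π₁) ▷ P.obj n) ≫ P.comp han c ≫ P.act π =
      (α_ (P.obj l) (P.obj m) (P.obj n)).hom ≫ (P.obj l ◁ (P.comp hmn j ≫ P.act π₂)) ≫
        P.comp hlb i ≫ P.act π' := by
  obtain ⟨ρ, hρ, hρ'⟩ := P.act_comp_left han c π₁ π
  obtain ⟨ρ', hρ₁, hρ₁'⟩ := P.act_comp_right hlb i π₂ π'
  rw [comp_whiskerRight, Category.assoc, hρ', MonoidalCategory.whiskerLeft_comp, Category.assoc,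
    hρ₁']
  have hc' := (legs_eq_inr_iff ..).1 hc
  have e : ρ = ρ' := by
    ext1 t
    apply legsLeft_injective (legs_injective hlm i) (legs_injective han (π₁ c))
    have h1 := H t
    rw [legs_assoc_seq hlm han hmn hlb i j (π₁ c) hc' (ρ' t)]
    simp only [legsLeft, legsRight, Function.comp] at h1 ⊢
    rw [hρ, hρ₁]
    simp only [Sum.map_map] at h1 ⊢
    exact h1
  rw [e, ← Category.assoc, P.assoc_seq hlm han hmn hlb i j (π₁ c) hc']
  simp only [Category.assoc]

theorem assoc_par_act_of_lt {l m n a b k : ℕ} (hlm : l + m = a + 1) (han : a + n = k + 1)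
    (hln : l + n = b + 1) (hbm : b + m = k + 1) (i j : Fin l) (hij : i < j) (c : Fin a) (d : Fin b)
    (π₁ : Equiv.Perm (Fin a)) (π₂ : Equiv.Perm (Fin b)) (π π' : Equiv.Perm (Fin k))
    (hc : legs hlm i (π₁ c) = .inl j) (hd : legs hln j (π₂ d) = .inl i)
    (H : ∀ t, legsLeft (legs hlm i ∘ π₁) (legs han c ∘ π) t =
      Sum.map id Sum.swap (legsLeft (legs hln j ∘ π₂) (legs hbm d ∘ π') t)) :
    ((P.comp hlm i ≫ P.act π₁) ▷ P.obj n) ≫ P.comp han c ≫ P.act π =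
      (α_ (P.obj l) (P.obj m) (P.obj n)).hom ≫ (P.obj l ◁ (β_ (P.obj m) (P.obj n)).hom) ≫
        (α_ (P.obj l) (P.obj n) (P.obj m)).inv ≫ ((P.comp hln j ≫ P.act π₂) ▷ P.obj m) ≫
        P.comp hbm d ≫ P.act π' := by
  obtain ⟨ρ, hρ, hρ'⟩ := P.act_comp_left han c π₁ π
  obtain ⟨ρ', hρ₁, hρ₁'⟩ := P.act_comp_left hbm d π₂ π'
  rw [comp_whiskerRight, Category.assoc, hρ', comp_whiskerRight, Category.assoc, hρ₁']
  have hij' : (i : ℕ) < j := hij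
  have hc' : (π₁ c : ℕ) + 1 = j + m := by
    have := ((legs_eq_inl_iff ..).1 hc).2
    unfold outerPos at this
    split_ifs at this <;> omega
  have hd' : (π₂ d : ℕ) = i := by
    have := ((legs_eq_inl_iff ..).1 hd).2
    unfold outerPos at this
    split_ifs at this <;> omega
  have e : ρ = ρ' := by
    ext1 t
    apply legsLeft_injective (legs_injective hlm i) (legs_injective han (π₁ c))
    have h1 := H t
    rw [legs_assoc_par hlm han hln hbm i j hij _ _ hc' hd' (ρ' t)]
    simp only [legsLeft, Function.comp] at h1 ⊢
    rw [hρ, hρ₁]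
    simp only [Sum.map_map] at h1 ⊢
    exact h1
  rw [e, ← Category.assoc, P.assoc_par hlm han hln hbm i j hij _ _ hc' hd']
  simp only [Category.assoc]

/-- No order between `i` and `j` is needed: the statement is symmetric under exchanging the two
inner operations, and `i = j` is impossible because the input `i` has been used up by the first
composition. -/
theorem assoc_par_act {l m n a b k : ℕ} (hlm : l + m = a + 1) (han : a + n = k + 1)
    (hln : l + n = b + 1) (hbm : b + m = k + 1) (i j : Fin l) (c : Fin a) (d : Fin b)
    (π₁ : Equiv.Perm (Fin a)) (π₂ : Equiv.Perm (Fin b)) (π π' : Equiv.Perm (Fin k))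
    (hc : legs hlm i (π₁ c) = .inl j) (hd : legs hln j (π₂ d) = .inl i)
    (H : ∀ t, legsLeft (legs hlm i ∘ π₁) (legs han c ∘ π) t =
      Sum.map id Sum.swap (legsLeft (legs hln j ∘ π₂) (legs hbm d ∘ π') t)) :
    ((P.comp hlm i ≫ P.act π₁) ▷ P.obj n) ≫ P.comp han c ≫ P.act π =
      (α_ (P.obj l) (P.obj m) (P.obj n)).hom ≫ (P.obj l ◁ (β_ (P.obj m) (P.obj n)).hom) ≫
        (α_ (P.obj l) (P.obj n) (P.obj m)).inv ≫ ((P.comp hln j ≫ P.act π₂) ▷ P.obj m) ≫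
        P.comp hbm d ≫ P.act π' := by
  rcases lt_trichotomy i j with hij | hij | hij
  · exact P.assoc_par_act_of_lt hlm han hln hbm i j hij c d π₁ π₂ π π' hc hd H
  · exact absurd hij.symm ((legs_eq_inl_iff ..).1 hc).1
  · rw [P.assoc_par_act_of_lt hln hbm hlm han j i hij d c π₂ π₁ π' π hd hc (fun t => by
      rw [H, Sum.map_map, Sum.swap_swap_eq, Function.comp_id, Sum.map_id_id, id])]
    simp [← MonoidalCategory.whiskerLeft_comp_assoc]

end Operad

/-! ### Cosets of the permutations that fix the output. -/

section Permutations

/-- The extension of a permutation of the inputs to a permutation of the output and the inputs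
that fixes the output. -/
def extendPerm {n : ℕ} (σ : Equiv.Perm (Fin n)) : Equiv.Perm (Fin (n + 1)) :=
  Equiv.Perm.decomposeFin.symm (0, σ)

variable {n : ℕ}

@[simp]
theorem extendPerm_zero (σ : Equiv.Perm (Fin n)) : extendPerm σ 0 = 0 := by
  simp [extendPerm]

@[simp]
theorem extendPerm_succ (σ : Equiv.Perm (Fin n)) (a : Fin n) :
    extendPerm σ a.succ = (σ a).succ := by
  simp [extendPerm]

@[simp]
theorem extendPerm_one : extendPerm (1 : Equiv.Perm (Fin n)) = 1 := by
  ext1 a; cases a using Fin.cases <;> simp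

theorem extendPerm_mul (σ ρ : Equiv.Perm (Fin n)) :
    extendPerm (σ * ρ) = extendPerm σ * extendPerm ρ := by
  ext1 a; cases a using Fin.cases <;> simp

/-- A permutation is a transposition that moves `0`, followed by a permutation that fixes `0`. -/
def restPerm (σ : Equiv.Perm (Fin (n + 1))) : Equiv.Perm (Fin n) :=
  (Equiv.Perm.decomposeFin σ).2

theorem swap_mul_extendPerm_restPerm (σ : Equiv.Perm (Fin (n + 1))) :
    Equiv.swap 0 (σ 0) * extendPerm (restPerm σ) = σ := by
  obtain ⟨⟨p, e⟩, rfl⟩ := Equiv.Perm.decomposeFin.symm.surjective σ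
  ext1 a
  cases a using Fin.cases <;> simp [restPerm]

theorem extendPerm_injective : Function.Injective (extendPerm (n := n)) := fun σ ρ h => by
  ext1 a
  have := congrArg (fun f => f a.succ) h
  simpa using this

theorem exists_eq_extendPerm (σ : Equiv.Perm (Fin (n + 1))) (h : σ 0 = 0) :
    ∃ ρ, σ = extendPerm ρ :=
  ⟨restPerm σ, by
    conv_lhs => rw [← swap_mul_extendPerm_restPerm σ, h, Equiv.swap_self]
    rfl⟩

/-- Left cosets of the stabilizer of `0` are separated by the image of `0`. This is why a coinduced
object needs only one factor per leg, and why statements about all permutations reduce to one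
permutation for each image of `0`. -/
theorem exists_eq_mul_extendPerm (σ σ' : Equiv.Perm (Fin (n + 1))) (h : σ 0 = σ' 0) :
    ∃ ρ, σ' = σ * extendPerm ρ := by
  obtain ⟨ρ, hρ⟩ := exists_eq_extendPerm (σ⁻¹ * σ') (by
    rw [Equiv.Perm.mul_apply, ← h, Equiv.Perm.inv_def, Equiv.symm_apply_apply])
  exact ⟨ρ, by rw [← hρ, mul_inv_cancel_left]⟩

theorem exists_succ_of_ne (σ : Equiv.Perm (Fin (n + 1))) (x : Fin (n + 1)) (h : x ≠ σ 0) :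
    ∃ a : Fin n, σ a.succ = x := by
  obtain ⟨a, ha⟩ := σ.surjective x
  cases a using Fin.cases with
  | zero => exact absurd ha.symm h
  | succ a => exact ⟨a, ha⟩

end Permutations

/-! ### Combinatorics of gluing two vertices along a leg. -/

section Glue

variable {m n k : ℕ}

/-- `e` identifies the legs `0, …, k` with those of two vertices with legs `0, …, m` and
`0, …, n`, except for the leg `x` of the first and the leg `y` of the second vertex. -/
structure IsGlue (x : Fin (m + 1)) (y : Fin (n + 1))
    (e : Fin (k + 1) → Fin (m + 1) ⊕ Fin (n + 1)) : Prop where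
  inj : Function.Injective e
  ne_left : ∀ c, e c ≠ .inl x
  ne_right : ∀ c, e c ≠ .inr y

variable {x : Fin (m + 1)} {y : Fin (n + 1)} {e : Fin (k + 1) → Fin (m + 1) ⊕ Fin (n + 1)}

theorem IsGlue.comp_perm (he : IsGlue x y e) (σ : Equiv.Perm (Fin (k + 1))) :
    IsGlue x y (e ∘ σ) :=
  ⟨he.inj.comp σ.injective, fun _ => he.ne_left _, fun _ => he.ne_right _⟩

theorem IsGlue.swap (he : IsGlue x y e) : IsGlue y x (Sum.swap ∘ e) :=
  ⟨(Equiv.sumComm _ _).injective.comp he.inj,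
    fun c hc => he.ne_right c (by rw [← Sum.swap_swap (e c)]; exact congrArg Sum.swap hc),
    fun c hc => he.ne_left c (by rw [← Sum.swap_swap (e c)]; exact congrArg Sum.swap hc)⟩

theorem IsGlue.map (he : IsGlue x y e) (σ : Equiv.Perm (Fin (m + 1)))
    (ρ : Equiv.Perm (Fin (n + 1))) : IsGlue (σ x) (ρ y) (Sum.map σ ρ ∘ e) where
  inj := (Sum.map_injective.2 ⟨σ.injective, ρ.injective⟩).comp he.inj
  ne_left c hc := by
    cases hx : e c with
    | inl a =>
      simp only [Function.comp, hx, Sum.map_inl, Sum.inl.injEq, EmbeddingLike.apply_eq_iff_eq] at hc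
      exact he.ne_left c (hc ▸ hx)
    | inr b => simp [hx] at hc
  ne_right c hc := by
    cases hx : e c with
    | inl a => simp [hx] at hc
    | inr b =>
      simp only [Function.comp, hx, Sum.map_inr, Sum.inr.injEq, EmbeddingLike.apply_eq_iff_eq] at hc
      exact he.ne_right c (hc ▸ hx)

/-- The leg `0` of the glued object belongs to the first vertex; after the rotations `α` and `β`
of the vertices, gluing is the composition at the input `j`, followed by `π`. -/
structure IsRooted (h : m + n = k + 1) (x : Fin (m + 1)) (y : Fin (n + 1))
    (e : Fin (k + 1) → Fin (m + 1) ⊕ Fin (n + 1)) (α : Equiv.Perm (Fin (m + 1)))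
    (β : Equiv.Perm (Fin (n + 1))) (j : Fin m) (π : Equiv.Perm (Fin k)) : Prop where
  root : e 0 = .inl (α 0)
  left : α j.succ = x
  right : β 0 = y
  legs (c : Fin k) : e c.succ = Sum.map (α ∘ Fin.succ) (β ∘ Fin.succ) (legs h j (π c))

theorem succ_map_injective (α : Equiv.Perm (Fin (m + 1))) (β : Equiv.Perm (Fin (n + 1))) :
    Function.Injective (Sum.map (α ∘ Fin.succ) (β ∘ Fin.succ) :
      Fin m ⊕ Fin n → Fin (m + 1) ⊕ Fin (n + 1)) :=
  Sum.map_injective.2 ⟨α.injective.comp (Fin.succ_injective m),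
    β.injective.comp (Fin.succ_injective n)⟩

/-- Apart from `0`, the labels avoid the root `α 0` and the glued legs `x` and `y`. So they are
inputs of the two turned vertices other than the input at which these are composed, and
`exists_perm_legs` supplies `π`. -/
theorem IsGlue.exists_isRooted (h : m + n = k + 1) (he : IsGlue x y e)
    (α : Equiv.Perm (Fin (m + 1))) (β : Equiv.Perm (Fin (n + 1))) (hα : e 0 = .inl (α 0))
    (hβ : β 0 = y) : ∃ j π, IsRooted h x y e α β j π := by
  obtain ⟨j, hj⟩ := exists_succ_of_ne α x (fun hx => he.ne_left 0 (by rw [hα, hx]))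
  have : ∀ c : Fin k, ∃ z, Sum.map (α ∘ Fin.succ) (β ∘ Fin.succ) z = e c.succ := fun c => by
    cases hz : e c.succ with
    | inl a =>
      obtain ⟨a', ha'⟩ := exists_succ_of_ne α a (fun ha =>
        Fin.succ_ne_zero c (he.inj (by rw [hz, hα, ha])))
      exact ⟨.inl a', by simp [ha']⟩
    | inr b =>
      obtain ⟨b', hb'⟩ := exists_succ_of_ne β b (fun hb =>
        he.ne_right c.succ (by rw [hz, hb, hβ]))
      exact ⟨.inr b', by simp [hb']⟩
  choose f hf using this
  obtain ⟨π, hπ⟩ := exists_perm_legs h j f (fun c c' hc => by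
      apply Fin.succ_injective; apply he.inj; rw [← hf, ← hf, hc])
    (fun c hc => he.ne_left c.succ (by rw [← hf, hc, ← hj]; rfl))
  exact ⟨j, π, hα, hj, hβ, fun c => by rw [hπ, hf]⟩

theorem IsRooted.comp_extendPerm {h : m + n = k + 1} {α : Equiv.Perm (Fin (m + 1))}
    {β : Equiv.Perm (Fin (n + 1))} {j : Fin m} {π : Equiv.Perm (Fin k)}
    (H : IsRooted h x y e α β j π) (ρ : Equiv.Perm (Fin k)) :
    IsRooted h x y (e ∘ extendPerm ρ) α β j (π * ρ) :=
  ⟨by simp [H.root], H.left, H.right, fun c => by simp [H.legs]⟩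

theorem IsRooted.map {h : m + n = k + 1} {α : Equiv.Perm (Fin (m + 1))}
    {β : Equiv.Perm (Fin (n + 1))} {j : Fin m} {π : Equiv.Perm (Fin k)}
    (H : IsRooted h x y e α β j π) (σ : Equiv.Perm (Fin (m + 1)))
    (ρ : Equiv.Perm (Fin (n + 1))) :
    IsRooted h (σ x) (ρ y) (Sum.map σ ρ ∘ e) (σ * α) (ρ * β) j π :=
  ⟨by simp [H.root], by simp [H.left], by simp [H.right], fun c => by
    simp only [Function.comp, H.legs, Sum.map_map]
    congr 1⟩

end Glue

/-! ### Coinduction, and the operation underlying a gluing. -/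

namespace Operad

variable {M : Type u} [Category.{v} M] [MonoidalCategory M] [SymmetricCategory M]
  [HasFiniteProducts M] (P : Operad M)

/-- The operations of arity `n` of the cofree cyclic operad: a family of operations of `P`,
indexed by the choice of the output among `0, …, n`. -/
noncomputable abbrev coind (n : ℕ) : M := ∏ᶜ fun _ : Fin (n + 1) => P.obj n

/-- The operation of `P` underlying `p · σ`. -/
noncomputable def prj {n : ℕ} (σ : Equiv.Perm (Fin (n + 1))) : P.coind n ⟶ P.obj n :=
  Pi.π (fun _ : Fin (n + 1) => P.obj n) (σ 0) ≫ P.act (restPerm σ)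

/-- Uniqueness of the decomposition into a transposition and a permutation fixing `0`. With
`coind_ext` and `coindLift_prj` it lets `P.coind n` be treated as the object of all Σₙ-equivariant
families indexed by Aut {0, …, n}, with no further reference to coset representatives. -/
theorem prj_mul_extendPerm {n : ℕ} (σ : Equiv.Perm (Fin (n + 1))) (ρ : Equiv.Perm (Fin n)) :
    P.prj (σ * extendPerm ρ) = P.prj σ ≫ P.act ρ := by
  have h0 : (σ * extendPerm ρ) 0 = σ 0 := by simp
  have : restPerm (σ * extendPerm ρ) = restPerm σ * ρ := by
    apply extendPerm_injective
    have := swap_mul_extendPerm_restPerm (σ * extendPerm ρ)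
    rw [h0] at this
    conv_rhs at this => rw [← swap_mul_extendPerm_restPerm σ]
    rw [mul_assoc] at this
    rw [mul_left_cancel this, extendPerm_mul]
  unfold prj
  rw [this, P.act_mul, h0, Category.assoc]

theorem prj_swap {n : ℕ} (a : Fin (n + 1)) :
    P.prj (Equiv.swap 0 a) = Pi.π (fun _ : Fin (n + 1) => P.obj n) a := by
  have : restPerm (Equiv.swap 0 a) = 1 := by
    apply extendPerm_injective
    have := swap_mul_extendPerm_restPerm (Equiv.swap 0 a)
    rw [Equiv.swap_apply_left] at this
    rw [extendPerm_one]
    exact mul_left_cancel (this.trans (mul_one _).symm)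
  unfold prj
  rw [this, P.act_one, Equiv.swap_apply_left, Category.comp_id]

variable {P} in
theorem coind_ext {n : ℕ} {X : M} {f g : X ⟶ P.coind n}
    (h : ∀ σ, f ≫ P.prj σ = g ≫ P.prj σ) : f = g :=
  Limits.Pi.hom_ext _ _ fun a => by simpa only [prj_swap] using h (Equiv.swap 0 a)

/-- The map to `P.coind n` given by an equivariant family. -/
noncomputable def coindLift {n : ℕ} {X : M} (g : Equiv.Perm (Fin (n + 1)) → (X ⟶ P.obj n)) :
    X ⟶ P.coind n :=
  Pi.lift fun a => g (Equiv.swap 0 a)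

theorem coindLift_prj {n : ℕ} {X : M} (g : Equiv.Perm (Fin (n + 1)) → (X ⟶ P.obj n))
    (hg : ∀ σ ρ, g (σ * extendPerm ρ) = g σ ≫ P.act ρ) (σ : Equiv.Perm (Fin (n + 1))) :
    P.coindLift g ≫ P.prj σ = g σ := by
  obtain ⟨ρ, hρ⟩ := exists_eq_mul_extendPerm (Equiv.swap 0 (σ 0)) σ (by simp)
  rw [hρ, prj_mul_extendPerm, prj_swap, hg]
  simp [coindLift]

section Root

variable {m n k : ℕ} (h : m + n = k + 1) {x : Fin (m + 1)} {y : Fin (n + 1)}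
  {e : Fin (k + 1) → Fin (m + 1) ⊕ Fin (n + 1)}

/-- Two ways of turning the vertices have the same root and the same glued legs, so they differ by
permutations of the inputs, which equivariance in `P` absorbs. Consequently `root` may be computed
with any convenient choice in `root_eq_left` and `root_eq_right`. -/
theorem isRooted_indep {α α' : Equiv.Perm (Fin (m + 1))} {β β' : Equiv.Perm (Fin (n + 1))}
    {j j' : Fin m} {π π' : Equiv.Perm (Fin k)} (H : IsRooted h x y e α β j π)
    (H' : IsRooted h x y e α' β' j' π') :
    (P.prj α ⊗ₘ P.prj β) ≫ P.comp h j ≫ P.act π =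
      (P.prj α' ⊗ₘ P.prj β') ≫ P.comp h j' ≫ P.act π' := by
  obtain ⟨s, rfl⟩ := exists_eq_mul_extendPerm α α' (Sum.inl_injective (H.root.symm.trans H'.root))
  obtain ⟨r, rfl⟩ := exists_eq_mul_extendPerm β β' (H.right.trans H'.right.symm)
  have hj : s j' = j := by
    have := H'.left.trans H.left.symm
    simpa using this
  rw [prj_mul_extendPerm, prj_mul_extendPerm, ← MonoidalCategory.tensorHom_comp_tensorHom,
    Category.assoc, P.comp_act_equivariance h j' j s r π' π hj]
  intro c
  apply succ_map_injective α β
  rw [← H.legs, H'.legs, Sum.map_map]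
  congr 1

open Classical in
/-- The operation with output `e 0` that is obtained by gluing the legs `x` and `y`. -/
noncomputable def root (he : IsGlue x y e) : P.coind m ⊗ P.coind n ⟶ P.obj k :=
  if H : ∃ a, e 0 = .inl a then
    have H' := he.exists_isRooted h (Equiv.swap 0 H.choose) (Equiv.swap 0 y)
      (by rw [Equiv.swap_apply_left]; exact H.choose_spec) (Equiv.swap_apply_left _ _)
    (P.prj (Equiv.swap 0 H.choose) ⊗ₘ P.prj (Equiv.swap 0 y)) ≫ P.comp h H'.choose ≫
      P.act H'.choose_spec.choose
  else
    have K : ∃ b, e 0 = .inr b := by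
      cases hb : e 0 with
      | inl a => exact absurd ⟨a, hb⟩ H
      | inr b => exact ⟨b, rfl⟩
    have H' := he.swap.exists_isRooted ((Nat.add_comm n m).trans h)
      (Equiv.swap 0 K.choose) (Equiv.swap 0 x)
      (by rw [Equiv.swap_apply_left]; exact congrArg Sum.swap K.choose_spec)
      (Equiv.swap_apply_left _ _)
    (β_ _ _).hom ≫ (P.prj (Equiv.swap 0 K.choose) ⊗ₘ P.prj (Equiv.swap 0 x)) ≫
      P.comp ((Nat.add_comm n m).trans h) H'.choose ≫ P.act H'.choose_spec.choose

theorem root_eq_left (he : IsGlue x y e) {α : Equiv.Perm (Fin (m + 1))}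
    {β : Equiv.Perm (Fin (n + 1))} {j : Fin m} {π : Equiv.Perm (Fin k)}
    (H : IsRooted h x y e α β j π) :
    P.root h he = (P.prj α ⊗ₘ P.prj β) ≫ P.comp h j ≫ P.act π := by
  unfold root
  have K : ∃ a, e 0 = .inl a := ⟨_, H.root⟩
  rw [dif_pos K]
  exact P.isRooted_indep h (he.exists_isRooted h (Equiv.swap 0 K.choose) (Equiv.swap 0 y)
    (by rw [Equiv.swap_apply_left]; exact K.choose_spec)
    (Equiv.swap_apply_left _ _)).choose_spec.choose_spec H

theorem root_eq_right (he : IsGlue x y e) {α : Equiv.Perm (Fin (m + 1))}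
    {β : Equiv.Perm (Fin (n + 1))} {j : Fin n} {π : Equiv.Perm (Fin k)}
    (h' : n + m = k + 1) (H : IsRooted h' y x (Sum.swap ∘ e) β α j π) :
    P.root h he = (β_ _ _).hom ≫ (P.prj β ⊗ₘ P.prj α) ≫ P.comp h' j ≫ P.act π := by
  have h0 : e 0 = .inr (β 0) := by
    rw [← Sum.swap_swap (e 0)]; exact congrArg Sum.swap H.root
  unfold root
  have K : ∃ b, e 0 = .inr b := ⟨_, h0⟩
  rw [dif_neg (by simp [h0])]
  refine congrArg ((β_ _ _).hom ≫ ·) ?_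
  exact P.isRooted_indep _ (he.swap.exists_isRooted h' (Equiv.swap 0 K.choose) (Equiv.swap 0 x)
    (by rw [Equiv.swap_apply_left]; exact congrArg Sum.swap K.choose_spec)
    (Equiv.swap_apply_left _ _)).choose_spec.choose_spec H

/-- Exchanging the vertices interchanges the two cases in the definition of `root`; the braiding in
the second case records this. -/
theorem root_symm (he : IsGlue x y e) (h' : n + m = k + 1) :
    P.root h he = (β_ _ _).hom ≫ P.root h' he.swap := by
  cases h0 : e 0 with
  | inl a =>
    obtain ⟨j, π, H⟩ := he.exists_isRooted h (Equiv.swap 0 a) (Equiv.swap 0 y)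
      (by simp [h0]) (by simp)
    rw [P.root_eq_left h he H, P.root_eq_right h' he.swap h (by
      simpa only [← Function.comp_assoc, Sum.swap_swap_eq, Function.id_comp] using H)]
    simp
  | inr b =>
    obtain ⟨j, π, H⟩ := he.swap.exists_isRooted h' (Equiv.swap 0 b) (Equiv.swap 0 x)
      (by simp [h0]) (by simp)
    rw [P.root_eq_right h he h' H, P.root_eq_left h' he.swap H]

end Root

end Operad

/-! ### Rearrangements in a symmetric monoidal category. -/

section Coherence

variable {M : Type u} [Category.{v} M] [MonoidalCategory M] [SymmetricCategory M]
  {A B C A' B' C' X Y Z : M} (f : A ⟶ A') (g : B ⟶ B') (w : C ⟶ C')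

/-- Carries a parallel associativity `key`, with the middle factor as root, to the form needed when
both outer factors are plugged into it and the factors are listed in their original order. -/
theorem middle_coherence {u : B' ⊗ A' ⟶ X} {u' : X ⊗ C' ⟶ Z} {v : B' ⊗ C' ⟶ Y}
    {v' : Y ⊗ A' ⟶ Z}
    (key : (u ▷ C') ≫ u' =
      (α_ _ _ _).hom ≫ (B' ◁ (β_ _ _).hom) ≫ (α_ _ _ _).inv ≫ (v ▷ A') ≫ v') :
    (((β_ A B).hom ≫ (g ⊗ₘ f) ≫ u) ⊗ₘ w) ≫ u' =
      (α_ _ _ _).hom ≫ (β_ _ _).hom ≫ (((g ⊗ₘ w) ≫ v) ⊗ₘ f) ≫ v' := by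
  have e1 : (((β_ A B).hom ≫ (g ⊗ₘ f) ≫ u) ⊗ₘ w) =
      ((β_ A B).hom ▷ C) ≫ ((g ⊗ₘ f) ⊗ₘ w) ≫ (u ▷ C') := by
    simp only [MonoidalCategory.tensorHom_def, comp_whiskerRight, Category.assoc,
      ← whisker_exchange, MonoidalCategory.tensor_whiskerLeft]
  have e2 : (((g ⊗ₘ w) ≫ v) ⊗ₘ f) = ((g ⊗ₘ w) ⊗ₘ f) ≫ (v ▷ A') := by
    rw [← MonoidalCategory.tensorHom_id, MonoidalCategory.tensorHom_comp_tensorHom,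
      Category.comp_id]
  have e3 : ((g ⊗ₘ f) ⊗ₘ w) ≫ (α_ _ _ _).hom ≫ (B' ◁ (β_ _ _).hom) ≫ (α_ _ _ _).inv =
      (α_ _ _ _).hom ≫ (B ◁ (β_ _ _).hom) ≫ (α_ _ _ _).inv ≫ ((g ⊗ₘ w) ⊗ₘ f) := by
    rw [MonoidalCategory.associator_naturality_assoc, ← MonoidalCategory.associator_inv_naturality,
      ← MonoidalCategory.id_tensorHom, ← MonoidalCategory.id_tensorHom,
      MonoidalCategory.tensorHom_comp_tensorHom_assoc,
      MonoidalCategory.tensorHom_comp_tensorHom_assoc, BraidedCategory.braiding_naturality,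
      Category.comp_id, Category.id_comp]
  have e4 := BraidedCategory.hexagon_forward A B C
  rw [e1, e2, Category.assoc, Category.assoc, key, Category.assoc]
  have e3' := congrArg (fun z => z ≫ (v ▷ A') ≫ v') e3
  simp only [Category.assoc] at e3'
  rw [e3', ← reassoc_of% e4, Iso.hom_inv_id_assoc]

/-- The analogue with the last factor as root: the sequential associativity `key` has the three
factors in reverse order, and the Yang–Baxter equation compares the two ways of reversing them. -/
theorem right_coherence {u : B' ⊗ A' ⟶ X} {u' : C' ⊗ X ⟶ Z} {v : C' ⊗ B' ⟶ Y}
    {v' : Y ⊗ A' ⟶ Z}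
    (key : (v ▷ A') ≫ v' = (α_ _ _ _).hom ≫ (C' ◁ u) ≫ u') :
    (β_ _ _).hom ≫ (w ⊗ₘ ((β_ A B).hom ≫ (g ⊗ₘ f) ≫ u)) ≫ u' =
      (α_ _ _ _).hom ≫ (β_ _ _).hom ≫ (((β_ B C).hom ≫ (w ⊗ₘ g) ≫ v) ⊗ₘ f) ≫ v' := by
  have e1 : (((β_ B C).hom ≫ (w ⊗ₘ g) ≫ v) ⊗ₘ f) =
      ((β_ B C).hom ▷ A) ≫ ((w ⊗ₘ g) ⊗ₘ f) ≫ (v ▷ A') := by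
    simp only [MonoidalCategory.tensorHom_def, comp_whiskerRight, Category.assoc,
      ← whisker_exchange, MonoidalCategory.tensor_whiskerLeft]
  have e2 : (w ⊗ₘ ((β_ A B).hom ≫ (g ⊗ₘ f) ≫ u)) =
      (C ◁ (β_ A B).hom) ≫ (w ⊗ₘ (g ⊗ₘ f)) ≫ (C' ◁ u) := by
    rw [← MonoidalCategory.id_tensorHom, ← MonoidalCategory.id_tensorHom,
      MonoidalCategory.tensorHom_comp_tensorHom, MonoidalCategory.tensorHom_comp_tensorHom,
      Category.comp_id, Category.id_comp]
  rw [e1, e2]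
  simp only [Category.assoc]
  rw [key, MonoidalCategory.associator_naturality_assoc]
  simp only [← Category.assoc]
  congr 3
  simp [← BraidedCategory.yang_baxter]

theorem par_coherence :
    ((β_ A B).hom ▷ C) ≫ (α_ B A C).hom =
      (α_ A B C).hom ≫ (A ◁ (β_ B C).hom) ≫ (α_ A C B).inv ≫ (β_ (A ⊗ C) B).hom := by
  have e := BraidedCategory.hexagon_forward B A C
  rw [← cancel_mono (β_ B (A ⊗ C)).hom, ← cancel_mono (α_ A C B).hom, Category.assoc,
    Category.assoc, e, ← comp_whiskerRight_assoc, SymmetricCategory.symmetry, id_whiskerRight,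
    Category.id_comp]
  simp only [Category.assoc, SymmetricCategory.symmetry_assoc, Iso.inv_hom_id, Category.comp_id]

end Coherence

/-! ### Labels of double composites under relabelling and exchange of factors. -/

section TotalLegs

variable {l m n a b k l' m' n' a' b' k' : ℕ}

theorem legsLeft_map {e : Fin a → Fin l ⊕ Fin m} {e' : Fin a' → Fin l' ⊕ Fin m'}
    {f : Fin k → Fin a ⊕ Fin n} {f' : Fin k' → Fin a' ⊕ Fin n'}
    {A : Fin l' → Fin l} {B : Fin m' → Fin m} {G : Fin n' → Fin n} {E : Fin a' → Fin a}
    (he : ∀ c, e (E c) = Sum.map A B (e' c)) {t : Fin k} {t' : Fin k'}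
    (hf : f t = Sum.map E G (f' t')) :
    legsLeft e f t = Sum.map A (Sum.map B G) (legsLeft e' f' t') := by
  simp only [legsLeft, hf]
  cases f' t' with
  | inr c => rfl
  | inl c =>
    simp only [Sum.map_inl, he]
    cases e' c <;> rfl

theorem legsRight_map {e : Fin b → Fin m ⊕ Fin n} {e' : Fin b' → Fin m' ⊕ Fin n'}
    {f : Fin k → Fin l ⊕ Fin b} {f' : Fin k' → Fin l' ⊕ Fin b'}
    {A : Fin l' → Fin l} {B : Fin m' → Fin m} {G : Fin n' → Fin n} {E : Fin b' → Fin b}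
    (he : ∀ c, e (E c) = Sum.map B G (e' c)) {t : Fin k} {t' : Fin k'}
    (hf : f t = Sum.map A E (f' t')) :
    legsRight e f t = Sum.map A (Sum.map B G) (legsRight e' f' t') := by
  simp only [legsRight, hf]
  cases f' t' with
  | inl c => rfl
  | inr c =>
    simp only [Sum.map_inr, he]

theorem legs_map_injective {A : Fin l' → Fin l} {B : Fin m' → Fin m} {G : Fin n' → Fin n}
    (hA : Function.Injective A) (hB : Function.Injective B) (hG : Function.Injective G) :
    Function.Injective (Sum.map A (Sum.map B G)) :=
  Sum.map_injective.2 ⟨hA, Sum.map_injective.2 ⟨hB, hG⟩⟩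

variable {e : Fin a → Fin l ⊕ Fin m} {f : Fin k → Fin a ⊕ Fin n}
    {e₂ : Fin b → Fin m ⊕ Fin n} {f₂ : Fin k → Fin l ⊕ Fin b} {t : Fin k}

theorem legsLeft_swap_left (H : legsLeft e f t = legsRight e₂ f₂ t) :
    legsLeft (Sum.swap ∘ e) f t = Sum.map id Sum.swap (legsLeft e₂ (Sum.swap ∘ f₂) t) := by
  simp only [legsLeft, legsRight, Function.comp] at H ⊢
  rcases h1 : f t with c | c <;> rcases h2 : f₂ t with d | d <;>
    simp only [h1, h2, Sum.map_inl, Sum.map_inr, Sum.swap_inl, Sum.swap_inr] at H ⊢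
  · rcases h3 : e c with p | p <;> simp_all
  · rcases h3 : e c with p | p <;> rcases h4 : e₂ d with q | q <;> simp_all
  · simp_all
  · rcases h4 : e₂ d with q | q <;> simp_all

theorem legsLeft_swap_swap (H : legsLeft e f t = legsRight e₂ f₂ t) :
    legsLeft (Sum.swap ∘ e₂) (Sum.swap ∘ f₂) t = legsRight (Sum.swap ∘ e) (Sum.swap ∘ f) t := by
  simp only [legsLeft, legsRight, Function.comp] at H ⊢
  rcases h1 : f t with c | c <;> rcases h2 : f₂ t with d | d <;>
    simp only [h1, h2, Sum.map_inl, Sum.map_inr, Sum.swap_inl, Sum.swap_inr] at H ⊢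
  · rcases h3 : e c with p | p <;> simp_all
  · rcases h3 : e c with p | p <;> rcases h4 : e₂ d with q | q <;> simp_all
  · simp_all
  · rcases h4 : e₂ d with q | q <;> simp_all

end TotalLegs

/-! ### Gluing in the coinduced objects, and its associativity. -/

namespace Operad

variable {M : Type u} [Category.{v} M] [MonoidalCategory M] [SymmetricCategory M]
  [HasFiniteProducts M] (P : Operad M)

section Glue

variable {m n k : ℕ} (h : m + n = k + 1) {x : Fin (m + 1)} {y : Fin (n + 1)}
  {e : Fin (k + 1) → Fin (m + 1) ⊕ Fin (n + 1)}

theorem root_congr {x' : Fin (m + 1)} {y' : Fin (n + 1)}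
    {e' : Fin (k + 1) → Fin (m + 1) ⊕ Fin (n + 1)} (he : IsGlue x y e) (he' : IsGlue x' y' e')
    (hx : x = x') (hy : y = y') (h' : ∀ c, e c = e' c) : P.root h he = P.root h he' := by
  subst hx hy
  obtain rfl : e = e' := funext h'
  rfl

theorem root_comp_extendPerm (he : IsGlue x y e) (ρ : Equiv.Perm (Fin k)) :
    P.root h (he.comp_perm (extendPerm ρ)) = P.root h he ≫ P.act ρ := by
  cases h0 : e 0 with
  | inl a =>
    obtain ⟨j, π, H⟩ := he.exists_isRooted h (Equiv.swap 0 a) (Equiv.swap 0 y)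
      (by simp [h0]) (by simp)
    rw [P.root_eq_left h he H, P.root_eq_left h _ (H.comp_extendPerm ρ), P.act_mul]
    simp
  | inr b =>
    have h' := (Nat.add_comm n m).trans h
    obtain ⟨j, π, H⟩ := he.swap.exists_isRooted h' (Equiv.swap 0 b) (Equiv.swap 0 x)
      (by simp [h0]) (by simp)
    rw [P.root_eq_right h he h' H, P.root_eq_right h _ h' (H.comp_extendPerm ρ), P.act_mul]
    simp

/-- The action of the permutations of the output and the inputs on the cofree cyclic operad. -/
noncomputable def coindAct {n : ℕ} (σ : Equiv.Perm (Fin (n + 1))) : P.coind n ⟶ P.coind n :=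
  P.coindLift fun ρ => P.prj (σ * ρ)

theorem coindAct_prj {n : ℕ} (σ ρ : Equiv.Perm (Fin (n + 1))) :
    P.coindAct σ ≫ P.prj ρ = P.prj (σ * ρ) :=
  P.coindLift_prj _ (fun σ' ρ' => by rw [← mul_assoc, prj_mul_extendPerm]) ρ

theorem coindAct_one (n : ℕ) : P.coindAct (1 : Equiv.Perm (Fin (n + 1))) = 𝟙 _ :=
  coind_ext fun σ => by rw [coindAct_prj, one_mul, Category.id_comp]

theorem coindAct_mul {n : ℕ} (σ ρ : Equiv.Perm (Fin (n + 1))) :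
    P.coindAct (σ * ρ) = P.coindAct σ ≫ P.coindAct ρ :=
  coind_ext fun τ => by rw [coindAct_prj, Category.assoc, coindAct_prj, coindAct_prj, mul_assoc]

theorem coindAct_root (he : IsGlue x y e) (σ : Equiv.Perm (Fin (m + 1)))
    (ρ : Equiv.Perm (Fin (n + 1))) :
    (P.coindAct σ ⊗ₘ P.coindAct ρ) ≫ P.root h he = P.root h (he.map σ ρ) := by
  cases h0 : e 0 with
  | inl a =>
    obtain ⟨j, π, H⟩ := he.exists_isRooted h (Equiv.swap 0 a) (Equiv.swap 0 y)
      (by simp [h0]) (by simp)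
    rw [P.root_eq_left h he H, P.root_eq_left h _ (H.map σ ρ),
      MonoidalCategory.tensorHom_comp_tensorHom_assoc, coindAct_prj, coindAct_prj]
  | inr b =>
    have h' := (Nat.add_comm n m).trans h
    obtain ⟨j, π, H⟩ := he.swap.exists_isRooted h' (Equiv.swap 0 b) (Equiv.swap 0 x)
      (by simp [h0]) (by simp)
    have H' : IsRooted h' (ρ y) (σ x) (Sum.swap ∘ (Sum.map σ ρ ∘ e)) (ρ * Equiv.swap 0 b)
        (σ * Equiv.swap 0 x) j π := by
      convert H.map ρ σ using 1
      ext1 c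
      simp only [Function.comp]
      cases e c <;> rfl
    rw [P.root_eq_right h he h' H, P.root_eq_right h _ h' H',
      BraidedCategory.braiding_naturality_assoc,
      MonoidalCategory.tensorHom_comp_tensorHom_assoc, coindAct_prj, coindAct_prj]

/-- The gluing of the legs `x` and `y`. -/
noncomputable def glue (he : IsGlue x y e) : P.coind m ⊗ P.coind n ⟶ P.coind k :=
  P.coindLift fun σ => P.root h (he.comp_perm σ)

theorem glue_prj (he : IsGlue x y e) (σ : Equiv.Perm (Fin (k + 1))) :
    P.glue h he ≫ P.prj σ = P.root h (he.comp_perm σ) :=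
  P.coindLift_prj _ (fun σ ρ => P.root_comp_extendPerm h (he.comp_perm σ) ρ) σ

theorem glue_congr {x' : Fin (m + 1)} {y' : Fin (n + 1)}
    {e' : Fin (k + 1) → Fin (m + 1) ⊕ Fin (n + 1)} (he : IsGlue x y e) (he' : IsGlue x' y' e')
    (hx : x = x') (hy : y = y') (h' : ∀ c, e c = e' c) : P.glue h he = P.glue h he' := by
  subst hx hy
  obtain rfl : e = e' := funext h'
  rfl

theorem glue_coindAct (he : IsGlue x y e) (σ : Equiv.Perm (Fin (k + 1))) :
    P.glue h he ≫ P.coindAct σ = P.glue h (he.comp_perm σ) :=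
  coind_ext fun ρ => by
    rw [Category.assoc, coindAct_prj, glue_prj, glue_prj]
    rfl

theorem coindAct_glue (he : IsGlue x y e) (σ : Equiv.Perm (Fin (m + 1)))
    (ρ : Equiv.Perm (Fin (n + 1))) :
    (P.coindAct σ ⊗ₘ P.coindAct ρ) ≫ P.glue h he = P.glue h (he.map σ ρ) :=
  coind_ext fun τ => by
    rw [Category.assoc, glue_prj, glue_prj, coindAct_root]

theorem glue_symm (he : IsGlue x y e) (h' : n + m = k + 1) :
    P.glue h he = (β_ _ _).hom ≫ P.glue h' he.swap :=
  coind_ext fun τ => by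
    rw [Category.assoc, glue_prj, glue_prj, P.root_symm h _ h']

end Glue

section Assoc

variable {l m n a b k : ℕ} (h₁ : l + m = a + 1) (h₂ : a + n = k + 1) (h₃ : m + n = b + 1)
  (h₄ : l + b = k + 1) {x : Fin (l + 1)} {y y' : Fin (m + 1)} {w : Fin (n + 1)}
  {e : Fin (a + 1) → Fin (l + 1) ⊕ Fin (m + 1)} {z : Fin (a + 1)}
  {f : Fin (k + 1) → Fin (a + 1) ⊕ Fin (n + 1)}
  {e₂ : Fin (b + 1) → Fin (m + 1) ⊕ Fin (n + 1)} {z₂ : Fin (b + 1)}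
  {f₂ : Fin (k + 1) → Fin (l + 1) ⊕ Fin (b + 1)}

/-- With the output on the first vertex, the second is plugged into the first and the third into the
second, so this is sequential associativity in `P`. The turnings of the vertices are chosen equal on
both sides, which leaves only the permutations of the inputs to compare. -/
theorem glue_root_left (he : IsGlue x y e) (hz : e z = .inr y') (hf : IsGlue z w f)
    (he₂ : IsGlue y' w e₂) (hz₂ : e₂ z₂ = .inl y) (hf₂ : IsGlue x z₂ f₂)
    (H : ∀ t, legsLeft e f t = legsRight e₂ f₂ t) {a₀ : Fin (l + 1)} {t : Fin (a + 1)}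
    (hf0 : f 0 = .inl t) (ht : e t = .inl a₀) (hf₂0 : f₂ 0 = .inl a₀) :
    (P.glue h₁ he ▷ P.coind n) ≫ P.root h₂ hf =
      (α_ _ _ _).hom ≫ (P.coind l ◁ P.glue h₃ he₂) ≫ P.root h₄ hf₂ := by
  obtain ⟨j, π, R⟩ := hf.exists_isRooted h₂ (Equiv.swap 0 t) (Equiv.swap 0 w)
    (by simp [hf0]) (by simp)
  obtain ⟨i', π₁, R₁⟩ := (he.comp_perm (Equiv.swap 0 t)).exists_isRooted h₁ (Equiv.swap 0 a₀)
    (Equiv.swap 0 y) (by simp [ht]) (by simp)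
  obtain ⟨i, π', R'⟩ := hf₂.exists_isRooted h₄ (Equiv.swap 0 a₀) (Equiv.swap 0 z₂)
    (by simp [hf₂0]) (by simp)
  obtain ⟨j', π₂, R₂⟩ := (he₂.comp_perm (Equiv.swap 0 z₂)).exists_isRooted h₃ (Equiv.swap 0 y)
    (Equiv.swap 0 w) (by simp [hz₂]) (by simp)
  obtain rfl : i = i' := Fin.succ_injective _ (Equiv.injective _ (R'.left.trans R₁.left.symm))
  have key := P.assoc_seq_act h₁ h₂ h₃ h₄ i j' j π₁ π₂ π π'
    (succ_map_injective (Equiv.swap 0 a₀) (Equiv.swap 0 y) (by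
      rw [← R₁.legs, Function.comp, R.left, hz, Sum.map_inr, Function.comp, R₂.left]))
    (fun t' => legs_map_injective
      ((Equiv.swap 0 a₀).injective.comp (Fin.succ_injective l))
      ((Equiv.swap 0 y).injective.comp (Fin.succ_injective m))
      ((Equiv.swap 0 w).injective.comp (Fin.succ_injective n)) (by
        exact (legsLeft_map (e := e) R₁.legs (R.legs t')).symm.trans
          ((H _).trans (legsRight_map (e := e₂) R₂.legs (R'.legs t')))))
  rw [P.root_eq_left h₂ hf R, P.root_eq_left h₄ hf₂ R',
    ← MonoidalCategory.tensorHom_id, ← MonoidalCategory.id_tensorHom,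
    MonoidalCategory.tensorHom_comp_tensorHom_assoc,
    MonoidalCategory.tensorHom_comp_tensorHom_assoc, glue_prj, glue_prj,
    P.root_eq_left h₁ _ R₁, P.root_eq_left h₃ _ R₂, Category.id_comp, Category.id_comp]
  have e1 := MonoidalCategory.tensorHom_comp_tensorHom
    (P.prj (Equiv.swap 0 a₀) ⊗ₘ P.prj (Equiv.swap 0 y)) (P.prj (Equiv.swap 0 w))
    (P.comp h₁ i ≫ P.act π₁) (𝟙 _)
  have e2 := MonoidalCategory.tensorHom_comp_tensorHom (P.prj (Equiv.swap 0 a₀))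
    (P.prj (Equiv.swap 0 y) ⊗ₘ P.prj (Equiv.swap 0 w)) (𝟙 _) (P.comp h₃ j' ≫ P.act π₂)
  rw [Category.comp_id] at e1 e2
  rw [← e1, ← e2, MonoidalCategory.tensorHom_id, MonoidalCategory.id_tensorHom, Category.assoc,
    key, Category.assoc, MonoidalCategory.associator_naturality_assoc]

/-- With the output on the middle vertex, both outer vertices are plugged into it at different
inputs, so this is parallel associativity in `P`. -/
theorem glue_root_middle (he : IsGlue x y e) (hz : e z = .inr y') (hf : IsGlue z w f)
    (he₂ : IsGlue y' w e₂) (hz₂ : e₂ z₂ = .inl y) (hf₂ : IsGlue x z₂ f₂)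
    (H : ∀ t, legsLeft e f t = legsRight e₂ f₂ t) {b₀ : Fin (m + 1)} {t : Fin (a + 1)}
    {t₂ : Fin (b + 1)} (hf0 : f 0 = .inl t) (ht : e t = .inr b₀) (hf₂0 : f₂ 0 = .inr t₂)
    (ht₂ : e₂ t₂ = .inl b₀) :
    (P.glue h₁ he ▷ P.coind n) ≫ P.root h₂ hf =
      (α_ _ _ _).hom ≫ (P.coind l ◁ P.glue h₃ he₂) ≫ P.root h₄ hf₂ := by
  have h₁' := (Nat.add_comm m l).trans h₁
  have h₄' := (Nat.add_comm b l).trans h₄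
  obtain ⟨j, π, R⟩ := hf.exists_isRooted h₂ (Equiv.swap 0 t) (Equiv.swap 0 w)
    (by simp [hf0]) (by simp)
  obtain ⟨i, π₁, R₁⟩ := (he.comp_perm (Equiv.swap 0 t)).swap.exists_isRooted h₁' (Equiv.swap 0 b₀)
    (Equiv.swap 0 x) (by simp [ht]) (by simp)
  obtain ⟨i₂, π', R'⟩ := hf₂.swap.exists_isRooted h₄' (Equiv.swap 0 t₂) (Equiv.swap 0 x)
    (by simp [hf₂0]) (by simp)
  obtain ⟨j', π₂, R₂⟩ := (he₂.comp_perm (Equiv.swap 0 t₂)).exists_isRooted h₃ (Equiv.swap 0 b₀)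
    (Equiv.swap 0 w) (by simp [ht₂]) (by simp)
  have key := P.assoc_par_act h₁' h₂ h₃ h₄' i j' j i₂ π₁ π₂ π π'
    (succ_map_injective (Equiv.swap 0 b₀) (Equiv.swap 0 x) (by
      rw [← R₁.legs, Function.comp, Function.comp, R.left, hz, Sum.map_inl, Function.comp, R₂.left,
        Sum.swap_inr]))
    (succ_map_injective (Equiv.swap 0 b₀) (Equiv.swap 0 w) (by
      rw [← R₂.legs, Function.comp, R'.left, hz₂, Sum.map_inl, Function.comp, R₁.left]))
    (fun t' => legs_map_injective
      ((Equiv.swap 0 b₀).injective.comp (Fin.succ_injective m))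
      ((Equiv.swap 0 x).injective.comp (Fin.succ_injective l))
      ((Equiv.swap 0 w).injective.comp (Fin.succ_injective n)) (by
        refine (legsLeft_map (e := Sum.swap ∘ e) R₁.legs (R.legs t')).symm.trans
          ((legsLeft_swap_left (H t'.succ)).trans ((congrArg (Sum.map id Sum.swap)
            (legsLeft_map (e := e₂) R₂.legs (f' := legs h₄' i₂ ∘ π') (R'.legs t'))).trans ?_))
        change Sum.map _ _ (Sum.map _ _ (legsLeft (legs h₃ j' ∘ π₂) (legs h₄' i₂ ∘ π') t')) = _
        generalize legsLeft (legs h₃ j' ∘ π₂) (legs h₄' i₂ ∘ π') t' = u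
        rcases u with u | u | u <;> rfl))
  rw [P.root_eq_left h₂ hf R, P.root_eq_right h₄ hf₂ h₄' R',
    BraidedCategory.braiding_naturality_right_assoc,
    ← MonoidalCategory.tensorHom_id, ← MonoidalCategory.tensorHom_id,
    MonoidalCategory.tensorHom_comp_tensorHom_assoc,
    MonoidalCategory.tensorHom_comp_tensorHom_assoc, glue_prj, glue_prj,
    P.root_eq_right h₁ _ h₁' R₁, P.root_eq_left h₃ _ R₂, Category.id_comp, Category.id_comp]
  exact middle_coherence _ _ _ key

/-- With the output on the third vertex the tree is read backwards: sequential associativity in `P`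
for the factors in reverse order, used from right to left. -/
theorem glue_root_right (he : IsGlue x y e) (hz : e z = .inr y') (hf : IsGlue z w f)
    (he₂ : IsGlue y' w e₂) (hz₂ : e₂ z₂ = .inl y) (hf₂ : IsGlue x z₂ f₂)
    (H : ∀ t, legsLeft e f t = legsRight e₂ f₂ t) {c₀ : Fin (n + 1)}
    {t₂ : Fin (b + 1)} (hf0 : f 0 = .inr c₀) (hf₂0 : f₂ 0 = .inr t₂)
    (ht₂ : e₂ t₂ = .inr c₀) :
    (P.glue h₁ he ▷ P.coind n) ≫ P.root h₂ hf =
      (α_ _ _ _).hom ≫ (P.coind l ◁ P.glue h₃ he₂) ≫ P.root h₄ hf₂ := by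
  have h₁' := (Nat.add_comm m l).trans h₁
  have h₂' := (Nat.add_comm n a).trans h₂
  have h₃' := (Nat.add_comm n m).trans h₃
  have h₄' := (Nat.add_comm b l).trans h₄
  obtain ⟨j, π, R⟩ := hf.swap.exists_isRooted h₂' (Equiv.swap 0 c₀) (Equiv.swap 0 z)
    (by simp [hf0]) (by simp)
  obtain ⟨i, π₁, R₁⟩ := (he.comp_perm (Equiv.swap 0 z)).swap.exists_isRooted h₁' (Equiv.swap 0 y')
    (Equiv.swap 0 x) (by simp [hz]) (by simp)
  obtain ⟨i₂, π', R'⟩ := hf₂.swap.exists_isRooted h₄' (Equiv.swap 0 t₂) (Equiv.swap 0 x)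
    (by simp [hf₂0]) (by simp)
  obtain ⟨j', π₂, R₂⟩ := (he₂.comp_perm (Equiv.swap 0 t₂)).swap.exists_isRooted h₃'
    (Equiv.swap 0 c₀) (Equiv.swap 0 y') (by simp [ht₂]) (by simp)
  obtain rfl : j = j' := Fin.succ_injective _ (Equiv.injective _ (R.left.trans R₂.left.symm))
  have key := P.assoc_seq_act h₃' h₄' h₁' h₂' j i i₂ π₂ π₁ π' π
    (succ_map_injective (Equiv.swap 0 c₀) (Equiv.swap 0 y') (by
      rw [← R₂.legs, Function.comp, Function.comp, R'.left, hz₂, Sum.map_inr, Function.comp,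
        R₁.left, Sum.swap_inl]))
    (fun t' => legs_map_injective
      ((Equiv.swap 0 c₀).injective.comp (Fin.succ_injective n))
      ((Equiv.swap 0 y').injective.comp (Fin.succ_injective m))
      ((Equiv.swap 0 x).injective.comp (Fin.succ_injective l)) (by
        exact (legsLeft_map (e := Sum.swap ∘ e₂) R₂.legs (R'.legs t')).symm.trans
          ((legsLeft_swap_swap (H t'.succ)).trans
            (legsRight_map (e := Sum.swap ∘ e) R₁.legs (R.legs t')))))
  rw [P.root_eq_right h₂ hf h₂' R, P.root_eq_right h₄ hf₂ h₄' R',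
    BraidedCategory.braiding_naturality_right_assoc,
    BraidedCategory.braiding_naturality_left_assoc,
    ← MonoidalCategory.tensorHom_id, ← MonoidalCategory.id_tensorHom,
    MonoidalCategory.tensorHom_comp_tensorHom_assoc,
    MonoidalCategory.tensorHom_comp_tensorHom_assoc, glue_prj, glue_prj,
    P.root_eq_right h₁ _ h₁' R₁, P.root_eq_right h₃ _ h₃' R₂, Category.id_comp, Category.id_comp]
  exact right_coherence _ _ _ key

/-- A chain of three vertices, with the middle one glued at `y` to the first and at `y'` to the
third. Testing against every `prj σ` fixes an output, and the three vertices on which it may lie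
give the three preceding cases. -/
theorem glue_assoc (he : IsGlue x y e) (hz : e z = .inr y') (hf : IsGlue z w f)
    (he₂ : IsGlue y' w e₂) (hz₂ : e₂ z₂ = .inl y) (hf₂ : IsGlue x z₂ f₂)
    (H : ∀ t, legsLeft e f t = legsRight e₂ f₂ t) :
    (P.glue h₁ he ▷ P.coind n) ≫ P.glue h₂ hf =
      (α_ _ _ _).hom ≫ (P.coind l ◁ P.glue h₃ he₂) ≫ P.glue h₄ hf₂ := by
  refine coind_ext fun σ => ?_
  simp only [Category.assoc, glue_prj]
  have H' : ∀ t, legsLeft e (f ∘ σ) t = legsRight e₂ (f₂ ∘ σ) t := fun t => H (σ t)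
  have H0 := H' 0
  simp only [legsLeft, legsRight] at H0
  rcases hf0 : (f ∘ σ) 0 with t | c₀ <;> rcases hf₂0 : (f₂ ∘ σ) 0 with a₀ | t₂
  · rcases ht : e t with a₁ | b₁ <;> simp only [hf0, hf₂0, ht, Sum.map_inl, id,
      Equiv.sumAssoc_apply_inl_inl, Equiv.sumAssoc_apply_inl_inr, reduceCtorEq,
      Sum.inl.injEq] at H0
    exact P.glue_root_left h₁ h₂ h₃ h₄ he hz _ he₂ hz₂ _ H' hf0 (H0 ▸ ht) hf₂0
  · rcases ht : e t with a₁ | b₁ <;> simp only [hf0, hf₂0, ht, Sum.map_inl, Sum.map_inr,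
      Equiv.sumAssoc_apply_inl_inl, Equiv.sumAssoc_apply_inl_inr, reduceCtorEq,
      Sum.inr.injEq] at H0
    exact P.glue_root_middle h₁ h₂ h₃ h₄ he hz _ he₂ hz₂ _ H' hf0 ht hf₂0 H0.symm
  -- The output cannot lie both on the third vertex and on the first.
  · simp only [hf0, hf₂0, Sum.map_inl, Sum.map_inr, Equiv.sumAssoc_apply_inr, reduceCtorEq] at H0
  · simp only [hf0, hf₂0, Sum.map_inr, Equiv.sumAssoc_apply_inr, Sum.inr.injEq, id] at H0
    exact P.glue_root_right h₁ h₂ h₃ h₄ he hz _ he₂ hz₂ _ H' hf0 hf₂0 H0.symm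

end Assoc

end Operad

/-! ### The gluing pattern of a partial composition. -/

section StdGlue

/-- The output and the inputs of a composite `p ∘ᵢ q`, as output and inputs of `p` or `q`. -/
def stdGlue {m n k : ℕ} (h : m + n = k + 1) (i : Fin m) :
    Fin (k + 1) → Fin (m + 1) ⊕ Fin (n + 1) :=
  Fin.cases (.inl 0) fun c => Sum.map Fin.succ Fin.succ (legs h i c)

variable {m n k : ℕ} (h : m + n = k + 1) (i : Fin m)

@[simp]
theorem stdGlue_zero : stdGlue h i 0 = .inl 0 := rfl

@[simp]
theorem stdGlue_succ (c : Fin k) :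
    stdGlue h i c.succ = Sum.map Fin.succ Fin.succ (legs h i c) := rfl

theorem stdGlue_eq_inl_iff (c : Fin (k + 1)) (a : Fin (m + 1)) :
    stdGlue h i c = .inl a ↔
      (a : ℕ) ≠ i + 1 ∧ (c : ℕ) = if (a : ℕ) ≤ i then (a : ℕ) else (a : ℕ) + n - 1 := by
  have := i.2
  cases c using Fin.cases with
  | zero =>
    simp only [stdGlue_zero, Sum.inl.injEq, Fin.ext_iff, Fin.val_zero]
    split_ifs <;> omega
  | succ c =>
    rw [stdGlue_succ]
    cases a using Fin.cases with
    | zero => cases legs h i c <;> simp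
    | succ a =>
      have : Sum.map Fin.succ Fin.succ (legs h i c) = .inl a.succ ↔ legs h i c = .inl a := by
        cases legs h i c <;> simp
      rw [this, legs_eq_inl_iff, Ne, Fin.ext_iff, Fin.val_succ, Fin.val_succ]
      unfold outerPos
      split_ifs <;> omega

theorem stdGlue_eq_inr_iff (c : Fin (k + 1)) (b : Fin (n + 1)) :
    stdGlue h i c = .inr b ↔ (b : ℕ) ≠ 0 ∧ (c : ℕ) = i + b := by
  cases c using Fin.cases with
  | zero =>
    simp only [stdGlue_zero, reduceCtorEq, Fin.val_zero, false_iff]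
    omega
  | succ c =>
    rw [stdGlue_succ]
    cases b using Fin.cases with
    | zero => cases legs h i c <;> simp
    | succ b =>
      have : Sum.map Fin.succ Fin.succ (legs h i c) = .inr b.succ ↔ legs h i c = .inr b := by
        cases legs h i c <;> simp
      rw [this, legs_eq_inr_iff, Fin.val_succ, Fin.val_succ]
      omega

theorem isGlue_stdGlue : IsGlue i.succ 0 (stdGlue h i) where
  inj c c' hc := by
    cases hx : stdGlue h i c' with
    | inl a =>
      rw [hx] at hc
      rw [stdGlue_eq_inl_iff] at hc hx
      exact Fin.ext (hc.2.trans hx.2.symm)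
    | inr b =>
      rw [hx] at hc
      rw [stdGlue_eq_inr_iff] at hc hx
      exact Fin.ext (hc.2.trans hx.2.symm)
  ne_left c hc := by
    rw [stdGlue_eq_inl_iff] at hc
    exact hc.1 (by simp)
  ne_right c hc := by
    rw [stdGlue_eq_inr_iff] at hc
    exact hc.1 (by simp)

theorem isRooted_stdGlue : IsRooted h i.succ 0 (stdGlue h i) 1 1 i 1 :=
  ⟨rfl, rfl, rfl, fun _ => rfl⟩

theorem stdGlue_map (j : Fin m) (σ : Equiv.Perm (Fin m)) (ρ : Equiv.Perm (Fin n))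
    (π : Equiv.Perm (Fin k))
    (H : ∀ c, legs h j (π c) = Sum.map σ ρ (legs h i c)) (c : Fin (k + 1)) :
    Sum.map (extendPerm σ) (extendPerm ρ) (stdGlue h i c) = stdGlue h j (extendPerm π c) := by
  cases c using Fin.cases with
  | zero => simp
  | succ c =>
    rw [extendPerm_succ, stdGlue_succ, stdGlue_succ, H]
    cases legs h i c <;> simp

theorem finRotate_val {n : ℕ} (a : Fin (n + 1)) :
    (finRotate (n + 1) a : ℕ) = if (a : ℕ) = n then 0 else (a : ℕ) + 1 := by
  rw [coe_finRotate]
  simp [Fin.ext_iff]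

theorem stdGlue_rotate (j : Fin m) (hij : (i : ℕ) = j + 1) (c : Fin (k + 1)) :
    stdGlue h i (finRotate (k + 1) c) = Sum.map (finRotate (m + 1)) id (stdGlue h j c) := by
  have := i.2; have := c.2
  cases hx : stdGlue h j c with
  | inl a =>
    have := a.2
    rw [stdGlue_eq_inl_iff] at hx
    rw [Sum.map_inl, stdGlue_eq_inl_iff, finRotate_val, finRotate_val]
    obtain ⟨h1, h2⟩ := hx
    split_ifs at h2 ⊢ <;> omega
  | inr b =>
    have := b.2
    rw [stdGlue_eq_inr_iff] at hx
    rw [Sum.map_inr, stdGlue_eq_inr_iff, finRotate_val, id]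
    obtain ⟨h1, h2⟩ := hx
    split_ifs <;> omega

/-- Turning the composite makes its first input the output. For composition at the first input of
`p` this leg belongs to `q`, so `q` becomes the root and the glued edge joins the turned `p` at the
last input of the turned `q`. -/
theorem stdGlue_rotate_first (h' : n + m = k + 1) (j : Fin n) (hi : (i : ℕ) = 0)
    (hj : (j : ℕ) + 1 = n) (c : Fin (k + 1)) :
    stdGlue h i (finRotate (k + 1) c) =
      Sum.swap (Sum.map (finRotate (n + 1)) (finRotate (m + 1)) (stdGlue h' j c)) := by
  have := i.2; have := c.2
  cases hx : stdGlue h' j c with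
  | inl a =>
    have := a.2
    rw [stdGlue_eq_inl_iff] at hx
    rw [Sum.map_inl, Sum.swap_inl, stdGlue_eq_inr_iff, finRotate_val, finRotate_val]
    obtain ⟨h1, h2⟩ := hx
    split_ifs at h2 ⊢ <;> omega
  | inr b =>
    have := b.2
    rw [stdGlue_eq_inr_iff] at hx
    rw [Sum.map_inr, Sum.swap_inr, stdGlue_eq_inl_iff, finRotate_val, finRotate_val]
    obtain ⟨h1, h2⟩ := hx
    split_ifs <;> omega

theorem stdGlue_assoc_seq {l m n a b k : ℕ} (hlm : l + m = a + 1) (han : a + n = k + 1)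
    (hmn : m + n = b + 1) (hlb : l + b = k + 1) (i : Fin l) (j : Fin m) (c : Fin a)
    (hc : (c : ℕ) = i + j) (t : Fin (k + 1)) :
    legsLeft (stdGlue hlm i) (stdGlue han c) t = legsRight (stdGlue hmn j) (stdGlue hlb i) t := by
  cases t using Fin.cases with
  | zero => rfl
  | succ t =>
    rw [legsLeft_map (stdGlue_succ hlm i) (stdGlue_succ han c t),
      legsRight_map (stdGlue_succ hmn j) (stdGlue_succ hlb i t),
      legs_assoc_seq hlm han hmn hlb i j c hc]

theorem stdGlue_assoc_par {l m n a b k : ℕ} (hlm : l + m = a + 1) (han : a + n = k + 1)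
    (hln : l + n = b + 1) (hbm : b + m = k + 1) (i j : Fin l) (hij : i < j)
    (c : Fin a) (d : Fin b) (hc : (c : ℕ) + 1 = j + m) (hd : (d : ℕ) = i) (t : Fin (k + 1)) :
    legsLeft (Sum.swap ∘ stdGlue hlm i) (stdGlue han c) t =
      legsRight (stdGlue hln j) (Sum.swap ∘ stdGlue hbm d) t := by
  have H : legsLeft (stdGlue hlm i) (stdGlue han c) t =
      Sum.map id Sum.swap (legsLeft (stdGlue hln j) (stdGlue hbm d) t) := by
    cases t using Fin.cases with
    | zero => rfl
    | succ t =>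
      rw [legsLeft_map (stdGlue_succ hlm i) (stdGlue_succ han c t),
        legsLeft_map (stdGlue_succ hln j) (stdGlue_succ hbm d t),
        legs_assoc_par hlm han hln hbm i j hij c d hc hd]
      rcases legsLeft (legs hln j) (legs hbm d) t with u | u | u <;> rfl
  simp only [legsLeft, legsRight, Function.comp] at H ⊢
  rcases h1 : stdGlue han c t with p | p <;> rcases h2 : stdGlue hbm d t with q | q <;>
    simp only [h1, h2, Sum.map_inl, Sum.map_inr, Sum.swap_inl, Sum.swap_inr] at H ⊢
  · rcases h3 : stdGlue hlm i p with p' | p' <;> rcases h4 : stdGlue hln j q with q' | q' <;>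
      simp_all
  · rcases h3 : stdGlue hlm i p with p' | p' <;> simp_all
  · rcases h4 : stdGlue hln j q with q' | q' <;> simp_all
  · simp_all

end StdGlue

/-! ### The cofree cyclic operad. -/

namespace Operad

variable {M : Type u} [Category.{v} M] [MonoidalCategory M] [SymmetricCategory M]
  [HasFiniteProducts M] (P : Operad M)

/-- The unit of the cofree cyclic operad. -/
noncomputable def coindOne : 𝟙_ M ⟶ P.coind 1 := P.coindLift fun _ => P.one

theorem coindOne_prj (σ : Equiv.Perm (Fin 2)) : P.coindOne ≫ P.prj σ = P.one :=
  P.coindLift_prj _ (fun _ ρ => by rw [Subsingleton.elim ρ 1, P.act_one, Category.comp_id]) σ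

theorem coindOne_coindAct (σ : Equiv.Perm (Fin 2)) : P.coindOne ≫ P.coindAct σ = P.coindOne :=
  coind_ext fun ρ => by rw [Category.assoc, coindAct_prj, coindOne_prj, coindOne_prj]

/-- The unit has just two legs; once `u` is glued, the other one takes the place of `y`. If the
output lies on the other operation, the unit is plugged into one of its inputs and `comp_one`
applies; otherwise the unit is the root and `one_comp` applies. -/
theorem coindOne_root {n : ℕ} (h : 1 + n = n + 1) {u : Fin 2} {y : Fin (n + 1)}
    {e : Fin (n + 1) → Fin 2 ⊕ Fin (n + 1)} (he : IsGlue u y e) (ψ : Equiv.Perm (Fin (n + 1)))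
    (hψ : ∀ c, e c = .inr (ψ c) ∨ (∃ u', e c = .inl u') ∧ ψ c = y) :
    (P.coindOne ▷ P.coind n) ≫ P.root h he = (λ_ _).hom ≫ P.prj ψ := by
  have two : ∀ a b c : Fin 2, b ≠ a → c ≠ a → b = c := by decide
  rcases hψ 0 with h0 | ⟨⟨u', h0⟩, h0'⟩
  · obtain ⟨j, hj⟩ := exists_succ_of_ne ψ y (fun hy => he.ne_right 0 (hy ▸ h0))
    have R : IsRooted rfl y u (Sum.swap ∘ e) ψ (Equiv.swap 0 u) j 1 := by
      refine ⟨by simp [h0], hj, by simp, fun c => ?_⟩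
      by_cases hc : c = j
      · subst hc
        have : legs (rfl : n + 1 = n + 1) c c = .inr 0 := by rw [legs_eq_inr_iff]; simp
        rcases hψ c.succ with h1 | ⟨⟨u', h1⟩, -⟩
        · exact absurd (hj ▸ h1) (he.ne_right _)
        · have hu' : u' ≠ u := fun h => he.ne_left c.succ (h ▸ h1)
          have h2 : Equiv.swap 0 u (Fin.succ 0) = u' := two u _ _ (fun h3 => by
            have h4 : Equiv.swap 0 u 0 = u := by simp
            exact absurd ((Equiv.swap 0 u).injective (h3.trans h4.symm)) (by simp)) hu'
          simp only [Function.comp, h1, Equiv.Perm.one_apply, this, Sum.map_inr, Sum.swap_inl, h2]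
      · have : legs (rfl : n + 1 = n + 1) j c = .inl c := by
          rw [legs_eq_inl_iff]; refine ⟨hc, ?_⟩; unfold outerPos; split_ifs <;> omega
        rcases hψ c.succ with h1 | ⟨-, h1⟩
        · simp [h1, this]
        · exact absurd (Fin.succ_injective _ (ψ.injective (h1.trans hj.symm))) hc
    rw [P.root_eq_right h he rfl R, BraidedCategory.braiding_naturality_left_assoc,
      ← MonoidalCategory.id_tensorHom, MonoidalCategory.tensorHom_comp_tensorHom_assoc,
      coindOne_prj, Category.id_comp, P.act_one, Category.comp_id, MonoidalCategory.tensorHom_def,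
      Category.assoc, P.comp_one]
    simp
  · have R : IsRooted h u y e (Equiv.swap 0 u') ψ 0 1 := by
      have hu' : u ≠ u' := fun h => he.ne_left 0 (h ▸ h0)
      refine ⟨by simp [h0], two u' _ _ (fun h3 => ?_) hu', h0', fun c => ?_⟩
      · have h4 : Equiv.swap 0 u' 0 = u' := by simp
        exact absurd ((Equiv.swap 0 u').injective (h3.trans h4.symm)) (by simp)
      · have : legs h 0 c = .inr c := by rw [legs_eq_inr_iff]; simp
        rcases hψ c.succ with h1 | ⟨⟨u'', h1⟩, -⟩
        · simp [h1, this]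
        · have : u'' = u' := two u _ _ (fun h => he.ne_left _ (h ▸ h1)) hu'.symm
          exact absurd (he.inj (h1.trans (this ▸ h0.symm))) (Fin.succ_ne_zero c)
    rw [P.root_eq_left h he R,
      ← MonoidalCategory.tensorHom_id, MonoidalCategory.tensorHom_comp_tensorHom_assoc,
      coindOne_prj, Category.id_comp, P.act_one, Category.comp_id, MonoidalCategory.tensorHom_def',
      Category.assoc, P.one_comp]
    simp

theorem coindOne_glue {n : ℕ} (h : 1 + n = n + 1) {u : Fin 2} {y : Fin (n + 1)}
    {e : Fin (n + 1) → Fin 2 ⊕ Fin (n + 1)} (he : IsGlue u y e)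
    (hψ : ∀ c, e c = .inr c ∨ (∃ u', e c = .inl u') ∧ c = y) :
    (P.coindOne ▷ P.coind n) ≫ P.glue h he = (λ_ _).hom :=
  coind_ext fun σ => by
    rw [Category.assoc, glue_prj]
    exact P.coindOne_root h _ σ (fun c => hψ (σ c))

theorem equivariance_legs {m n k : ℕ} (h : m + n = k + 1) (i : Fin m) (σ : Equiv.Perm (Fin m))
    (ρ : Equiv.Perm (Fin n)) (π : Equiv.Perm (Fin k))
    (h₁ : ∀ (a : Fin m) (c : Fin k), a ≠ i → (c : ℕ) = outerPos n i a →
      (π c : ℕ) = outerPos n (σ i) (σ a))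
    (h₂ : ∀ (b : Fin n) (c : Fin k), (c : ℕ) = i + b → (π c : ℕ) = σ i + ρ b) (c : Fin k) :
    legs h (σ i) (π c) = Sum.map σ ρ (legs h i c) := by
  cases hx : legs h i c with
  | inl a =>
    rw [legs_eq_inl_iff] at hx
    rw [Sum.map_inl, legs_eq_inl_iff]
    exact ⟨fun h => hx.1 (σ.injective h), h₁ a c hx.1 hx.2⟩
  | inr b =>
    rw [legs_eq_inr_iff] at hx
    rw [Sum.map_inr, legs_eq_inr_iff]
    exact h₂ b c hx

/-- The cofree cyclic operad on an operad. -/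
noncomputable def cofreeCyclic : CyclicOperad M where
  obj := P.coind
  act σ := P.coindAct (extendPerm σ)
  one := P.coindOne
  comp h i := P.glue h (isGlue_stdGlue h i)
  act_one n := by rw [extendPerm_one, coindAct_one]
  act_mul σ ρ := by rw [extendPerm_mul, coindAct_mul]
  one_comp {n} h := P.coindOne_glue h _ (fun c => by
    cases c using Fin.cases with
    | zero => exact .inr ⟨⟨0, rfl⟩, rfl⟩
    | succ c => exact .inl ((stdGlue_eq_inr_iff ..).2 (by simp)))
  comp_one {m} i := by
    have h' : 1 + m = m + 1 := Nat.add_comm _ _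
    -- Gluing is symmetric, so the right unit law follows from the left one.
    rw [P.glue_symm _ _ h', BraidedCategory.braiding_naturality_right_assoc,
      P.coindOne_glue h' _ (fun c => ?_)]
    · simp
    · by_cases hc : c = i.succ
      · subst hc
        exact .inr ⟨⟨1, by
          rw [Function.comp, (stdGlue_eq_inr_iff (b := 1) ..).2 (by simp)]; rfl⟩, rfl⟩
      · refine .inl ?_
        have : (c : ℕ) ≠ i + 1 := fun h => hc (Fin.ext h)
        rw [Function.comp, (stdGlue_eq_inl_iff (a := c) ..).2 ⟨this, ?_⟩]
        · rfl
        · split_ifs <;> omega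
  assoc_seq hlm han hmn hlb i j c hc := P.glue_assoc hlm han hmn hlb _
    (y' := j.succ) (by
      rw [stdGlue_succ, (legs_eq_inr_iff ..).2 hc]; rfl) _ _ rfl _
    (stdGlue_assoc_seq hlm han hmn hlb i j c hc)
  assoc_par {l m n a b k} hlm han hln hbm i j hij c d hc hd := by
    have hml := (Nat.add_comm m l).trans hlm
    have hmb := (Nat.add_comm m b).trans hbm
    have hij' : (i : ℕ) < j := hij
    -- The parallel axiom is also an instance of the chain: both `q` and `r` are glued to `p`, so
    -- after exchanging the first two factors `p` is the middle vertex.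
    have key := P.glue_assoc hml han hln hmb (isGlue_stdGlue hlm i).swap
      (z := c.succ) (y' := j.succ) (by
        rw [Function.comp, stdGlue_succ, (legs_eq_inl_iff (a := j) ..).2]
        · rfl
        · refine ⟨hij.ne', ?_⟩
          unfold outerPos; split_ifs <;> omega)
      (isGlue_stdGlue han c) (isGlue_stdGlue hln j) (z₂ := d.succ) (by
        rw [stdGlue_succ, (legs_eq_inl_iff (a := i) ..).2]
        · rfl
        · refine ⟨hij.ne, ?_⟩
          unfold outerPos; split_ifs <;> omega)
      (isGlue_stdGlue hbm d).swap
      (stdGlue_assoc_par hlm han hln hbm i j hij c d hc hd)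
    rw [P.glue_symm hlm (isGlue_stdGlue hlm i) hml, comp_whiskerRight, Category.assoc, key,
      P.glue_symm hbm (isGlue_stdGlue hbm d) hmb,
      BraidedCategory.braiding_naturality_left_assoc]
    have e := par_coherence (A := P.coind l) (B := P.coind m) (C := P.coind n)
    rw [reassoc_of% e]
  equivariance h i σ ρ π h₁ h₂ := by
    rw [coindAct_glue, glue_coindAct]
    exact P.glue_congr h _ _ (by simp) (by simp)
      (stdGlue_map h i (σ i) σ ρ π (equivariance_legs h i σ ρ π h₁ h₂))
  cact := P.coindAct
  cact_one := P.coindAct_one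
  cact_mul := P.coindAct_mul
  cact_extend σ σ' h0 hσ := by
    congr 1
    ext1 a
    cases a using Fin.cases with
    | zero => simp [h0]
    | succ a => simp [hσ]
  one_rotate := P.coindOne_coindAct _
  comp_rotate {m n k} h i j hij := by
    rw [glue_coindAct, ← MonoidalCategory.tensorHom_id, ← P.coindAct_one, coindAct_glue]
    refine P.glue_congr h _ _ ?_ rfl (fun c => stdGlue_rotate h i j hij c)
    have := i.2
    rw [Fin.ext_iff, finRotate_val, Fin.val_succ, Fin.val_succ, if_neg (by omega), hij]
  comp_rotate_first {m n k} h h' i j hi hj := by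
    rw [glue_coindAct, coindAct_glue, P.glue_symm h' _ h, SymmetricCategory.symmetry_assoc]
    refine P.glue_congr h _ _ ?_ ?_ (fun c => stdGlue_rotate_first h i h' j hi hj c)
    · have := i.2
      rw [Fin.ext_iff, finRotate_val, Fin.val_succ, Fin.val_zero, if_neg (by omega), hi]
    · rw [Fin.ext_iff, finRotate_val, Fin.val_succ, Fin.val_zero, if_pos hj]

end Operad

/-! ### The universal property of the cofree cyclic operad. -/

namespace CyclicOperad

variable {M : Type u} [Category.{v} M] [MonoidalCategory M] [SymmetricCategory M]
  (Q : CyclicOperad M)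

theorem cact_extendPerm {n : ℕ} (σ : Equiv.Perm (Fin n)) : Q.cact (extendPerm σ) = Q.act σ :=
  Q.cact_extend σ _ (extendPerm_zero σ) (extendPerm_succ σ)

theorem one_cact (σ : Equiv.Perm (Fin 2)) : Q.one ≫ Q.cact σ = Q.one := by
  have : σ = 1 ∨ σ = finRotate 2 := by revert σ; decide
  rcases this with rfl | rfl
  · rw [Q.cact_one, Category.comp_id]
  · exact Q.one_rotate

variable [HasFiniteProducts M] {Q} {P : Operad M} (f : Q.toOperad ⟶ P)

/-- The components of the map to a cofree cyclic operad that is adjoint to `f`. -/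
noncomputable def toCoind (n : ℕ) : Q.obj n ⟶ P.coind n :=
  P.coindLift fun σ => Q.cact σ ≫ f.app n

theorem toCoind_prj {n : ℕ} (σ : Equiv.Perm (Fin (n + 1))) :
    toCoind f n ≫ P.prj σ = Q.cact σ ≫ f.app n :=
  P.coindLift_prj _ (fun σ ρ => by
    rw [Q.cact_mul, cact_extendPerm, Category.assoc, Category.assoc, f.app_act]) σ

theorem cact_toCoind {n : ℕ} (σ : Equiv.Perm (Fin (n + 1))) :
    Q.cact σ ≫ toCoind f n = toCoind f n ≫ P.coindAct σ :=
  Operad.coind_ext fun ρ => by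
    rw [Category.assoc, toCoind_prj, Category.assoc, P.coindAct_prj, toCoind_prj, Q.cact_mul,
      Category.assoc]

/-- The compatibility of `toCoind` with composition, after the action of `σ`. -/
def CompatibleAt {m n k : ℕ} (h : m + n = k + 1) (i : Fin m) (σ : Equiv.Perm (Fin (k + 1))) :
    Prop :=
  Q.comp h i ≫ Q.cact σ ≫ f.app k =
    (toCoind f m ⊗ₘ toCoind f n) ≫ P.root h ((isGlue_stdGlue h i).comp_perm σ)

variable {m n k : ℕ} (h : m + n = k + 1) (i : Fin m)

theorem compatibleAt_one : CompatibleAt f h i 1 := by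
  unfold CompatibleAt
  rw [Q.cact_one, Category.id_comp, f.app_comp]
  have e := P.root_eq_left h ((isGlue_stdGlue h i).comp_perm 1) (isRooted_stdGlue h i)
  rw [e, MonoidalCategory.tensorHom_comp_tensorHom_assoc, toCoind_prj, toCoind_prj,
    Q.cact_one, Q.cact_one, Category.id_comp, Category.id_comp, P.act_one, Category.comp_id]

-- Equivariance of `f` and of `root` under permutations of the inputs: compatibility depends only on
-- which leg becomes the output.
variable {f h i} in
theorem CompatibleAt.mul_extendPerm {σ : Equiv.Perm (Fin (k + 1))} (H : CompatibleAt f h i σ)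
    (ρ : Equiv.Perm (Fin k)) : CompatibleAt f h i (σ * extendPerm ρ) := by
  unfold CompatibleAt at H ⊢
  rw [Q.cact_mul, cact_extendPerm, Category.assoc, f.app_act,
    reassoc_of% H]
  congr 1
  exact (P.root_comp_extendPerm h ((isGlue_stdGlue h i).comp_perm σ) ρ).symm

-- The inputs of both factors may be renumbered first, because permutations act invertibly and
-- `toCoind` commutes with them. This moves a given leg into the position to which a cyclic axiom
-- applies.
variable {f h i} in
theorem CompatibleAt.of_legs {s : Equiv.Perm (Fin m)} {r : Equiv.Perm (Fin n)}
    {π : Equiv.Perm (Fin k)} (hπ : ∀ c, legs h (s i) (π c) = Sum.map s r (legs h i c))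
    {σ : Equiv.Perm (Fin (k + 1))} (H : CompatibleAt f h (s i) (extendPerm π * σ)) :
    CompatibleAt f h i σ := by
  unfold CompatibleAt at H ⊢
  have iso : ∀ {n : ℕ} (s : Equiv.Perm (Fin n)), IsIso (Q.act s) := fun s =>
    ⟨Q.act s⁻¹, by rw [← Q.act_mul, mul_inv_cancel, Q.act_one],
      by rw [← Q.act_mul, inv_mul_cancel, Q.act_one]⟩
  have := iso s
  have := iso r
  have e := Q.comp_act_equivariance h i _ s r 1 π rfl hπ
  rw [Q.act_one, Category.comp_id] at e
  rw [Q.cact_mul, cact_extendPerm, Category.assoc, ← reassoc_of% e] at H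
  rw [← cancel_epi (Q.act s ⊗ₘ Q.act r), H, MonoidalCategory.tensorHom_comp_tensorHom_assoc,
    ← cact_extendPerm, ← cact_extendPerm, cact_toCoind, cact_toCoind,
    ← MonoidalCategory.tensorHom_comp_tensorHom_assoc, P.coindAct_root]
  congr 1
  exact P.root_congr h _ _ (by simp) (by simp)
    (fun c => (stdGlue_map h i (s i) s r π hπ (σ c)).symm)

theorem compatibleAt_rotate (j : Fin m) (hij : (i : ℕ) = j + 1) :
    CompatibleAt f h i (finRotate (k + 1)) := by
  have H := compatibleAt_one f h j
  unfold CompatibleAt at H ⊢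
  rw [Q.cact_one, Category.id_comp] at H
  rw [← Category.assoc, Q.comp_rotate h i j hij, Category.assoc, H, ← MonoidalCategory.tensorHom_id,
    MonoidalCategory.tensorHom_comp_tensorHom_assoc, ← Q.cact_one, cact_toCoind, cact_toCoind,
    ← MonoidalCategory.tensorHom_comp_tensorHom_assoc, P.coindAct_root]
  congr 1
  refine P.root_congr h _ _ ?_ rfl (fun c => (stdGlue_rotate h i j hij c).symm)
  have := i.2
  rw [Fin.ext_iff, finRotate_val, Fin.val_succ, Fin.val_succ, if_neg (by omega), hij]

theorem compatibleAt_rotate_first (h' : n + m = k + 1) (j : Fin n) (hi : (i : ℕ) = 0)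
    (hj : (j : ℕ) + 1 = n) :
    CompatibleAt f h i (finRotate (k + 1)) := by
  have H := compatibleAt_one f h' j
  unfold CompatibleAt at H ⊢
  rw [Q.cact_one, Category.id_comp] at H
  rw [← Category.assoc, Q.comp_rotate_first h h' i j hi hj, Category.assoc, Category.assoc, H,
    MonoidalCategory.tensorHom_comp_tensorHom_assoc, cact_toCoind, cact_toCoind,
    ← MonoidalCategory.tensorHom_comp_tensorHom_assoc, P.coindAct_root,
    ← BraidedCategory.braiding_naturality_assoc, P.root_symm h' _ h,
    SymmetricCategory.symmetry_assoc]
  congr 1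
  refine P.root_congr h _ _ ?_ ?_ (fun c => (stdGlue_rotate_first h i h' j hi hj c).symm)
  · have := i.2
    rw [Fin.ext_iff, finRotate_val, Fin.val_succ, Fin.val_zero, if_neg (by omega), hi]
  · rw [Fin.ext_iff, finRotate_val, Fin.val_succ, Fin.val_zero, if_pos hj]

variable {f h i} in
theorem CompatibleAt.of_apply_zero {σ σ' : Equiv.Perm (Fin (k + 1))} (H : CompatibleAt f h i σ)
    (h0 : σ 0 = σ' 0) : CompatibleAt f h i σ' := by
  obtain ⟨ρ, rfl⟩ := exists_eq_mul_extendPerm σ σ' h0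
  exact H.mul_extendPerm ρ

/-- The axioms speak only of one rotation. Compatibility depends only on the leg that becomes the
output, and that leg can be renumbered to be the first input of the composite; then the identity or
one of the two rotation axioms settles the case, according to whether it is the old output, an input
of `p` or an input of `q`. -/
theorem compatibleAt (σ : Equiv.Perm (Fin (k + 1))) : CompatibleAt f h i σ := by
  by_cases h0 : σ 0 = 0
  · exact (compatibleAt_one f h i).of_apply_zero h0.symm
  have hm := i.2
  -- `finRotate` sends `0` to `1`, so it suffices to bring the leg that becomes the output to
  -- position `1`.
  have one_of {π : Equiv.Perm (Fin k)} (hp : (extendPerm π (σ 0) : ℕ) = 1) :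
      finRotate (k + 1) 0 = (extendPerm π * σ) 0 := by
    have := (extendPerm π (σ 0)).2
    rw [Fin.ext_iff, Equiv.Perm.mul_apply, hp, finRotate_val, Fin.val_zero, if_neg (by omega)]
  rcases hx : stdGlue h i (σ 0) with a | b
  · have hx' := (stdGlue_eq_inl_iff ..).1 hx
    have ha0 : (a : ℕ) ≠ 0 := fun ha => h0 (Fin.ext (by rw [hx'.2, ha]; simp))
    obtain ⟨a, rfl⟩ := Fin.exists_succ_eq.2 (fun h => ha0 (by simp [h]) : a ≠ 0)
    -- The chosen input of `p` is exchanged with the first one. As it differs from `i`, the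
    -- composition then takes place at a later input, as `comp_rotate` requires.
    obtain ⟨π, hπ, -⟩ := P.exists_perm_equivariance h i (Equiv.swap a ⟨0, by omega⟩) 1 1
    have hai : a ≠ i := fun h => hx'.1 (by simp [h])
    have hsi : Equiv.swap a ⟨0, by omega⟩ i ≠ ⟨0, by omega⟩ := fun h => hai
      ((Equiv.swap a ⟨0, by omega⟩).injective ((Equiv.swap_apply_left _ _).trans h.symm))
    have hsi' : (Equiv.swap a ⟨0, by omega⟩ i : ℕ) ≠ 0 := fun h => hsi (Fin.ext h)
    have hp := stdGlue_map h i _ _ _ π hπ (σ 0)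
    rw [hx, Sum.map_inl, extendPerm_succ, Equiv.swap_apply_left, eq_comm,
      stdGlue_eq_inl_iff] at hp
    refine CompatibleAt.of_legs hπ (CompatibleAt.of_apply_zero
      (compatibleAt_rotate f h _ ⟨(Equiv.swap a ⟨0, by omega⟩ i : ℕ) - 1, ?_⟩ ?_) (one_of ?_))
    · have := (Equiv.swap a ⟨0, by omega⟩ i).2
      omega
    · simp only; omega
    · rw [hp.2, Fin.val_succ]
      simp only
      split_ifs <;> omega
  · have hx' := (stdGlue_eq_inr_iff ..).1 hx
    obtain ⟨b, rfl⟩ := Fin.exists_succ_eq.2 (fun h => hx'.1 (by simp [h]) : b ≠ 0)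
    have hn := b.2
    -- Now `i` becomes the first input of `p` and the chosen leg the first input of `q`. The
    -- existence of this leg shows that `q` has an input, so its last input `n - 1` makes sense in
    -- `comp_rotate_first`.
    obtain ⟨π, hπ, -⟩ := P.exists_perm_equivariance h i (Equiv.swap i ⟨0, by omega⟩)
      (Equiv.swap b ⟨0, by omega⟩) 1
    have hp := stdGlue_map h i _ _ _ π hπ (σ 0)
    rw [hx, Sum.map_inr, extendPerm_succ, Equiv.swap_apply_left, eq_comm,
      stdGlue_eq_inr_iff] at hp
    refine CompatibleAt.of_legs hπ (CompatibleAt.of_apply_zero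
      (compatibleAt_rotate_first f h _ ((Nat.add_comm n m).trans h) ⟨n - 1, by omega⟩ ?_ ?_)
        (one_of ?_))
    · rw [Equiv.swap_apply_left]
    · simp only; omega
    · rw [hp.2, Equiv.swap_apply_left]; simp

theorem one_toCoind : Q.one ≫ toCoind f 1 = P.coindOne :=
  Operad.coind_ext fun σ => by
    rw [Category.assoc, toCoind_prj, ← Category.assoc, one_cact, f.app_one, P.coindOne_prj]

theorem comp_toCoind : Q.comp h i ≫ toCoind f k =
    (toCoind f m ⊗ₘ toCoind f n) ≫ P.glue h (isGlue_stdGlue h i) :=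
  Operad.coind_ext fun σ => by
    rw [Category.assoc, toCoind_prj, compatibleAt f h i σ, Category.assoc, P.glue_prj]

theorem act_toCoind {n : ℕ} (σ : Equiv.Perm (Fin n)) :
    Q.act σ ≫ toCoind f n = toCoind f n ≫ P.coindAct (extendPerm σ) := by
  rw [← cact_extendPerm, cact_toCoind]

/-- The map to a cofree cyclic operad that is adjoint to `f`. -/
noncomputable def toCofree : Q ⟶ P.cofreeCyclic where
  hom :=
    { app := toCoind f
      app_act := fun σ => act_toCoind f σ
      app_one := one_toCoind f
      app_comp := fun h i => comp_toCoind f h i }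
  hom_cact σ := cact_toCoind f σ

end CyclicOperad

/-! ### The right adjoint of the forgetful functor. -/

namespace Operad

variable {M : Type u} [Category.{v} M] [MonoidalCategory M] [SymmetricCategory M]
  [HasFiniteProducts M] (P : Operad M)

/-- The projection of the cofree cyclic operad. -/
noncomputable def cofreeCounit : P.cofreeCyclic.toOperad ⟶ P where
  app _ := P.prj 1
  app_act σ := by
    change P.coindAct (extendPerm σ) ≫ _ = _
    rw [coindAct_prj, mul_one, ← one_mul (extendPerm σ), prj_mul_extendPerm]
    rfl
  app_one := P.coindOne_prj 1
  app_comp h i := by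
    change P.glue h (isGlue_stdGlue h i) ≫ _ = _
    have e := P.root_eq_left h ((isGlue_stdGlue h i).comp_perm 1) (isRooted_stdGlue h i)
    rw [glue_prj, e, P.act_one, Category.comp_id]
    rfl

theorem toCofree_counit {Q : CyclicOperad M} (f : Q.toOperad ⟶ P) :
    (CyclicOperad.toCofree f).hom ≫ P.cofreeCounit = f :=
  Hom.ext (funext fun n => by
    change CyclicOperad.toCoind f n ≫ P.prj 1 = _
    rw [CyclicOperad.toCoind_prj, Q.cact_one, Category.id_comp])

/-- A map of cyclic operads into the cofree one is determined by its component at the output `0`,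
since every other component arises from this one by acting. -/
theorem toCofree_hom_counit {Q : CyclicOperad M} (g : Q ⟶ P.cofreeCyclic) :
    CyclicOperad.toCofree (g.hom ≫ P.cofreeCounit) = g :=
  CyclicOperad.Hom.ext (Hom.ext (funext fun n => coind_ext fun σ => by
    refine (CyclicOperad.toCoind_prj _ σ).trans ?_
    refine ((Category.assoc _ _ _).symm.trans (congrArg (· ≫ P.prj 1) (g.hom_cact σ))).trans ?_
    refine (Category.assoc _ _ _).trans (congrArg (g.hom.app n ≫ ·) ?_)
    exact (P.coindAct_prj σ 1).trans (by rw [mul_one])))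

variable (M) in
/-- The universal property of the cofree cyclic operad. -/
noncomputable def cofreeHomEquiv (Q : CyclicOperad M) (P : Operad M) :
    ((CyclicOperad.forget M).obj Q ⟶ P) ≃ (Q ⟶ P.cofreeCyclic) where
  toFun f := CyclicOperad.toCofree f
  invFun g := g.hom ≫ P.cofreeCounit
  left_inv f := P.toCofree_counit f
  right_inv g := P.toCofree_hom_counit g

theorem cofreeHomEquiv_symm_naturality {Q' Q : CyclicOperad M} (g : Q' ⟶ Q)
    (f : Q ⟶ P.cofreeCyclic) :
    (cofreeHomEquiv M Q' P).symm (g ≫ f) =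
      (CyclicOperad.forget M).map g ≫ (cofreeHomEquiv M Q P).symm f :=
  Hom.ext (funext fun _ => Category.assoc _ _ _)

theorem cofreeHomEquiv_naturality {Q' Q : CyclicOperad M} (g : Q' ⟶ Q)
    (f : (CyclicOperad.forget M).obj Q ⟶ P) :
    cofreeHomEquiv M Q' P ((CyclicOperad.forget M).map g ≫ f) = g ≫ cofreeHomEquiv M Q P f := by
  rw [← Equiv.eq_symm_apply, cofreeHomEquiv_symm_naturality, Equiv.symm_apply_apply]

variable (M) in
/-- The right adjoint of the forgetful functor from cyclic operads to operads. -/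
noncomputable def cofree : Operad M ⥤ CyclicOperad M :=
  Adjunction.rightAdjointOfEquiv (cofreeHomEquiv M) fun _ _ P g f =>
    P.cofreeHomEquiv_naturality g f

variable (M) in
/-- Cofree cyclic operads are right adjoint to the forgetful functor. -/
noncomputable def cofreeAdjunction : CyclicOperad.forget M ⊣ cofree M :=
  Adjunction.adjunctionOfEquivRight (cofreeHomEquiv M) fun _ _ P g f =>
    P.cofreeHomEquiv_naturality g f

variable {P}

/-- This formula carries the homotopical content: composed with the forgetful functor, the right
adjoint is levelwise a finite power, so it preserves every class of maps that is defined levelwise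
and closed under products. -/
theorem cofree_map_app {P' : Operad M} (f : P ⟶ P') (n : ℕ) :
    ((cofree M).map f).hom.app n = Limits.Pi.map fun _ : Fin (n + 1) => f.app n :=
  coind_ext fun σ => by
    have e : (Limits.Pi.map fun _ : Fin (n + 1) => f.app n) ≫ P'.prj σ = P.prj σ ≫ f.app n := by
      rw [prj, prj, Limits.Pi.map_π_assoc, Category.assoc, f.app_act]
    refine Eq.trans ?_ e.symm
    refine (CyclicOperad.toCoind_prj _ σ).trans ?_
    change P.coindAct σ ≫ (𝟙 (P.coind n) ≫ P.prj 1) ≫ f.app n = _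
    rw [Category.id_comp, ← Category.assoc, coindAct_prj, mul_one]

end Operad

/-! ### The free cyclic operad and the left adjoint. -/

/-- Formal operations of arity `n`, built from a generator in each arity, a unit, partial
compositions, and the actions of the groups `Aut {0, …, n}`. -/
inductive CyclicTerm : ℕ → Type
  | gen (n : ℕ) : CyclicTerm n
  | one : CyclicTerm 1
  | comp {m n k : ℕ} (h : m + n = k + 1) (i : Fin m) (t : CyclicTerm m) (s : CyclicTerm n) :
    CyclicTerm k
  | cact {n : ℕ} (σ : Equiv.Perm (Fin (n + 1))) (t : CyclicTerm n) : CyclicTerm n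

section

variable {M : Type u} [Category.{v} M] {T S : Type*} {X : T → M} {A : M} {Y : S → M} {B : M}

/-- A family of morphisms with a common target that is jointly epimorphic. -/
def JointlyEpi (a : ∀ t, X t ⟶ A) : Prop :=
  ∀ ⦃Z : M⦄ ⦃f g : A ⟶ Z⦄, (∀ t, a t ≫ f = a t ≫ g) → f = g

variable [MonoidalCategory M] [MonoidalClosed M] {a : ∀ t, X t ⟶ A} {b : ∀ s, Y s ⟶ B}

/-- Tensoring with a fixed object is a left adjoint, so equalities can be tested after currying.
This lets the axioms of the free cyclic operad be checked on formal terms. -/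
theorem JointlyEpi.whiskerLeft (ha : JointlyEpi a) (B : M) : JointlyEpi fun t => B ◁ a t :=
  fun Z f g h => MonoidalClosed.curry_injective (ha fun t => by
    rw [← MonoidalClosed.curry_natural_left, ← MonoidalClosed.curry_natural_left, h])

variable [SymmetricCategory M]

theorem JointlyEpi.whiskerRight (ha : JointlyEpi a) (B : M) : JointlyEpi fun t => a t ▷ B :=
  fun Z f g h => by
    rw [← cancel_epi (β_ B A).hom]
    refine ha.whiskerLeft B fun t => ?_
    rw [BraidedCategory.braiding_naturality_right_assoc,
      BraidedCategory.braiding_naturality_right_assoc, h]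

theorem JointlyEpi.tensor (ha : JointlyEpi a) (hb : JointlyEpi b) :
    JointlyEpi fun p : T × S => a p.1 ⊗ₘ b p.2 :=
  fun Z f g h => ha.whiskerRight B fun t => hb.whiskerLeft (X t) fun s => by
    have : (a t ⊗ₘ b s) ≫ f = (a t ⊗ₘ b s) ≫ g := h (t, s)
    rwa [MonoidalCategory.tensorHom_def', Category.assoc, Category.assoc] at this

end

namespace Operad

section

variable {M : Type u} [Category.{v} M] [MonoidalCategory M] [SymmetricCategory M] (P : Operad M)

/-- The object parametrizing the operations of the shape `t` with generators from `P`. -/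
@[reducible]
def shape : ∀ {n : ℕ}, CyclicTerm n → M
  | _, .gen n => P.obj n
  | _, .one => 𝟙_ M
  | _, .comp _ _ t s => shape t ⊗ shape s
  | _, .cact _ t => shape t

/-- The relations that hold between the formal operations with generators from `P` in every
cyclic operad. -/
inductive ShapeRel : ∀ {n : ℕ} (t s : CyclicTerm n), (P.shape t ⟶ P.shape s) → Prop
  | gen_act {n : ℕ} (σ : Equiv.Perm (Fin n)) :
    ShapeRel (.cact (extendPerm σ) (.gen n)) (.gen n) (P.act σ)
  | gen_one : ShapeRel .one (.gen 1) P.one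
  | gen_comp {m n k : ℕ} (h : m + n = k + 1) (i : Fin m) :
    ShapeRel (.comp h i (.gen m) (.gen n)) (.gen k) (P.comp h i)
  | one_comp {n : ℕ} (h : 1 + n = n + 1) (t : CyclicTerm n) :
    ShapeRel (.comp h 0 .one t) t (λ_ (P.shape t)).hom
  | comp_one {m : ℕ} (i : Fin m) (t : CyclicTerm m) :
    ShapeRel (.comp rfl i t .one) t (ρ_ (P.shape t)).hom
  | assoc_seq {l m n a b k : ℕ} (hlm : l + m = a + 1) (han : a + n = k + 1)
    (hmn : m + n = b + 1) (hlb : l + b = k + 1) (i : Fin l) (j : Fin m) (c : Fin a)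
    (hc : (c : ℕ) = i + j) (t : CyclicTerm l) (s : CyclicTerm m) (r : CyclicTerm n) :
    ShapeRel (.comp han c (.comp hlm i t s) r) (.comp hlb i t (.comp hmn j s r))
      (α_ (P.shape t) (P.shape s) (P.shape r)).hom
  | assoc_par {l m n a b k : ℕ} (hlm : l + m = a + 1) (han : a + n = k + 1)
    (hln : l + n = b + 1) (hbm : b + m = k + 1) (i j : Fin l) (hij : i < j)
    (c : Fin a) (d : Fin b) (hc : (c : ℕ) + 1 = j + m) (hd : (d : ℕ) = i)
    (t : CyclicTerm l) (s : CyclicTerm m) (r : CyclicTerm n) :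
    ShapeRel (.comp han c (.comp hlm i t s) r) (.comp hbm d (.comp hln j t r) s)
      ((α_ (P.shape t) (P.shape s) (P.shape r)).hom ≫
        (P.shape t ◁ (β_ (P.shape s) (P.shape r)).hom) ≫
        (α_ (P.shape t) (P.shape r) (P.shape s)).inv)
  | equivariance {m n k : ℕ} (h : m + n = k + 1) (i : Fin m) (σ : Equiv.Perm (Fin m))
    (ρ : Equiv.Perm (Fin n)) (π : Equiv.Perm (Fin k))
    (h₁ : ∀ (a : Fin m) (c : Fin k), a ≠ i → (c : ℕ) = outerPos n i a →
      (π c : ℕ) = outerPos n (σ i) (σ a))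
    (h₂ : ∀ (b : Fin n) (c : Fin k), (c : ℕ) = i + b → (π c : ℕ) = σ i + ρ b)
    (t : CyclicTerm m) (s : CyclicTerm n) :
    ShapeRel (.comp h i (.cact (extendPerm σ) t) (.cact (extendPerm ρ) s))
      (.cact (extendPerm π) (.comp h (σ i) t s)) (𝟙 (P.shape t ⊗ P.shape s))
  | cact_one {n : ℕ} (t : CyclicTerm n) : ShapeRel (.cact 1 t) t (𝟙 (P.shape t))
  | cact_mul {n : ℕ} (σ ρ : Equiv.Perm (Fin (n + 1))) (t : CyclicTerm n) :
    ShapeRel (.cact (σ * ρ) t) (.cact ρ (.cact σ t)) (𝟙 (P.shape t))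
  | one_rotate : ShapeRel (.cact (finRotate 2) .one) .one (𝟙 (𝟙_ M))
  | comp_rotate {m n k : ℕ} (h : m + n = k + 1) (i j : Fin m) (hij : (i : ℕ) = j + 1)
    (t : CyclicTerm m) (s : CyclicTerm n) :
    ShapeRel (.cact (finRotate (k + 1)) (.comp h i t s))
      (.comp h j (.cact (finRotate (m + 1)) t) s) (𝟙 (P.shape t ⊗ P.shape s))
  | comp_rotate_first {m n k : ℕ} (h : m + n = k + 1) (h' : n + m = k + 1) (i : Fin m)
    (j : Fin n) (hi : (i : ℕ) = 0) (hj : (j : ℕ) + 1 = n) (t : CyclicTerm m)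
    (s : CyclicTerm n) :
    ShapeRel (.cact (finRotate (k + 1)) (.comp h i t s))
      (.comp h' j (.cact (finRotate (n + 1)) s) (.cact (finRotate (m + 1)) t))
      (β_ (P.shape t) (P.shape s)).hom
  | comp_left {m n k : ℕ} (h : m + n = k + 1) (i : Fin m) (t t' : CyclicTerm m)
    (s : CyclicTerm n) (φ : P.shape t ⟶ P.shape t') (hφ : ShapeRel t t' φ) :
    ShapeRel (.comp h i t s) (.comp h i t' s) (φ ▷ P.shape s)
  | comp_right {m n k : ℕ} (h : m + n = k + 1) (i : Fin m) (t : CyclicTerm m)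
    (s s' : CyclicTerm n) (φ : P.shape s ⟶ P.shape s') (hφ : ShapeRel s s' φ) :
    ShapeRel (.comp h i t s) (.comp h i t s') (P.shape t ◁ φ)
  | cact {n : ℕ} (σ : Equiv.Perm (Fin (n + 1))) (t t' : CyclicTerm n)
    (φ : P.shape t ⟶ P.shape t') (hφ : ShapeRel t t' φ) :
    ShapeRel (.cact σ t) (.cact σ t') φ

variable {P}

/-- The value of a formal operation in a cyclic operad. -/
def eval {Q : CyclicOperad M} (g : P ⟶ Q.toOperad) : ∀ {n : ℕ} (t : CyclicTerm n),
    P.shape t ⟶ Q.obj n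
  | _, .gen n => g.app n
  | _, .one => Q.one
  | _, .comp h i t s => (eval g t ⊗ₘ eval g s) ≫ Q.comp h i
  | _, .cact σ t => eval g t ≫ Q.cact σ

/-- Soundness of the relations: the generating cases are preservation of structure by `g` and the
axioms of `Q`; the remaining three follow from functoriality of the tensor product and of
composition. -/
theorem ShapeRel.eval {Q : CyclicOperad M} (g : P ⟶ Q.toOperad) {n : ℕ} {t s : CyclicTerm n}
    {φ : P.shape t ⟶ P.shape s} (hφ : P.ShapeRel t s φ) : φ ≫ eval g s = eval g t := by
  induction hφ with
  | gen_act σ =>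
    change P.act σ ≫ g.app _ = g.app _ ≫ Q.cact (extendPerm σ)
    rw [CyclicOperad.cact_extendPerm, g.app_act]
  | gen_one => exact g.app_one
  | gen_comp h i => exact g.app_comp h i
  | one_comp h t =>
    simp only [Operad.eval]
    rw [MonoidalCategory.tensorHom_def', Category.assoc, Q.one_comp,
      MonoidalCategory.leftUnitor_naturality]
  | comp_one i t =>
    simp only [Operad.eval]
    rw [MonoidalCategory.tensorHom_def, Category.assoc, Q.comp_one,
      MonoidalCategory.rightUnitor_naturality]
  | assoc_seq hlm han hmn hlb i j c hc t s r =>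
    simp only [Operad.eval]
    rw [← MonoidalCategory.tensorHom_comp_whiskerLeft, ← MonoidalCategory.tensorHom_comp_whiskerRight,
      Category.assoc, Category.assoc, Q.assoc_seq hlm han hmn hlb i j c hc,
      MonoidalCategory.associator_naturality_assoc]
  | assoc_par hlm han hln hbm i j hij c d hc hd t s r =>
    simp only [Operad.eval]
    rw [← MonoidalCategory.tensorHom_comp_whiskerRight, ← MonoidalCategory.tensorHom_comp_whiskerRight,
      Category.assoc, Category.assoc, Category.assoc, Category.assoc,
      Q.assoc_par hlm han hln hbm i j hij c d hc hd,
      MonoidalCategory.associator_naturality_assoc,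
      MonoidalCategory.tensorHom_comp_whiskerLeft_assoc, BraidedCategory.braiding_naturality,
      ← MonoidalCategory.whiskerLeft_comp_tensorHom_assoc,
      MonoidalCategory.associator_inv_naturality_assoc]
  | equivariance h i σ ρ π h₁ h₂ t s =>
    simp only [Operad.eval]
    have := Q.equivariance h i σ ρ π h₁ h₂
    rw [CyclicOperad.cact_extendPerm, CyclicOperad.cact_extendPerm, CyclicOperad.cact_extendPerm,
      ← MonoidalCategory.tensorHom_comp_tensorHom_assoc, this, Category.id_comp, Category.assoc]
  | cact_one t =>
    simp only [Operad.eval]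
    rw [Q.cact_one, Category.id_comp, Category.comp_id]
  | cact_mul σ ρ t =>
    simp only [Operad.eval]
    rw [Q.cact_mul, Category.id_comp, Category.assoc]
  | one_rotate =>
    simp only [Operad.eval]
    rw [Q.one_rotate, Category.id_comp]
  | comp_rotate h i j hij t s =>
    simp only [Operad.eval]
    rw [Category.assoc, Q.comp_rotate h i j hij, Category.id_comp,
      MonoidalCategory.tensorHom_comp_whiskerRight_assoc]
  | comp_rotate_first h h' i j hi hj t s =>
    simp only [Operad.eval]
    rw [Category.assoc, Q.comp_rotate_first h h' i j hi hj,
      BraidedCategory.braiding_naturality_assoc, MonoidalCategory.tensorHom_comp_tensorHom_assoc]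
  | comp_left h i t t' s φ hφ ih =>
    simp only [Operad.eval]
    rw [← ih, ← MonoidalCategory.whiskerRight_comp_tensorHom, Category.assoc]
  | comp_right h i t s s' φ hφ ih =>
    simp only [Operad.eval]
    rw [← ih, ← MonoidalCategory.whiskerLeft_comp_tensorHom, Category.assoc]
  | cact σ t t' φ hφ ih =>
    simp only [Operad.eval]
    rw [← ih, Category.assoc]

end

section

variable {M : Type u} [Category.{v} M] [MonoidalCategory M] [SymmetricCategory M] [HasColimits M]
  (P : Operad M)

/-- The relations in arity `n`. -/
abbrev RelIndex (n : ℕ) : Type v :=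
  Σ (t : ULift.{v} (CyclicTerm n)) (s : ULift.{v} (CyclicTerm n)),
    { φ : P.shape t.down ⟶ P.shape s.down // P.ShapeRel t.down s.down φ }

/-- The object of operations of arity `n` of the cyclic operad freely generated by `P`. -/
noncomputable def freeObj (n : ℕ) : M :=
  coequalizer
    (Sigma.desc fun r : P.RelIndex n => Sigma.ι (fun t : ULift.{v} (CyclicTerm n) =>
      P.shape t.down) r.1)
    (Sigma.desc fun r : P.RelIndex n => r.2.2.1 ≫
      Sigma.ι (fun t : ULift.{v} (CyclicTerm n) => P.shape t.down) r.2.1)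

/-- The operations of the shape `t` in the cyclic operad freely generated by `P`. -/
noncomputable def freeι {n : ℕ} (t : CyclicTerm n) : P.shape t ⟶ P.freeObj n :=
  Sigma.ι (fun t : ULift.{v} (CyclicTerm n) => P.shape t.down) ⟨t⟩ ≫ coequalizer.π _ _

variable {P}

theorem ShapeRel.comp_freeι {n : ℕ} {t s : CyclicTerm n} {φ : P.shape t ⟶ P.shape s}
    (hφ : P.ShapeRel t s φ) : φ ≫ P.freeι s = P.freeι t := by
  have := (Sigma.ι (fun r : P.RelIndex n => P.shape r.1.down) ⟨⟨t⟩, ⟨s⟩, φ, hφ⟩) ≫=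
    coequalizer.condition
    (Sigma.desc fun r : P.RelIndex n => Sigma.ι (fun t : ULift.{v} (CyclicTerm n) =>
      P.shape t.down) r.1)
    (Sigma.desc fun r : P.RelIndex n => r.2.2.1 ≫
      Sigma.ι (fun t : ULift.{v} (CyclicTerm n) => P.shape t.down) r.2.1)
  rw [Sigma.ι_desc_assoc, Sigma.ι_desc_assoc, Category.assoc] at this
  exact this.symm

theorem freeObj_hom_ext {n : ℕ} {Z : M} {f g : P.freeObj n ⟶ Z}
    (h : ∀ t, P.freeι t ≫ f = P.freeι t ≫ g) : f = g :=
  coequalizer.hom_ext (Sigma.hom_ext _ _ fun t =>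
    (Category.assoc _ _ _).symm.trans ((h t.down).trans (Category.assoc _ _ _)))

theorem jointlyEpi_freeι (n : ℕ) : JointlyEpi (P.freeι (n := n)) :=
  fun _ _ _ h => freeObj_hom_ext h

/-- The map from `P.freeObj n` given by a family that is compatible with the relations. -/
noncomputable def freeDesc {n : ℕ} {Z : M} (g : ∀ t : CyclicTerm n, P.shape t ⟶ Z)
    (hg : ∀ t s φ, P.ShapeRel t s φ → φ ≫ g s = g t) : P.freeObj n ⟶ Z :=
  coequalizer.desc (Sigma.desc fun t => g t.down) (Sigma.hom_ext _ _ fun r => by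
    rw [Sigma.ι_desc_assoc, Sigma.ι_desc_assoc, Category.assoc, Sigma.ι_desc, Sigma.ι_desc]
    exact (hg _ _ _ r.2.2.2).symm)

theorem freeι_desc {n : ℕ} {Z : M} (g : ∀ t : CyclicTerm n, P.shape t ⟶ Z)
    (hg : ∀ t s φ, P.ShapeRel t s φ → φ ≫ g s = g t) (t : CyclicTerm n) :
    P.freeι t ≫ freeDesc g hg = g t :=
  (Category.assoc _ _ _).trans ((congrArg _ (coequalizer.π_desc _ _)).trans (Sigma.ι_desc _ _))

variable (P) in
/-- The action of `Aut {0, …, n}` on the cyclic operad freely generated by `P`. -/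
noncomputable def freeCact {n : ℕ} (σ : Equiv.Perm (Fin (n + 1))) : P.freeObj n ⟶ P.freeObj n :=
  freeDesc (fun t => P.freeι (.cact σ t))
    fun t t' φ hφ => (ShapeRel.cact (P := P) σ t t' φ hφ).comp_freeι

variable (P) in
theorem freeι_freeCact {n : ℕ} (σ : Equiv.Perm (Fin (n + 1))) (t : CyclicTerm n) :
    P.freeι t ≫ P.freeCact σ = P.freeι (.cact σ t) :=
  freeι_desc ..

variable {Q : CyclicOperad M}

/-- The components of the map from a free cyclic operad that is adjoint to `g`. -/
noncomputable def evalDesc (g : P ⟶ Q.toOperad) (n : ℕ) : P.freeObj n ⟶ Q.obj n :=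
  freeDesc (fun t => eval g t) fun _ _ _ hφ => hφ.eval g

theorem freeι_evalDesc (g : P ⟶ Q.toOperad) {n : ℕ} (t : CyclicTerm n) :
    P.freeι t ≫ evalDesc g n = eval g t :=
  freeι_desc ..

theorem freeCact_evalDesc (g : P ⟶ Q.toOperad) {n : ℕ} (σ : Equiv.Perm (Fin (n + 1))) :
    P.freeCact σ ≫ evalDesc g n = evalDesc g n ≫ Q.cact σ :=
  freeObj_hom_ext fun t => by
    rw [reassoc_of% freeι_freeCact, freeι_evalDesc, ← Category.assoc, freeι_evalDesc, eval]

end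

section

variable {M : Type u} [Category.{v} M] [MonoidalCategory M] [SymmetricCategory M] [HasColimits M]
  [MonoidalClosed M] {P : Operad M}

theorem whiskerLeft_freeObj_hom_ext {n : ℕ} {X Z : M} {f g : X ⊗ P.freeObj n ⟶ Z}
    (h : ∀ t, X ◁ P.freeι t ≫ f = X ◁ P.freeι t ≫ g) : f = g :=
  (jointlyEpi_freeι n).whiskerLeft X h

theorem tensor_freeObj_hom_ext {m n : ℕ} {Z : M} {f g : P.freeObj m ⊗ P.freeObj n ⟶ Z}
    (h : ∀ t s, (P.freeι t ⊗ₘ P.freeι s) ≫ f = (P.freeι t ⊗ₘ P.freeι s) ≫ g) : f = g :=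
  (jointlyEpi_freeι m).tensor (jointlyEpi_freeι n) fun p => h p.1 p.2

theorem tensor_tensor_freeObj_hom_ext {l m n : ℕ} {Z : M}
    {f g : (P.freeObj l ⊗ P.freeObj m) ⊗ P.freeObj n ⟶ Z}
    (h : ∀ t s r, ((P.freeι t ⊗ₘ P.freeι s) ⊗ₘ P.freeι r) ≫ f =
      ((P.freeι t ⊗ₘ P.freeι s) ⊗ₘ P.freeι r) ≫ g) : f = g :=
  ((jointlyEpi_freeι l).tensor (jointlyEpi_freeι m)).tensor (jointlyEpi_freeι n)
    fun p => h p.1.1 p.1.2 p.2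

/-- The map from a tensor product given by a family that is compatible with the relations. -/
noncomputable def freeDescRight {n : ℕ} {X Z : M} (g : ∀ t : CyclicTerm n, X ⊗ P.shape t ⟶ Z)
    (hg : ∀ t s φ, P.ShapeRel t s φ → X ◁ φ ≫ g s = g t) : X ⊗ P.freeObj n ⟶ Z :=
  MonoidalClosed.uncurry (freeDesc (fun t => MonoidalClosed.curry (g t)) fun t s φ hφ => by
    rw [← MonoidalClosed.curry_natural_left, hg _ _ _ hφ])

theorem freeι_descRight {n : ℕ} {X Z : M} (g : ∀ t : CyclicTerm n, X ⊗ P.shape t ⟶ Z)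
    (hg : ∀ t s φ, P.ShapeRel t s φ → X ◁ φ ≫ g s = g t) (t : CyclicTerm n) :
    X ◁ P.freeι t ≫ freeDescRight g hg = g t := by
  rw [freeDescRight, ← MonoidalClosed.uncurry_natural_left, freeι_desc, MonoidalClosed.uncurry_curry]

/-- The map from a tensor product given by a family that is compatible with the relations. -/
noncomputable def freeDescLeft {n : ℕ} {X Z : M} (g : ∀ t : CyclicTerm n, P.shape t ⊗ X ⟶ Z)
    (hg : ∀ t s φ, P.ShapeRel t s φ → φ ▷ X ≫ g s = g t) : P.freeObj n ⊗ X ⟶ Z :=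
  (β_ _ _).hom ≫ freeDescRight (fun t => (β_ _ _).hom ≫ g t) fun t s φ hφ => by
    rw [BraidedCategory.braiding_naturality_right_assoc, hg _ _ _ hφ]

theorem freeι_descLeft {n : ℕ} {X Z : M} (g : ∀ t : CyclicTerm n, P.shape t ⊗ X ⟶ Z)
    (hg : ∀ t s φ, P.ShapeRel t s φ → φ ▷ X ≫ g s = g t) (t : CyclicTerm n) :
    P.freeι t ▷ X ≫ freeDescLeft g hg = g t := by
  rw [freeDescLeft, BraidedCategory.braiding_naturality_left_assoc, freeι_descRight,
    SymmetricCategory.symmetry_assoc]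

variable (P)

/-- The composition of the cyclic operad freely generated by `P`, with the first operation
fixed. -/
noncomputable def freeCompRight {m n k : ℕ} (h : m + n = k + 1) (i : Fin m) (t : CyclicTerm m) :
    P.shape t ⊗ P.freeObj n ⟶ P.freeObj k :=
  freeDescRight (fun s => P.freeι (.comp h i t s))
    fun s s' φ hφ => (ShapeRel.comp_right (P := P) h i t s s' φ hφ).comp_freeι

theorem freeι_freeCompRight {m n k : ℕ} (h : m + n = k + 1) (i : Fin m) (t : CyclicTerm m)
    (s : CyclicTerm n) : P.shape t ◁ P.freeι s ≫ P.freeCompRight h i t =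
      P.freeι (.comp h i t s) :=
  freeι_descRight ..

/-- The composition of the cyclic operad freely generated by `P`. -/
noncomputable def freeComp {m n k : ℕ} (h : m + n = k + 1) (i : Fin m) :
    P.freeObj m ⊗ P.freeObj n ⟶ P.freeObj k :=
  freeDescLeft (P.freeCompRight h i)
    -- The second factor has already been passed to the quotient. A relation in the first factor
    -- commutes past it by the exchange law, and `comp_left` applies.
    fun t t' φ hφ => whiskerLeft_freeObj_hom_ext fun s => by
      rw [MonoidalCategory.whisker_exchange_assoc, freeι_freeCompRight, freeι_freeCompRight]
      exact (ShapeRel.comp_left (P := P) h i t t' s φ hφ).comp_freeι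

theorem freeι_freeComp {m n k : ℕ} (h : m + n = k + 1) (i : Fin m) (t : CyclicTerm m)
    (s : CyclicTerm n) :
    (P.freeι t ⊗ₘ P.freeι s) ≫ P.freeComp h i = P.freeι (.comp h i t s) := by
  rw [freeComp, MonoidalCategory.tensorHom_def', Category.assoc, freeι_descLeft,
    freeι_freeCompRight]

/-- The cyclic operad freely generated by `P`. -/
noncomputable def freeCyclic : CyclicOperad M where
  obj := P.freeObj
  act σ := P.freeCact (extendPerm σ)
  one := P.freeι .one
  comp h i := P.freeComp h i
  cact σ := P.freeCact σ
  act_one n := freeObj_hom_ext fun t => by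
    rw [extendPerm_one, freeι_freeCact, Category.comp_id]
    exact (ShapeRel.cact_one (P := P) t).comp_freeι.symm.trans (Category.id_comp _)
  act_mul σ ρ := freeObj_hom_ext fun t => by
    rw [extendPerm_mul, freeι_freeCact, reassoc_of% freeι_freeCact, freeι_freeCact]
    exact (ShapeRel.cact_mul (P := P) _ _ t).comp_freeι.symm.trans (Category.id_comp _)
  cact_one n := freeObj_hom_ext fun t => by
    rw [freeι_freeCact, Category.comp_id]
    exact (ShapeRel.cact_one (P := P) t).comp_freeι.symm.trans (Category.id_comp _)
  cact_mul σ ρ := freeObj_hom_ext fun t => by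
    rw [freeι_freeCact, reassoc_of% freeι_freeCact, freeι_freeCact]
    exact (ShapeRel.cact_mul (P := P) _ _ t).comp_freeι.symm.trans (Category.id_comp _)
  cact_extend σ σ' h0 hσ := by
    congr 1
    refine Equiv.ext (Fin.cases ?_ fun a => ?_)
    · rw [h0, extendPerm_zero]
    · rw [hσ, extendPerm_succ]
  one_comp h := whiskerLeft_freeObj_hom_ext fun t => by
    rw [← MonoidalCategory.tensorHom_def'_assoc, freeι_freeComp,
      MonoidalCategory.leftUnitor_naturality]
    exact (ShapeRel.one_comp (P := P) h t).comp_freeι.symm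
  comp_one i := (jointlyEpi_freeι _).whiskerRight _ fun t => by
    rw [← MonoidalCategory.tensorHom_def_assoc, freeι_freeComp,
      MonoidalCategory.rightUnitor_naturality]
    exact (ShapeRel.comp_one (P := P) i t).comp_freeι.symm
  assoc_seq hlm han hmn hlb i j c hc := tensor_tensor_freeObj_hom_ext fun t s r => by
    rw [MonoidalCategory.tensorHom_comp_whiskerRight_assoc, freeι_freeComp, freeι_freeComp,
      MonoidalCategory.associator_naturality_assoc,
      MonoidalCategory.tensorHom_comp_whiskerLeft_assoc, freeι_freeComp, freeι_freeComp]
    exact (ShapeRel.assoc_seq (P := P) hlm han hmn hlb i j c hc t s r).comp_freeι.symm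
  assoc_par hlm han hln hbm i j hij c d hc hd := tensor_tensor_freeObj_hom_ext fun t s r => by
    rw [MonoidalCategory.tensorHom_comp_whiskerRight_assoc, freeι_freeComp, freeι_freeComp,
      MonoidalCategory.associator_naturality_assoc,
      MonoidalCategory.tensorHom_comp_whiskerLeft_assoc, BraidedCategory.braiding_naturality,
      ← MonoidalCategory.whiskerLeft_comp_tensorHom_assoc,
      MonoidalCategory.associator_inv_naturality_assoc,
      MonoidalCategory.tensorHom_comp_whiskerRight_assoc, freeι_freeComp, freeι_freeComp]
    have := (ShapeRel.assoc_par (P := P) hlm han hln hbm i j hij c d hc hd t s r).comp_freeι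
    simpa only [Category.assoc] using this.symm
  equivariance h i σ ρ π h₁ h₂ := tensor_freeObj_hom_ext fun t s => by
    rw [MonoidalCategory.tensorHom_comp_tensorHom_assoc, freeι_freeCact, freeι_freeCact,
      freeι_freeComp, reassoc_of% freeι_freeComp, freeι_freeCact]
    exact (ShapeRel.equivariance (P := P) h i σ ρ π h₁ h₂ t s).comp_freeι.symm.trans
      (Category.id_comp _)
  one_rotate := by
    rw [freeι_freeCact]
    exact (ShapeRel.one_rotate (P := P)).comp_freeι.symm.trans (Category.id_comp _)
  comp_rotate h i j hij := tensor_freeObj_hom_ext fun t s => by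
    rw [MonoidalCategory.tensorHom_comp_whiskerRight_assoc, freeι_freeCact,
      freeι_freeComp, reassoc_of% freeι_freeComp, freeι_freeCact]
    exact (ShapeRel.comp_rotate (P := P) h i j hij t s).comp_freeι.symm.trans
      (Category.id_comp _)
  comp_rotate_first h h' i j hi hj := tensor_freeObj_hom_ext fun t s => by
    rw [BraidedCategory.braiding_naturality_assoc, reassoc_of% freeι_freeComp, freeι_freeCact,
      MonoidalCategory.tensorHom_comp_tensorHom_assoc, freeι_freeCact, freeι_freeCact,
      freeι_freeComp]
    exact (ShapeRel.comp_rotate_first (P := P) h h' i j hi hj t s).comp_freeι.symm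

/-- The inclusion of the generators. -/
noncomputable def freeUnit : P ⟶ P.freeCyclic.toOperad where
  app n := P.freeι (.gen n)
  app_act {n} σ := (ShapeRel.gen_act (P := P) σ).comp_freeι.trans
    (P.freeι_freeCact (extendPerm σ) (.gen n)).symm
  app_one := (ShapeRel.gen_one (P := P)).comp_freeι
  app_comp h i := (ShapeRel.gen_comp (P := P) h i).comp_freeι.trans
    (P.freeι_freeComp h i (.gen _) (.gen _)).symm

variable {P} {Q : CyclicOperad M}

theorem freeComp_evalDesc (g : P ⟶ Q.toOperad) {m n k : ℕ} (h : m + n = k + 1) (i : Fin m) :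
    P.freeComp h i ≫ evalDesc g k = (evalDesc g m ⊗ₘ evalDesc g n) ≫ Q.comp h i :=
  tensor_freeObj_hom_ext fun t s => by
    rw [reassoc_of% freeι_freeComp, freeι_evalDesc, MonoidalCategory.tensorHom_comp_tensorHom_assoc,
      freeι_evalDesc, freeι_evalDesc, eval]

/-- The map from a free cyclic operad that is adjoint to `g`. -/
noncomputable def ofFree (g : P ⟶ Q.toOperad) : P.freeCyclic ⟶ Q where
  hom :=
    { app := evalDesc g
      app_act := fun σ => (freeCact_evalDesc g (extendPerm σ)).trans
        (congrArg _ (Q.cact_extendPerm σ))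
      app_one := freeι_evalDesc g .one
      app_comp := fun h i => freeComp_evalDesc g h i }
  hom_cact σ := freeCact_evalDesc g σ

/-- Induction on terms: preservation of unit, composition and action forces the values on all terms
from those on generators. This is the uniqueness half of the universal property. -/
theorem freeι_app (f : P.freeCyclic ⟶ Q) {n : ℕ} (t : CyclicTerm n) :
    P.freeι t ≫ f.hom.app n = eval (P.freeUnit ≫ f.hom) t := by
  induction t with
  | gen n => rfl
  | one => exact f.hom.app_one
  | comp h i t s iht ihs =>
    rw [eval, ← iht, ← ihs, ← freeι_freeComp]
    refine (Category.assoc _ _ _).trans ((congrArg _ (f.hom.app_comp h i)).trans ?_)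
    exact MonoidalCategory.tensorHom_comp_tensorHom_assoc ..
  | cact σ t ih =>
    rw [eval, ← ih, ← freeι_freeCact]
    refine (Category.assoc _ _ _).trans (Eq.trans ?_ (Category.assoc _ _ _).symm)
    exact congrArg _ (f.hom_cact σ)

variable (M) in
/-- The universal property of the free cyclic operad. -/
noncomputable def freeHomEquiv (P : Operad M) (Q : CyclicOperad M) :
    (P.freeCyclic ⟶ Q) ≃ (P ⟶ (CyclicOperad.forget M).obj Q) where
  toFun f := P.freeUnit ≫ f.hom
  invFun g := ofFree g
  left_inv f := CyclicOperad.Hom.ext (Hom.ext (funext fun _ => freeObj_hom_ext fun t =>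
    (freeι_evalDesc _ t).trans (freeι_app f t).symm))
  right_inv g := Hom.ext (funext fun n => freeι_evalDesc g (.gen n))

theorem freeHomEquiv_naturality {Q' : CyclicOperad M} (g : Q ⟶ Q') (f : P.freeCyclic ⟶ Q) :
    freeHomEquiv M P Q' (f ≫ g) = freeHomEquiv M P Q f ≫ (CyclicOperad.forget M).map g :=
  Hom.ext (funext fun _ => (Category.assoc _ _ _).symm)

variable (M) in
/-- The left adjoint of the forgetful functor from cyclic operads to operads. -/
noncomputable def free : Operad M ⥤ CyclicOperad M :=
  Adjunction.leftAdjointOfEquiv (freeHomEquiv M) fun _ _ _ g f => freeHomEquiv_naturality g f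

variable (M) in
/-- Free cyclic operads are left adjoint to the forgetful functor. -/
noncomputable def freeAdjunction : free M ⊣ CyclicOperad.forget M :=
  Adjunction.adjunctionOfEquivLeft (freeHomEquiv M) fun _ _ _ g f => freeHomEquiv_naturality g f

end

end Operad

/-! ### Limits and colimits of cyclic operads. -/

namespace CyclicOperad

variable {M : Type u} [Category.{v} M] [MonoidalCategory M] [SymmetricCategory M]

variable (M) in
/-- The functor of operations of arity `n`. -/
def arity (n : ℕ) : CyclicOperad M ⥤ M where
  obj Q := Q.obj n
  map f := f.hom.app n

section

variable {J : Type*} [Category* J] [HasLimitsOfShape J M] (F : J ⥤ CyclicOperad M)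

/-- The operations of arity `n` of the limit of a diagram of cyclic operads. -/
noncomputable def limitObj (n : ℕ) : M := limit (F ⋙ arity M n)

/-- The projections from the limit of a diagram of cyclic operads. -/
noncomputable def limitπ (n : ℕ) (j : J) : limitObj F n ⟶ (F.obj j).obj n :=
  limit.π (F ⋙ arity M n) j

variable {F}

theorem limitObj_hom_ext {n : ℕ} {X : M} {f g : X ⟶ limitObj F n}
    (h : ∀ j, f ≫ limitπ F n j = g ≫ limitπ F n j) : f = g :=
  limit.hom_ext h

theorem limitπ_naturality {n : ℕ} {j j' : J} (φ : j ⟶ j') :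
    limitπ F n j ≫ (F.map φ).hom.app n = limitπ F n j' :=
  limit.w (F ⋙ arity M n) φ

/-- The map to the limit given by a compatible family. -/
noncomputable def limitLift {n : ℕ} {X : M} (g : ∀ j, X ⟶ (F.obj j).obj n)
    (hg : ∀ (j j' : J) (φ : j ⟶ j'), g j ≫ (F.map φ).hom.app n = g j') : X ⟶ limitObj F n :=
  limit.lift (F ⋙ arity M n)
    { pt := X
      π :=
        { app := g
          naturality := fun j j' φ => (Category.id_comp _).trans (hg j j' φ).symm } }

theorem limitLift_π {n : ℕ} {X : M} (g : ∀ j, X ⟶ (F.obj j).obj n)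
    (hg : ∀ (j j' : J) (φ : j ⟶ j'), g j ≫ (F.map φ).hom.app n = g j') (j : J) :
    limitLift g hg ≫ limitπ F n j = g j :=
  limit.lift_π _ _

variable (F)

/-- The action on the limit of a diagram of cyclic operads. -/
noncomputable def limitCact {n : ℕ} (σ : Equiv.Perm (Fin (n + 1))) :
    limitObj F n ⟶ limitObj F n :=
  limitLift (fun j => limitπ F n j ≫ (F.obj j).cact σ) fun _ _ φ => by
    rw [Category.assoc, (F.map φ).hom_cact, ← Category.assoc, limitπ_naturality]

theorem limitCact_π {n : ℕ} (σ : Equiv.Perm (Fin (n + 1))) (j : J) :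
    limitCact F σ ≫ limitπ F n j = limitπ F n j ≫ (F.obj j).cact σ :=
  limitLift_π ..

/-- The unit of the limit of a diagram of cyclic operads. -/
noncomputable def limitOne : 𝟙_ M ⟶ limitObj F 1 :=
  limitLift (fun j => (F.obj j).one) fun _ _ φ => (F.map φ).hom.app_one

theorem limitOne_π (j : J) : limitOne F ≫ limitπ F 1 j = (F.obj j).one :=
  limitLift_π ..

/-- The composition of the limit of a diagram of cyclic operads. -/
noncomputable def limitComp {m n k : ℕ} (h : m + n = k + 1) (i : Fin m) :
    limitObj F m ⊗ limitObj F n ⟶ limitObj F k :=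
  limitLift (fun j => (limitπ F m j ⊗ₘ limitπ F n j) ≫ (F.obj j).comp h i) fun _ _ φ => by
    rw [Category.assoc, (F.map φ).hom.app_comp,
      MonoidalCategory.tensorHom_comp_tensorHom_assoc, limitπ_naturality, limitπ_naturality]

theorem limitComp_π {m n k : ℕ} (h : m + n = k + 1) (i : Fin m) (j : J) :
    limitComp F h i ≫ limitπ F k j = (limitπ F m j ⊗ₘ limitπ F n j) ≫ (F.obj j).comp h i :=
  limitLift_π ..

/-- The limit of a diagram of cyclic operads. -/
noncomputable def limitCyclic : CyclicOperad M where
  obj := limitObj F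
  act σ := limitCact F (extendPerm σ)
  one := limitOne F
  comp h i := limitComp F h i
  cact σ := limitCact F σ
  act_one n := limitObj_hom_ext fun j => by
    rw [limitCact_π, extendPerm_one, cact_one, Category.id_comp, Category.comp_id]
  act_mul σ ρ := limitObj_hom_ext fun j => by
    rw [limitCact_π, extendPerm_mul, cact_mul, Category.assoc, limitCact_π, reassoc_of% limitCact_π]
  cact_one n := limitObj_hom_ext fun j => by
    rw [limitCact_π, cact_one, Category.id_comp, Category.comp_id]
  cact_mul σ ρ := limitObj_hom_ext fun j => by
    rw [limitCact_π, cact_mul, Category.assoc, limitCact_π, reassoc_of% limitCact_π]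
  cact_extend σ σ' h0 hσ := by
    congr 1
    refine Equiv.ext (Fin.cases ?_ fun a => ?_)
    · rw [h0, extendPerm_zero]
    · rw [hσ, extendPerm_succ]
  one_comp {n} h := limitObj_hom_ext fun j => by
    rw [Category.assoc, limitComp_π, MonoidalCategory.whiskerRight_comp_tensorHom_assoc,
      limitOne_π, MonoidalCategory.tensorHom_def', Category.assoc, (F.obj j).one_comp,
      MonoidalCategory.leftUnitor_naturality]
  comp_one i := limitObj_hom_ext fun j => by
    rw [Category.assoc, limitComp_π, MonoidalCategory.whiskerLeft_comp_tensorHom_assoc,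
      limitOne_π, MonoidalCategory.tensorHom_def, Category.assoc, (F.obj j).comp_one,
      MonoidalCategory.rightUnitor_naturality]
  assoc_seq hlm han hmn hlb i j c hc := limitObj_hom_ext fun x => by
    rw [Category.assoc, limitComp_π, MonoidalCategory.whiskerRight_comp_tensorHom_assoc,
      limitComp_π, ← MonoidalCategory.tensorHom_comp_whiskerRight_assoc,
      (F.obj x).assoc_seq hlm han hmn hlb i j c hc, Category.assoc, Category.assoc, limitComp_π,
      MonoidalCategory.whiskerLeft_comp_tensorHom_assoc, limitComp_π,
      ← MonoidalCategory.tensorHom_comp_whiskerLeft_assoc,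
      MonoidalCategory.associator_naturality_assoc]
  assoc_par hlm han hln hbm i j hij c d hc hd := limitObj_hom_ext fun x => by
    simp only [Category.assoc]
    rw [limitComp_π, MonoidalCategory.whiskerRight_comp_tensorHom_assoc,
      limitComp_π, ← MonoidalCategory.tensorHom_comp_whiskerRight_assoc,
      (F.obj x).assoc_par hlm han hln hbm i j hij c d hc hd, limitComp_π,
      MonoidalCategory.whiskerRight_comp_tensorHom_assoc, limitComp_π,
      ← MonoidalCategory.tensorHom_comp_whiskerRight_assoc,
      MonoidalCategory.associator_naturality_assoc,
      MonoidalCategory.tensorHom_comp_whiskerLeft_assoc, BraidedCategory.braiding_naturality,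
      ← MonoidalCategory.whiskerLeft_comp_tensorHom_assoc,
      MonoidalCategory.associator_inv_naturality_assoc]
  equivariance h i σ ρ π h₁ h₂ := limitObj_hom_ext fun x => by
    rw [Category.assoc, limitComp_π, MonoidalCategory.tensorHom_comp_tensorHom_assoc, limitCact_π,
      limitCact_π, Category.assoc, limitCact_π, reassoc_of% limitComp_π, cact_extendPerm,
      cact_extendPerm, cact_extendPerm, ← (F.obj x).equivariance h i σ ρ π h₁ h₂,
      MonoidalCategory.tensorHom_comp_tensorHom_assoc]
  one_rotate := limitObj_hom_ext fun x => by
    rw [Category.assoc, limitCact_π, reassoc_of% limitOne_π, limitOne_π, one_rotate]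
  comp_rotate h i j hij := limitObj_hom_ext fun x => by
    rw [Category.assoc, limitCact_π, reassoc_of% limitComp_π, (F.obj x).comp_rotate h i j hij,
      Category.assoc, limitComp_π, MonoidalCategory.whiskerRight_comp_tensorHom_assoc,
      limitCact_π, MonoidalCategory.tensorHom_comp_whiskerRight_assoc]
  comp_rotate_first h h' i j hi hj := limitObj_hom_ext fun x => by
    rw [Category.assoc, limitCact_π, reassoc_of% limitComp_π,
      (F.obj x).comp_rotate_first h h' i j hi hj, Category.assoc, Category.assoc, limitComp_π,
      MonoidalCategory.tensorHom_comp_tensorHom_assoc, limitCact_π, limitCact_π,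
      BraidedCategory.braiding_naturality_assoc, MonoidalCategory.tensorHom_comp_tensorHom_assoc]

/-- The limit cone of a diagram of cyclic operads. -/
noncomputable def limitCone : Cone F where
  pt := limitCyclic F
  π :=
    { app := fun j =>
        { hom :=
            { app := fun n => limitπ F n j
              app_act := fun σ => (limitCact_π F (extendPerm σ) j).trans
                (congrArg _ ((F.obj j).cact_extendPerm σ))
              app_one := limitOne_π F j
              app_comp := fun h i => limitComp_π F h i j }
          hom_cact := fun σ => limitCact_π F σ j }
      naturality := fun _ _ φ => (Category.id_comp _).trans
        (Hom.ext (Operad.Hom.ext (funext fun _ => (limitπ_naturality φ).symm))) }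

/-- The components of the map to the limit of a diagram of cyclic operads. -/
noncomputable def limitConeLift (s : Cone F) (n : ℕ) : s.pt.obj n ⟶ limitObj F n :=
  limitLift (fun j => (s.π.app j).hom.app n) fun _ j' φ =>
    congrArg (fun f : s.pt ⟶ F.obj j' => f.hom.app n) (s.w φ)

theorem limitConeLift_π (s : Cone F) (n : ℕ) (j : J) :
    limitConeLift F s n ≫ limitπ F n j = (s.π.app j).hom.app n :=
  limitLift_π ..

theorem cact_limitConeLift (s : Cone F) {n : ℕ} (σ : Equiv.Perm (Fin (n + 1))) :
    s.pt.cact σ ≫ limitConeLift F s n = limitConeLift F s n ≫ limitCact F σ :=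
  limitObj_hom_ext fun j => by
    rw [Category.assoc, limitConeLift_π, Category.assoc, limitCact_π, reassoc_of% limitConeLift_π]
    exact (s.π.app j).hom_cact σ

theorem one_limitConeLift (s : Cone F) : s.pt.one ≫ limitConeLift F s 1 = limitOne F :=
  limitObj_hom_ext fun j => by
    rw [Category.assoc, limitConeLift_π, limitOne_π]
    exact (s.π.app j).hom.app_one

theorem comp_limitConeLift (s : Cone F) {m n k : ℕ} (h : m + n = k + 1) (i : Fin m) :
    s.pt.comp h i ≫ limitConeLift F s k =
      (limitConeLift F s m ⊗ₘ limitConeLift F s n) ≫ limitComp F h i :=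
  limitObj_hom_ext fun j => by
    rw [Category.assoc, limitConeLift_π, Category.assoc, limitComp_π,
      MonoidalCategory.tensorHom_comp_tensorHom_assoc, limitConeLift_π, limitConeLift_π]
    exact (s.π.app j).hom.app_comp h i

/-- The limit cone of a diagram of cyclic operads is a limit cone. -/
noncomputable def limitConeIsLimit : IsLimit (limitCone F) where
  lift s :=
    { hom :=
        { app := limitConeLift F s
          app_act := fun σ => (congrArg (· ≫ limitConeLift F s _)
            (s.pt.cact_extendPerm σ)).symm.trans (cact_limitConeLift F s (extendPerm σ))
          app_one := one_limitConeLift F s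
          app_comp := comp_limitConeLift F s }
      hom_cact := cact_limitConeLift F s }
  fac s j := Hom.ext (Operad.Hom.ext (funext fun n => limitConeLift_π F s n j))
  uniq s _ hm := Hom.ext (Operad.Hom.ext (funext fun n => limitObj_hom_ext fun j =>
    (congrArg (fun f : s.pt ⟶ F.obj j => f.hom.app n) (hm j)).trans
      (limitConeLift_π F s n j).symm))

end

instance hasLimits [HasLimits M] : HasLimits (CyclicOperad M) where
  has_limits_of_shape _ _ := ⟨fun F => ⟨⟨⟨limitCone F, limitConeIsLimit F⟩⟩⟩⟩

instance reflectsIsomorphisms_forget : (forget M).ReflectsIsomorphisms where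
  reflects {P Q} f hf := by
    obtain ⟨g, hfg, hgf⟩ := hf
    change Q.toOperad ⟶ P.toOperad at g
    have hfg' (n : ℕ) : f.hom.app n ≫ g.app n = 𝟙 (P.obj n) :=
      congrArg (fun f : P.toOperad ⟶ P.toOperad => f.app n) hfg
    have hgf' (n : ℕ) : g.app n ≫ f.hom.app n = 𝟙 (Q.obj n) :=
      congrArg (fun f : Q.toOperad ⟶ Q.toOperad => f.app n) hgf
    exact ⟨⟨g, fun {n} σ => by
      rw [← Category.id_comp (Q.cact σ ≫ g.app n), ← hgf', Category.assoc,
        ← reassoc_of% f.hom_cact, hfg', Category.comp_id]⟩, Hom.ext hfg, Hom.ext hgf⟩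

variable [HasLimits M] [HasColimits M] [MonoidalClosed M]

instance isRightAdjoint_forget : (forget M).IsRightAdjoint :=
  (Operad.freeAdjunction M).isRightAdjoint

/-- Beck's theorem: the forgetful functor has a right adjoint, reflects isomorphisms and, having
also a left adjoint, preserves the levelwise limits constructed above. It is therefore comonadic and
creates colimits. -/
instance hasColimits [HasColimits (Operad M)] : HasColimits (CyclicOperad M) := by
  have : Comonad.HasEqualizerOfIsCosplitPair (forget M) := ⟨fun _ _ => inferInstance⟩
  have : Comonad.PreservesLimitOfIsCosplitPair (forget M) := ⟨fun _ _ => inferInstance⟩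
  have : ComonadicLeftAdjoint (forget M) :=
    Comonad.comonadicOfHasPreservesFSplitEqualizersOfReflectsIsomorphisms
      (Operad.cofreeAdjunction M)
  have := comonadicCreatesColimits.{v, v} (forget M)
  exact hasColimits_of_hasColimits_createsColimits (forget M)

end CyclicOperad

/-! ### Deleting isomorphisms from a transfinite composition. -/

namespace CategoryTheory.Limits

/-- A cocone whose restriction along a final functor is isomorphic to a colimit cocone is a
colimit cocone. -/
noncomputable def IsColimit.ofFinal {C J K : Type*} [Category* C] [Category* J] [Category* K]
    {F : J ⥤ C} {G : K ⥤ C} (r : J ⥤ K) [r.Final] (e : r ⋙ G ≅ F) {c : Cocone F}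
    (hc : IsColimit c) (t : Cocone G) (φ : t.pt ≅ c.pt)
    (w : ∀ x, t.ι.app (r.obj x) ≫ φ.hom = e.hom.app x ≫ c.ι.app x) : IsColimit t :=
  (Functor.Final.isColimitWhiskerEquiv r t).1
    (IsColimit.ofIsoColimit ((IsColimit.precomposeHomEquiv e c).symm hc)
      (Cocone.ext φ w).symm)

/-- A criterion for the well-order-continuity of `G` at `m`: the restriction of `G` to a cofinal
family of elements below `m` is isomorphic to a functor with colimit `G.obj m`. -/
theorem isColimit_principalSegIio_of_cofinal {C J K : Type*} [Category* C] [PartialOrder J]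
    [IsDirectedOrder J] [PartialOrder K] {F : J ⥤ C} (G : K ⥤ C) {m : K} {r : J → K}
    (hr : Monotone r) (hrm : ∀ x, r x < m) (hm : ∀ y < m, ∃ x, y ≤ r x)
    (e : ∀ x, G.obj (r x) ≅ F.obj x)
    (he : ∀ {x y : J} (h : x ≤ y),
      G.map (homOfLE (hr h)) ≫ (e y).hom = (e x).hom ≫ F.map (homOfLE h))
    {c : Cocone F} (hc : IsColimit c) (φ : G.obj m ≅ c.pt)
    (w : ∀ x, G.map (homOfLE (hrm x).le) ≫ φ.hom = (e x).hom ≫ c.ι.app x) :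
    Nonempty (IsColimit ((Set.principalSegIio m).cocone G)) := by
  have hr' : Monotone fun x => (⟨r x, hrm x⟩ : Set.Iio m) := fun _ _ h => hr h
  have : hr'.functor.Final :=
    (Monotone.final_functor_iff hr').2 fun y => hm y.1 y.2
  exact ⟨IsColimit.ofFinal (G := (Set.principalSegIio m).monotone.functor ⋙ G) hr'.functor
    (NatIso.ofComponents e fun f => he (leOfHom f)) hc _ φ w⟩

end CategoryTheory.Limits

namespace CategoryTheory.Functor

variable {C : Type*} [Category* C] {J : Type*} [LinearOrder J] [SuccOrder J] (F : J ⥤ C)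

/-- All the maps `F.obj z ⟶ F.obj (Order.succ z)` for `y ≤ z < x` are isomorphisms. -/
def IsConstantBetween (y x : J) : Prop :=
  ∀ z, y ≤ z → z < x → IsIso (F.map (homOfLE (Order.le_succ z)))

variable [WellFoundedLT J] {F}

/-- Transfinite induction on the upper end. At a limit, continuity presents the value as the colimit
of a diagram that is constant from `y` on. -/
theorem IsConstantBetween.isIso_map [F.IsWellOrderContinuous] {y x : J}
    (H : F.IsConstantBetween y x) (h : y ≤ x) : IsIso (F.map (homOfLE h)) := by
  induction x using SuccOrder.limitRecOn with
  | isMin x hx =>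
    obtain rfl := hx.eq_of_le h
    exact F.map_isIso (𝟙 y)
  | succ x hx ih =>
    rcases h.eq_or_lt with rfl | hlt
    · exact F.map_isIso (𝟙 _)
    have hyx : y ≤ x := Order.lt_succ_iff_of_not_isMax hx |>.1 hlt
    have := ih (fun z hz hz' => H z hz (hz'.trans (Order.lt_succ_of_not_isMax hx))) hyx
    have := H x hyx (Order.lt_succ_of_not_isMax hx)
    rw [← homOfLE_comp hyx (Order.le_succ x), F.map_comp]
    infer_instance
  | isSuccLimit x hx ih =>
    rcases h.eq_or_lt with rfl | hlt
    · exact F.map_isIso (𝟙 _)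
    have hc : ((Set.principalSegIio x).monotone.functor ⋙ F).IsEventuallyConstantFrom
        (⟨y, hlt⟩ : Set.Iio x) := fun z f =>
      ih z.1 z.2 (fun w hw hw' => H w hw (hw'.trans z.2)) (leOfHom f)
    have : Nonempty (Set.Iio x) := ⟨⟨y, hlt⟩⟩
    exact hc.isIso_ι_of_isColimit (F.isColimitOfIsWellOrderContinuous x hx)

variable (F)

/-- The least element from which `F` is constant up to `x`. -/
noncomputable def constantRoot (x : J) : J :=
  WellFounded.min (wellFounded_lt (α := J)) {y | y ≤ x ∧ F.IsConstantBetween y x}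
    ⟨x, le_rfl, fun _ h h' => (lt_irrefl _ (h.trans_lt h')).elim⟩

theorem constantRoot_mem (x : J) :
    F.constantRoot x ≤ x ∧ F.IsConstantBetween (F.constantRoot x) x :=
  WellFounded.min_mem (wellFounded_lt (α := J)) {y | y ≤ x ∧ F.IsConstantBetween y x} _

theorem constantRoot_le (x : J) : F.constantRoot x ≤ x := (F.constantRoot_mem x).1

variable {F} in
theorem IsConstantBetween.constantRoot_le {y x : J} (H : F.IsConstantBetween y x) (h : y ≤ x) :
    F.constantRoot x ≤ y :=
  WellFounded.min_le (wellFounded_lt (α := J)) (show y ∈ {z | z ≤ x ∧ F.IsConstantBetween z x} from ⟨h, H⟩)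

theorem constantRoot_monotone : Monotone F.constantRoot := fun x x' h => by
  rcases le_total (F.constantRoot x') x with h' | h'
  · exact IsConstantBetween.constantRoot_le
      (fun z hz hz' => (F.constantRoot_mem x').2 z hz (hz'.trans_le h)) h'
  · exact (F.constantRoot_le x).trans h'

theorem constantRoot_constantRoot (x : J) :
    F.constantRoot (F.constantRoot x) = F.constantRoot x := by
  refine le_antisymm (F.constantRoot_le _) (IsConstantBetween.constantRoot_le (fun z hz hz' => ?_)
    ((F.constantRoot_le _).trans (F.constantRoot_le _)))
  rcases lt_or_ge z (F.constantRoot x) with h | h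
  · exact (F.constantRoot_mem _).2 z hz h
  · exact (F.constantRoot_mem x).2 z h hz'

theorem isIso_map_constantRoot_le [F.IsWellOrderContinuous] (x : J) : IsIso (F.map (homOfLE (F.constantRoot_le x))) :=
  (F.constantRoot_mem x).2.isIso_map (F.constantRoot_le x)

/-- The elements of `J` at which `F` has changed. -/
abbrev ConstantRoots : Type _ := { x : J // F.constantRoot x = x }

/-- The restriction of `F` to the elements at which it has changed. -/
def restrictConstantRoots : F.ConstantRoots ⥤ C :=
  (Subtype.mono_coe fun x => F.constantRoot x = x).functor ⋙ F

/-- `constantRoot` as a functor. -/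
noncomputable def constantRootFunctor : J ⥤ F.ConstantRoots :=
  Monotone.functor (f := fun x => ⟨F.constantRoot x, F.constantRoot_constantRoot x⟩)
    fun _ _ h => F.constantRoot_monotone h

/-- `F` is determined by its restriction to the elements at which it has changed. -/
noncomputable def constantRootIso [F.IsWellOrderContinuous] :
    F.constantRootFunctor ⋙ F.restrictConstantRoots ≅ F :=
  NatIso.ofComponents (fun x => @asIso _ _ _ _ (F.map (homOfLE (F.constantRoot_le x)))
    (F.isIso_map_constantRoot_le x)) fun f => by
    change F.map _ ≫ F.map _ = F.map _ ≫ F.map _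
    rw [← F.map_comp, ← F.map_comp]
    rfl

theorem constantRoot_succ {z : J} (hz : ¬ IsMax z)
    (h : ¬ IsIso (F.map (homOfLE (Order.le_succ z)))) :
    F.constantRoot (Order.succ z) = Order.succ z := by
  refine le_antisymm (F.constantRoot_le _) (le_of_not_gt fun hlt => h ?_)
  exact (F.constantRoot_mem _).2 z ((Order.lt_succ_iff_of_not_isMax hz).1 hlt)
    (Order.lt_succ_of_not_isMax hz)

theorem not_isConstantBetween_of_lt {x : J} (hx : F.constantRoot x = x) {y : J} (h : y < x) :
    ¬ F.IsConstantBetween y x :=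
  fun H => lt_irrefl _ ((hx.symm.le.trans (H.constantRoot_le h.le)).trans_lt h)

/-- Minimality of the root `y` yields a step at some `z` between `x` and `y` that is not an
isomorphism. Then both `Order.succ z` and the root of `z` are roots, and as none lies strictly
between `x` and `y`, they are `y` and `x`. -/
theorem exists_of_covBy_constantRoots {x y : F.ConstantRoots} (h : x ⋖ y) :
    ∃ z : J, ¬ IsMax z ∧ y.1 = Order.succ z ∧ F.constantRoot z = x.1 ∧
      ¬ IsIso (F.map (homOfLE (Order.le_succ z))) := by
  have H := F.not_isConstantBetween_of_lt y.2 h.1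
  simp only [IsConstantBetween, not_forall] at H
  obtain ⟨z, hxz, hzy, hz⟩ := H
  have hz' : ¬ IsMax z := not_isMax_iff.2 ⟨_, hzy⟩
  have hsz : y.1 ≤ Order.succ z := le_of_not_gt fun hlt =>
    h.2 (c := ⟨Order.succ z, F.constantRoot_succ hz' hz⟩)
      (hxz.trans_lt (Order.lt_succ_of_not_isMax hz')) hlt
  refine ⟨z, hz', le_antisymm hsz (Order.succ_le_of_lt hzy), le_antisymm ?_ ?_, hz⟩
  · refine le_of_not_gt fun hlt => h.2 (c := ⟨F.constantRoot z, F.constantRoot_constantRoot z⟩)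
      hlt ((F.constantRoot_le z).trans_lt hzy)
  · exact x.2.symm.le.trans (F.constantRoot_monotone hxz)

theorem isSuccLimit_of_isSuccLimit_constantRoots {x : F.ConstantRoots} (h : Order.IsSuccLimit x) :
    Order.IsSuccLimit x.1 := by
  refine ⟨fun hmin => h.1 fun y hy => hmin hy, fun z hz => ?_⟩
  refine h.2 ⟨F.constantRoot z, F.constantRoot_constantRoot z⟩
    ⟨(F.constantRoot_le z).trans_lt hz.1, fun y hy hyx => ?_⟩
  have hyz : y.1 ≤ z := le_of_not_gt fun hlt => hz.2 hlt hyx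
  exact lt_irrefl _ (hy.trans_le (y.2.symm.le.trans (F.constantRoot_monotone hyz)))

instance [F.IsWellOrderContinuous] : F.restrictConstantRoots.IsWellOrderContinuous where
  nonempty_isColimit m hm := isColimit_principalSegIio_of_cofinal F.restrictConstantRoots
    (F := (Set.principalSegIio m.1).monotone.functor ⋙ F)
    (r := fun x => ⟨F.constantRoot x, F.constantRoot_constantRoot x⟩)
    (fun _ _ h => F.constantRoot_monotone h) (fun x => (F.constantRoot_le x).trans_lt x.2)
    (fun y hy => ⟨⟨y.1, hy⟩, y.2.symm.le⟩)
    (fun x => F.constantRootIso.app x.1)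
    (fun h => F.constantRootIso.hom.naturality (homOfLE h))
    (F.isColimitOfIsWellOrderContinuous m.1 (F.isSuccLimit_of_isSuccLimit_constantRoots hm))
    (Iso.refl _) fun x => (Category.comp_id _).trans
      (F.map_comp (homOfLE (F.constantRoot_le x.1)) (homOfLE (le_of_lt x.2)))

end CategoryTheory.Functor

namespace CategoryTheory.MorphismProperty

universe w

/-- In a transfinite composition, the isomorphisms may be omitted. -/
theorem transfiniteCompositions_of_or_isIso {C : Type u} [Category.{v} C]
    (W : MorphismProperty C) [W.RespectsIso] {J : Type w} [LinearOrder J] [SuccOrder J]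
    [OrderBot J] [WellFoundedLT J] {X Y : C} {f : X ⟶ Y}
    (h : (W ⊔ isomorphisms C).TransfiniteCompositionOfShape J f) :
    transfiniteCompositions.{w} W f := by
  let F := h.F
  have h0 : F.constantRoot ⊥ = ⊥ := le_bot_iff.1 (F.constantRoot_le ⊥)
  let _ : OrderBot F.ConstantRoots := { bot := ⟨⊥, h0⟩, bot_le := fun x => bot_le (a := x.1) }
  let _ : SuccOrder F.ConstantRoots := SuccOrder.ofLinearWellFoundedLT _
  have hr : F.constantRootFunctor.Final := by
    refine (Monotone.final_functor_iff
      (f := fun x => (⟨F.constantRoot x, F.constantRoot_constantRoot x⟩ : F.ConstantRoots))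
      fun _ _ h => F.constantRoot_monotone h).2 fun y => ⟨y.1, y.2.symm.le⟩
  refine transfiniteCompositionsOfShape_le_transfiniteCompositions W F.ConstantRoots _
    ⟨{ F := F.restrictConstantRoots
       isoBot := h.isoBot
       incl := Functor.whiskerLeft _ h.incl
       isColimit := IsColimit.ofFinal F.constantRootFunctor F.constantRootIso h.isColimit
        _ (Iso.refl _) fun x => (Category.comp_id _).trans
          (h.incl.naturality (homOfLE (F.constantRoot_le x))|>.trans (Category.comp_id _)).symm
       fac := h.fac
       map_mem := fun x hx => ?_ }⟩
  -- Between consecutive roots the functor is an isomorphism followed by exactly one step that is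
  -- not an isomorphism, and this step must lie in `W`.
  obtain ⟨z, hz', hyz, hzx, hz⟩ :=
    F.exists_of_covBy_constantRoots (Order.covBy_succ_of_not_isMax hx)
  have key : ∀ {a b : J} (hab : a ≤ b), b = Order.succ z → F.constantRoot z = a →
      W (F.map (homOfLE hab)) := by
    rintro _ _ hab rfl rfl
    have := F.isIso_map_constantRoot_le z
    rw [← homOfLE_comp (F.constantRoot_le z) (Order.le_succ z), F.map_comp]
    exact RespectsIso.precomp _ _ _ ((h.map_mem z hz').resolve_right hz)
  exact key _ hyz hzx

end CategoryTheory.MorphismProperty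

/-! ### Refining the steps of a sequence lexicographically. -/

section

universe w

variable {C : Type u} [Category.{v} C] {J K : Type w} [LinearOrder J] [SuccOrder J]
  [LinearOrder K] [BoundedOrder K] (F : J ⥤ C)

variable (K) in
/-- A refinement of a functor `F : J ⥤ C`: the map `F.obj j ⟶ F.obj (Order.succ j)` is refined to
a functor `K ⥤ C`. -/
structure StepRefinement where
  /-- The functor that refines the map `F.obj j ⟶ F.obj (Order.succ j)`. -/
  H : J → K ⥤ C
  /-- The map from the source. -/
  u : ∀ j k, F.obj j ⟶ (H j).obj k
  /-- The map to the target. -/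
  v : ∀ j k, (H j).obj k ⟶ F.obj (Order.succ j)
  u_map : ∀ j {k k' : K} (h : k ≤ k'), u j k ≫ (H j).map (homOfLE h) = u j k'
  map_v : ∀ j {k k' : K} (h : k ≤ k'), (H j).map (homOfLE h) ≫ v j k' = v j k
  u_v : ∀ j k, u j k ≫ v j k = F.map (homOfLE (Order.le_succ j))
  isIso_u : ∀ j, IsIso (u j ⊥)
  isIso_v : ∀ j, IsIso (v j ⊤)

namespace StepRefinement

attribute [instance] isIso_u isIso_v

variable {F} (R : StepRefinement K F)

/-- The objects of the lexicographic refinement. -/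
def lexObj (p : J ×ₗ K) : C := (R.H (ofLex p).1).obj (ofLex p).2

open Classical in
/-- The maps of the lexicographic refinement. -/
noncomputable def lexMap {j j' : J} {k k' : K} (h : toLex (j, k) ≤ toLex (j', k')) :
    (R.H j).obj k ⟶ (R.H j').obj k' :=
  if hj : j = j' then
    eqToHom (by rw [hj]) ≫ (R.H j').map
      (homOfLE ((Prod.Lex.toLex_le_toLex.1 h).elim (fun h => (h.ne hj).elim) fun h => h.2))
  else R.v j k ≫ F.map (homOfLE (Order.succ_le_of_lt
    ((Prod.Lex.toLex_le_toLex.1 h).elim id fun h => (hj h.1).elim))) ≫ R.u j' k'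

theorem lexMap_same {j : J} {k k' : K} (h : toLex (j, k) ≤ toLex (j, k')) (hk : k ≤ k') :
    R.lexMap h = (R.H j).map (homOfLE hk) := by
  rw [lexMap, dif_pos rfl, eqToHom_refl, Category.id_comp]

theorem lexMap_of_lt {j j' : J} {k k' : K} (h : toLex (j, k) ≤ toLex (j', k')) (hj : j < j') :
    R.lexMap h = R.v j k ≫ F.map (homOfLE (Order.succ_le_of_lt hj)) ≫ R.u j' k' :=
  dif_neg hj.ne

theorem lexMap_comp {j j' j'' : J} {k k' k'' : K} (h : toLex (j, k) ≤ toLex (j', k'))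
    (h' : toLex (j', k') ≤ toLex (j'', k'')) :
    R.lexMap h ≫ R.lexMap h' = R.lexMap (h.trans h') := by
  rcases Prod.Lex.toLex_le_toLex.1 h with hj | ⟨hj, hk⟩ <;>
    rcases Prod.Lex.toLex_le_toLex.1 h' with hj' | ⟨hj', hk'⟩ <;> dsimp only at hj hj'
  · rw [R.lexMap_of_lt h hj, R.lexMap_of_lt h' hj', R.lexMap_of_lt _ (hj.trans hj')]
    simp only [Category.assoc, reassoc_of% R.u_v, ← F.map_comp_assoc]
    rfl
  · subst hj'
    rw [R.lexMap_of_lt h hj, R.lexMap_same h' hk', R.lexMap_of_lt _ hj]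
    simp only [Category.assoc, R.u_map]
  · subst hj
    rw [R.lexMap_same h hk, R.lexMap_of_lt _ hj', R.lexMap_of_lt _ hj', reassoc_of% R.map_v]
  · subst hj hj'
    rw [R.lexMap_same h hk, R.lexMap_same h' hk', R.lexMap_same _ (hk.trans hk'),
      ← Functor.map_comp]
    rfl

/-- The lexicographic refinement. -/
noncomputable def lex : J ×ₗ K ⥤ C where
  obj := R.lexObj
  map f := R.lexMap (leOfHom f)
  map_id p := by
    refine (R.lexMap_same _ le_rfl).trans ?_
    exact (R.H (ofLex p).1).map_id (ofLex p).2
  map_comp f g := (R.lexMap_comp (leOfHom f) (leOfHom g)).symm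

/-- The inclusion of `J` in the lexicographic product. -/
def lexIncl : J ⥤ J ×ₗ K :=
  Monotone.functor (f := fun j => toLex (j, ⊥)) fun _ _ h =>
    Prod.Lex.toLex_mono ⟨h, le_rfl⟩

theorem map_u_bot {j j' : J} (h : j ≤ j') (hl : toLex (j, (⊥ : K)) ≤ toLex (j', ⊥)) :
    R.u j ⊥ ≫ R.lexMap hl = F.map (homOfLE h) ≫ R.u j' ⊥ := by
  rcases h.eq_or_lt with rfl | hlt
  · rw [R.lexMap_same _ le_rfl, R.u_map]
    exact ((congrArg (· ≫ R.u j ⊥) (F.map_id j)).trans (Category.id_comp _)).symm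
  · rw [R.lexMap_of_lt _ hlt, reassoc_of% R.u_v, ← F.map_comp_assoc]
    rfl

/-- The lexicographic refinement restricts to the original functor. -/
noncomputable def lexObjIso (j : J) : R.lex.obj (toLex (j, ⊥)) ≅ F.obj j :=
  (@asIso _ _ _ _ (R.u j ⊥) (R.isIso_u j)).symm

theorem u_lexObjIso (j : J) : R.u j ⊥ ≫ (R.lexObjIso j).hom = 𝟙 _ :=
  @IsIso.hom_inv_id _ _ _ _ (R.u j ⊥) (R.isIso_u j)

theorem lexObjIso_naturality {j j' : J} (h : j ≤ j') (hl : toLex (j, (⊥ : K)) ≤ toLex (j', ⊥)) :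
    R.lex.map (homOfLE hl) ≫ (R.lexObjIso j').hom =
      (R.lexObjIso j).hom ≫ F.map (homOfLE h) :=
  ((Iso.eq_inv_comp (R.lexObjIso j).symm).2 (((Category.assoc _ _ _).symm.trans
    (congrArg (· ≫ (R.lexObjIso j').hom) (R.map_u_bot h hl))).trans
    ((Category.assoc _ _ _).trans
      ((congrArg _ (R.u_lexObjIso j')).trans (Category.comp_id _)))))

/-- The lexicographic refinement restricts to the original functor. -/
noncomputable def lexInclIso : lexIncl ⋙ R.lex ≅ F :=
  NatIso.ofComponents R.lexObjIso fun f =>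
    R.lexObjIso_naturality (leOfHom f) (leOfHom (lexIncl.map f))

theorem u_v_incl {Y : C} (ι : F ⟶ (Functor.const J).obj Y) (j : J) (k : K) :
    R.u j k ≫ R.v j k ≫ ι.app (Order.succ j) = ι.app j := by
  rw [reassoc_of% R.u_v, ι.naturality]
  exact Category.comp_id _

theorem lexMap_v_incl {Y : C} (ι : F ⟶ (Functor.const J).obj Y) {j j' : J} {k k' : K}
    (h : toLex (j, k) ≤ toLex (j', k')) :
    R.lexMap h ≫ R.v j' k' ≫ ι.app (Order.succ j') = R.v j k ≫ ι.app (Order.succ j) := by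
  rcases Prod.Lex.toLex_le_toLex.1 h with hj | ⟨hj, hk⟩ <;> dsimp only at hj
  · rw [R.lexMap_of_lt h hj, Category.assoc, Category.assoc, R.u_v_incl, ι.naturality]
    exact congrArg _ (Category.comp_id _)
  · subst hj
    rw [R.lexMap_same h hk, reassoc_of% R.map_v]

variable [WellFoundedLT J] [WellFoundedLT K]

/-- A limit in the lexicographic order has one of two forms. Either it starts a row at a limit of
`J`, because the start of any successor row covers the top of the preceding one, and the starts of
earlier rows are cofinal; or it is a limit inside a row, whose earlier elements are cofinal. -/
instance isWellOrderContinuous_lex [F.IsWellOrderContinuous]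
    [∀ j, (R.H j).IsWellOrderContinuous] : R.lex.IsWellOrderContinuous where
  nonempty_isColimit m hm := by
    obtain ⟨⟨j, k⟩, rfl⟩ := toLex.surjective m
    by_cases hk : k = ⊥
    · subst hk
      have hj : Order.IsSuccLimit j := by
        refine ⟨fun hmin => hm.1 fun p hp => ?_, fun j' hj' => hm.2 (toLex (j', ⊤)) ?_⟩
        · rcases Prod.Lex.le_iff.1 hp with h | h
          · exact (hmin.not_lt h).elim
          · exact Prod.Lex.le_iff.2 (.inr ⟨h.1.symm, bot_le⟩)
        · exact Prod.Lex.toLex_covBy_toLex_iff.2 (.inr ⟨hj', isMax_top, isMin_bot⟩)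
      refine isColimit_principalSegIio_of_cofinal R.lex
        (F := (Set.principalSegIio j).monotone.functor ⋙ F) (r := fun j' => toLex (j'.1, ⊥))
        (fun _ _ h => Prod.Lex.toLex_mono ⟨h, le_rfl⟩)
        (fun j' => Prod.Lex.toLex_lt_toLex.2 (.inl j'.2)) (fun p hp => ?_)
        (fun x => R.lexObjIso x.1) (fun h => R.lexObjIso_naturality h _)
        (F.isColimitOfIsWellOrderContinuous j hj) (R.lexObjIso j)
        fun x => R.lexObjIso_naturality (le_of_lt x.2) _
      have hpj : (ofLex p).1 < j := (Prod.Lex.lt_iff.1 hp).elim id fun h =>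
        (not_lt_bot h.2).elim
      refine ⟨⟨Order.succ (ofLex p).1, hj.succ_lt hpj⟩, Prod.Lex.le_iff.2 (.inl ?_)⟩
      exact Order.lt_succ_of_not_isMax (not_isMax_iff.2 ⟨_, hpj⟩)
    · have hk' : Order.IsSuccLimit k := by
        refine ⟨fun hmin => hk hmin.eq_bot, fun k' hk' => hm.2 (toLex (j, k')) ?_⟩
        exact Prod.Lex.toLex_covBy_toLex_iff.2 (.inl ⟨rfl, hk'⟩)
      refine isColimit_principalSegIio_of_cofinal R.lex
        (F := (Set.principalSegIio k).monotone.functor ⋙ R.H j) (r := fun k' => toLex (j, k'.1))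
        (fun _ _ h => Prod.Lex.toLex_mono ⟨le_rfl, h⟩)
        (fun k' => Prod.Lex.toLex_lt_toLex.2 (.inr ⟨rfl, k'.2⟩)) (fun p hp => ?_)
        (fun x => Iso.refl _) (fun {x y} h => ?_)
        ((R.H j).isColimitOfIsWellOrderContinuous k hk') (Iso.refl _) fun x => ?_
      · rcases Prod.Lex.lt_iff.1 hp with h | h
        · exact ⟨⟨⊥, hk'.bot_lt⟩, Prod.Lex.le_iff.2 (.inl h)⟩
        · exact ⟨⟨(ofLex p).2, h.2⟩, Prod.Lex.le_iff.2 (.inr ⟨h.1, le_rfl⟩)⟩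
      · refine (Category.comp_id _).trans (Eq.trans ?_ (Category.id_comp _).symm)
        have hl : toLex (j, x.1) ≤ toLex (j, y.1) := Prod.Lex.toLex_mono ⟨le_rfl, h⟩
        exact R.lexMap_same hl h
      · refine (Category.comp_id _).trans (Eq.trans ?_ (Category.id_comp _).symm)
        have hl : toLex (j, x.1) ≤ toLex (j, k) := Prod.Lex.toLex_mono ⟨le_rfl, le_of_lt x.2⟩
        exact R.lexMap_same hl (le_of_lt x.2)

end StepRefinement

end

namespace StepRefinement

universe w

variable {C : Type u} [Category.{v} C] {J K : Type w} [LinearOrder J] [SuccOrder J] [OrderBot J]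
  [WellFoundedLT J] [NoMaxOrder J] [LinearOrder K] [BoundedOrder K] [WellFoundedLT K]

/-- A transfinite composition of maps that are refined to transfinite compositions of maps in `W`
and isomorphisms is a transfinite composition of maps in `W`. -/
theorem transfiniteCompositions (W : MorphismProperty C) [W.RespectsIso] {X Y : C} {f : X ⟶ Y}
    (h : TransfiniteCompositionOfShape J f) (R : StepRefinement K h.F)
    [∀ j, (R.H j).IsWellOrderContinuous]
    (hR : ∀ j (k k' : K) (hk : k ⋖ k'), (W ⊔ MorphismProperty.isomorphisms C)
      ((R.H j).map (homOfLE hk.le))) :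
    MorphismProperty.transfiniteCompositions.{w} W f := by
  let _ : SuccOrder (J ×ₗ K) := SuccOrder.ofLinearWellFoundedLT _
  have hr : (lexIncl (J := J) (K := K)).Final :=
    (Monotone.final_functor_iff (f := fun j : J => toLex (j, (⊥ : K))) fun _ _ h =>
      Prod.Lex.toLex_mono ⟨h, le_rfl⟩).2 fun p =>
      ⟨Order.succ (ofLex p).1, Prod.Lex.le_iff.2 (.inl (Order.lt_succ _))⟩
  refine MorphismProperty.transfiniteCompositions_of_or_isIso W (J := J ×ₗ K)
    { F := R.lex
      isoBot := R.lexInclIso.app ⊥ ≪≫ h.isoBot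
      incl :=
        { app := fun p => R.v (ofLex p).1 (ofLex p).2 ≫ h.incl.app (Order.succ (ofLex p).1)
          naturality := fun p q hpq =>
            (R.lexMap_v_incl h.incl (leOfHom hpq)).trans (Category.comp_id _).symm }
      isColimit := IsColimit.ofFinal lexIncl R.lexInclIso h.isColimit _ (Iso.refl _) fun j => ?_
      fac := ?_
      map_mem := fun p hp => ?_ }
  · exact (Category.comp_id _).trans ((Iso.eq_inv_comp (R.lexObjIso j).symm).2
      (R.u_v_incl h.incl j ⊥))
  · refine (Category.assoc _ _ _).trans (Eq.trans ?_ h.fac)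
    exact congrArg _ (R.u_v_incl h.incl ⊥ ⊥)
  · have key : ∀ (q : J ×ₗ K) (hq : p ≤ q), p ⋖ q →
        (W ⊔ MorphismProperty.isomorphisms C) (R.lex.map (homOfLE hq)) := by
      intro q hq hpq
      obtain ⟨⟨j, k⟩, rfl⟩ := toLex.surjective p
      obtain ⟨⟨j', k'⟩, rfl⟩ := toLex.surjective q
      rcases Prod.Lex.toLex_covBy_toLex_iff.1 hpq with ⟨rfl, hk⟩ | ⟨hj, hk, hk'⟩
      · have := hR j k k' hk
        rwa [← R.lexMap_same hq hk.le] at this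
      · obtain rfl := hk.eq_top
        obtain rfl := hk'.eq_bot
        obtain rfl := hj.succ_eq
        -- The passage from the end of a row to the start of the next is an isomorphism, because
        -- both represent the same object of the original sequence.
        refine .inr ?_
        have : IsIso (R.lexMap hq) := by
          rw [R.lexMap_of_lt hq hj.lt]
          have : IsIso (h.F.map (homOfLE (Order.succ_le_of_lt hj.lt))) := h.F.map_isIso (𝟙 _)
          infer_instance
        exact this
    exact key _ _ (Order.covBy_succ_of_not_isMax hp)

end StepRefinement

/-! ### Attaching families of cells. -/

theorem CategoryTheory.IsPushout.of_exists_desc {C : Type u} [Category.{v} C] {W X Y P : C}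
    {f : W ⟶ X} {g : W ⟶ Y} {inl : X ⟶ P} {inr : Y ⟶ P} (w : f ≫ inl = g ≫ inr)
    (hom_ext : ∀ {T : C} {m m' : P ⟶ T}, inl ≫ m = inl ≫ m' → inr ≫ m = inr ≫ m' → m = m')
    (exists_desc : ∀ {T : C} (p : X ⟶ T) (q : Y ⟶ T), f ≫ p = g ≫ q →
      ∃ m : P ⟶ T, inl ≫ m = p ∧ inr ≫ m = q) : IsPushout f g inl inr :=
  ⟨⟨w⟩, ⟨PushoutCocone.IsColimit.mk _
    (fun s => (exists_desc s.inl s.inr s.condition).choose)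
    (fun s => (exists_desc s.inl s.inr s.condition).choose_spec.1)
    (fun s => (exists_desc s.inl s.inr s.condition).choose_spec.2)
    fun s _ h₁ h₂ => hom_ext
      (h₁.trans (exists_desc s.inl s.inr s.condition).choose_spec.1.symm)
      (h₂.trans (exists_desc s.inl s.inr s.condition).choose_spec.2.symm)⟩⟩

section

variable {C : Type u} [Category.{v} C] {ι : Type*} {A B : ι → C}

/-- The object `Z` is obtained from `X` by attaching, for each `x ∈ E`, the cell `i x` along
`a x`. -/
structure IsAttach (i : ∀ x, A x ⟶ B x) (E : Set ι) {X Z : C} (a : ∀ x ∈ E, A x ⟶ X)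
    (f : X ⟶ Z) (b : ∀ x ∈ E, B x ⟶ Z) : Prop where
  w : ∀ x hx, i x ≫ b x hx = a x hx ≫ f
  hom_ext : ∀ {T : C} {g g' : Z ⟶ T}, f ≫ g = f ≫ g' →
    (∀ x hx, b x hx ≫ g = b x hx ≫ g') → g = g'
  exists_desc : ∀ {T : C} (φ : X ⟶ T) (ψ : ∀ x ∈ E, B x ⟶ T),
    (∀ x hx, i x ≫ ψ x hx = a x hx ≫ φ) → ∃ g : Z ⟶ T, f ≫ g = φ ∧ ∀ x hx, b x hx ≫ g = ψ x hx

namespace IsAttach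

variable {i : ∀ x, A x ⟶ B x} {E E' : Set ι} {X X' Z Z' : C} {a : ∀ x ∈ E, A x ⟶ X}
  {f : X ⟶ Z} {b : ∀ x ∈ E, B x ⟶ Z} {a' : ∀ x ∈ E', A x ⟶ X'} {f' : X' ⟶ Z'}
  {b' : ∀ x ∈ E', B x ⟶ Z'}

/-- Attaching the same cells to `X` and to `X'`, compatibly, amounts to cobase change along `X ⟶
X'`. Two inclusions replace an equality of the index sets so that the dependent attaching maps need
no transport. -/
theorem isPushout_of_subset (H : IsAttach i E a f b) (H' : IsAttach i E' a' f' b') (hE : E ⊆ E')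
    (hE' : E' ⊆ E) {g : X ⟶ X'} {h : Z ⟶ Z'} (ha : ∀ x hx, a x hx ≫ g = a' x (hE hx))
    (w : f ≫ h = g ≫ f') (hb : ∀ x hx, b x hx ≫ h = b' x (hE hx)) : IsPushout g f f' h := by
  refine .of_exists_desc w.symm (fun {T m m'} h₁ h₂ => H'.hom_ext h₁ fun x hx => ?_)
    fun p q hpq => ?_
  · rw [← hb x (hE' hx), Category.assoc, Category.assoc, h₂]
  · obtain ⟨m, hm, hm'⟩ := H'.exists_desc p (fun x hx => b x (hE' hx) ≫ q) fun x hx => by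
      rw [← Category.assoc, H.w, Category.assoc, ← hpq, ← Category.assoc, ha]
    refine ⟨m, hm, H.hom_ext ?_ fun x hx => ?_⟩
    · rw [← Category.assoc, w, Category.assoc, hm, hpq]
    · rw [← Category.assoc, hb, hm']

theorem isIso_of_subset (H : IsAttach i E a f b) (H' : IsAttach i E' a' f' b') (hE : E ⊆ E')
    (hE' : E' ⊆ E) {g : X ⟶ X'} [IsIso g] {h : Z ⟶ Z'} (ha : ∀ x hx, a x hx ≫ g = a' x (hE hx))
    (w : f ≫ h = g ≫ f') (hb : ∀ x hx, b x hx ≫ h = b' x (hE hx)) : IsIso h :=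
  (H.isPushout_of_subset H' hE hE' ha w hb).isIso_inr_of_isIso

theorem isIso_of_isEmpty (H : IsAttach i E a f b) (hE : ∀ x, x ∉ E) : IsIso f := by
  obtain ⟨g, hg, -⟩ := H.exists_desc (𝟙 X) (fun x hx => (hE x hx).elim) fun x hx => (hE x hx).elim
  exact ⟨g, hg, H.hom_ext (by rw [reassoc_of% hg, Category.comp_id])
    fun x hx => (hE x hx).elim⟩

open Classical in
theorem exists_desc_insert (H' : IsAttach i E' a' f' b') {x₀ : ι} (hx₀ : x₀ ∈ E')
    (hE' : ∀ x ∈ E', x = x₀ ∨ x ∈ E) {T : C} (φ : X' ⟶ T) (ψ₀ : B x₀ ⟶ T) (ψ : ∀ x ∈ E, B x ⟶ T)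
    (hx₀' : x₀ ∉ E) (h₀ : i x₀ ≫ ψ₀ = a' x₀ hx₀ ≫ φ)
    (h : ∀ x hx hx', i x ≫ ψ x hx = a' x hx' ≫ φ) :
    ∃ g : Z' ⟶ T, f' ≫ g = φ ∧ b' x₀ hx₀ ≫ g = ψ₀ ∧ ∀ x hx hx', b' x hx' ≫ g = ψ x hx := by
  obtain ⟨g, hg, hg'⟩ := H'.exists_desc φ (fun x hx => if hx' : x ∈ E then ψ x hx' else
    eqToHom (by rw [(hE' x hx).resolve_right hx']) ≫ ψ₀) fun x hx => by
      by_cases hx' : x ∈ E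
      · rw [dif_pos hx', h]
      · obtain rfl := (hE' x hx).resolve_right hx'
        rw [dif_neg hx', eqToHom_refl, Category.id_comp, h₀]
  refine ⟨g, hg, ?_, fun x hx hx' => ?_⟩
  · rw [hg', dif_neg hx₀', eqToHom_refl, Category.id_comp]
  · rw [hg', dif_pos hx]

theorem isPushout_of_insert {a' : ∀ x ∈ E', A x ⟶ X} {f' : X ⟶ Z'} (H : IsAttach i E a f b)
    (H' : IsAttach i E' a' f' b') (hE : E ⊆ E') {x₀ : ι} (hx₀ : x₀ ∈ E')
    (hE' : ∀ x ∈ E', x = x₀ ∨ x ∈ E) (hx₀' : x₀ ∉ E) {h : Z ⟶ Z'}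
    (ha : ∀ x hx, a x hx = a' x (hE hx)) (w : f ≫ h = f')
    (hb : ∀ x hx, b x hx ≫ h = b' x (hE hx)) :
    IsPushout (a' x₀ hx₀ ≫ f) (i x₀) h (b' x₀ hx₀) := by
  refine .of_exists_desc (by rw [Category.assoc, w, H'.w]) (fun {T m m'} h₁ h₂ => ?_)
    fun p q hpq => ?_
  · refine H'.hom_ext (by rw [← w, Category.assoc, Category.assoc, h₁]) fun x hx => ?_
    rcases hE' x hx with rfl | hx'
    · exact h₂
    · rw [← hb x hx', Category.assoc, Category.assoc, h₁]
  · obtain ⟨m, hm, hm₀, hm'⟩ := H'.exists_desc_insert hx₀ hE' (f ≫ p) q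
      (fun x hx => b x hx ≫ p) hx₀' (by rw [← hpq, Category.assoc]) fun x hx hx' => by
        rw [← Category.assoc, H.w, Category.assoc, ha]
    refine ⟨m, H.hom_ext (by rw [← Category.assoc, w, hm]) fun x hx => ?_, hm₀⟩
    rw [← Category.assoc, hb, hm' x hx]

/-- Here the base changes too, but the new cell is attached along an isomorphism, so the new base is
its boundary. Everything new is then obtained by gluing the cell to `Z` along `X`, through the
composite of `X ⟶ X'` with the cell map. -/
theorem isPushout_of_insert_isIso (H : IsAttach i E a f b) (H' : IsAttach i E' a' f' b')
    (hE : E ⊆ E') {x₀ : ι} (hx₀ : x₀ ∈ E') (hE' : ∀ x ∈ E', x = x₀ ∨ x ∈ E) (hx₀' : x₀ ∉ E)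
    {g : X ⟶ X'} {h : Z ⟶ Z'} {r : X' ⟶ A x₀} (hr : r ≫ a' x₀ hx₀ = 𝟙 _)
    (hr' : a' x₀ hx₀ ≫ r = 𝟙 _) (ha : ∀ x hx, a x hx ≫ g = a' x (hE hx))
    (w : f ≫ h = g ≫ f') (hb : ∀ x hx, b x hx ≫ h = b' x (hE hx)) :
    IsPushout f (g ≫ r ≫ i x₀) h (b' x₀ hx₀) := by
  have hf' : f' = r ≫ i x₀ ≫ b' x₀ hx₀ := by rw [H'.w, reassoc_of% hr]
  refine .of_exists_desc (by rw [w, hf', Category.assoc, Category.assoc])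
    (fun {T m m'} h₁ h₂ => ?_) fun p q hpq => ?_
  · refine H'.hom_ext (by rw [hf']; simp only [Category.assoc, h₂]) fun x hx => ?_
    rcases hE' x hx with rfl | hx'
    · exact h₂
    · rw [← hb x hx', Category.assoc, Category.assoc, h₁]
  · obtain ⟨m, hm, hm₀, hm'⟩ := H'.exists_desc_insert hx₀ hE' (r ≫ i x₀ ≫ q) q
      (fun x hx => b x hx ≫ p) hx₀' (by rw [reassoc_of% hr']) fun x hx hx' => by
        rw [← Category.assoc, H.w, Category.assoc, hpq, ← ha x hx]
        simp only [Category.assoc]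
    refine ⟨m, H.hom_ext ?_ fun x hx => ?_, hm₀⟩
    · rw [← Category.assoc, w, Category.assoc, hm, hpq]
      simp only [Category.assoc]
    · rw [← Category.assoc, hb, hm' x hx]

/-- Attaching cells commutes with directed colimits. A cell of the colimit occurs at some stage, and
directedness makes its image in a cocone independent of the stage chosen. -/
theorem isColimit {J : Type*} [Preorder J] [IsDirectedOrder J] {F G : J ⥤ C} {E : J → Set ι}
    {a : ∀ j, ∀ x ∈ E j, A x ⟶ F.obj j} {f : ∀ j, F.obj j ⟶ G.obj j}
    {b : ∀ j, ∀ x ∈ E j, B x ⟶ G.obj j} (H : ∀ j, IsAttach i (E j) (a j) (f j) (b j))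
    (hE : Monotone E)
    (hf : ∀ {j j' : J} (h : j ≤ j'), f j ≫ G.map (homOfLE h) = F.map (homOfLE h) ≫ f j')
    (hb : ∀ {j j' : J} (h : j ≤ j') x hx,
      b j x hx ≫ G.map (homOfLE h) = b j' x (hE h hx))
    {c : Cocone F} (hc : IsColimit c) {t : Cocone G} {a' : ∀ x ∈ E', A x ⟶ c.pt}
    {f' : c.pt ⟶ t.pt} {b' : ∀ x ∈ E', B x ⟶ t.pt} (H' : IsAttach i E' a' f' b')
    (hE' : ∀ j, E j ⊆ E') (hE'' : ∀ x ∈ E', ∃ j, x ∈ E j)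
    (hft : ∀ j, f j ≫ t.ι.app j = c.ι.app j ≫ f')
    (ha' : ∀ j x hx, a j x hx ≫ c.ι.app j = a' x (hE' j hx))
    (hb' : ∀ j x hx, b j x hx ≫ t.ι.app j = b' x (hE' j hx)) : Nonempty (IsColimit t) := by
  have hs (s : Cocone G) : ∃ g : t.pt ⟶ s.pt, ∀ j, t.ι.app j ≫ g = s.ι.app j := by
    have hb'' {j j' : J} {x : ι} (hx : x ∈ E j) (hx' : x ∈ E j') :
        b j x hx ≫ s.ι.app j = b j' x hx' ≫ s.ι.app j' := by
      obtain ⟨k, hk, hk'⟩ := exists_ge_ge j j'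
      rw [← s.w (homOfLE hk), ← s.w (homOfLE hk'), ← Category.assoc, ← Category.assoc, hb, hb]
    let s' : Cocone F :=
      { pt := s.pt
        ι :=
          { app := fun j => f j ≫ s.ι.app j
            naturality := fun j j' φ => by
              have := hf (leOfHom φ)
              refine ((Category.assoc _ _ _).symm.trans
                (congrArg (· ≫ s.ι.app j') this.symm)).trans ?_
              rw [Category.assoc]
              exact (congrArg _ (s.w _)).trans (Category.comp_id _).symm } }
    obtain ⟨g, hg, hg'⟩ := H'.exists_desc (hc.desc s')
      (fun x hx => b _ x (hE'' x hx).choose_spec ≫ s.ι.app (hE'' x hx).choose) fun x hx => by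
        rw [← Category.assoc, (H _).w, ← ha' _ x (hE'' x hx).choose_spec, Category.assoc,
          Category.assoc, hc.fac]
    refine ⟨g, fun j => (H j).hom_ext ?_ fun x hx => ?_⟩
    · rw [← Category.assoc, hft, Category.assoc, hg, hc.fac]
    · rw [← Category.assoc, hb', hg']
      exact hb'' _ hx
  exact ⟨{
    desc := fun s => (hs s).choose
    fac := fun s => (hs s).choose_spec
    uniq := fun s m hm => by
      have (j : J) : t.ι.app j ≫ m = t.ι.app j ≫ (hs s).choose :=
        (hm j).trans ((hs s).choose_spec j).symm
      refine H'.hom_ext (hc.hom_ext fun j => ?_) fun x hx => ?_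
      · rw [← Category.assoc, ← hft, Category.assoc, this, ← Category.assoc, ← Category.assoc, hft]
      · obtain ⟨j, hj⟩ := hE'' x hx
        rw [← hb' j x hj, Category.assoc, Category.assoc, this] }⟩

end IsAttach

variable {ι : Type v} {A B : ι → C} {i : ∀ x, A x ⟶ B x}

theorem exists_isAttach [HasColimits C] (i : ∀ x, A x ⟶ B x) (E : Set ι) {X : C}
    (a : ∀ x ∈ E, A x ⟶ X) : ∃ (Z : C) (f : X ⟶ Z) (b : ∀ x ∈ E, B x ⟶ Z), IsAttach i E a f b := by
  have sq := IsPushout.of_hasPushout (Sigma.desc fun x : E => a x.1 x.2)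
    (Limits.Sigma.map fun x : E => i x.1)
  refine ⟨_, pushout.inl _ _, fun x hx => Sigma.ι (fun x : E => B x.1) ⟨x, hx⟩ ≫ pushout.inr _ _,
    fun x hx => ?_, fun h₁ h₂ => sq.hom_ext h₁ (Sigma.hom_ext _ _ fun x => ?_),
    fun φ ψ h => ⟨sq.desc φ (Sigma.desc fun x => ψ x.1 x.2) (Sigma.hom_ext _ _ fun x => ?_),
      sq.inl_desc _ _ _, fun x hx => ?_⟩⟩
  · have := Sigma.ι (fun x : E => A x.1) ⟨x, hx⟩ ≫= sq.w
    rw [Sigma.ι_desc_assoc, Limits.Sigma.ι_map_assoc] at this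
    exact this.symm
  · have := h₂ x.1 x.2
    rwa [Category.assoc, Category.assoc] at this
  · rw [Sigma.ι_desc_assoc, Limits.Sigma.ι_map_assoc, Sigma.ι_desc, h]
  · rw [Category.assoc, sq.inr_desc, Sigma.ι_desc]

/-- A functor `F` together with cells to be attached to it: at the stage `j`, the cells in
`E j`. -/
structure CellDiagram {J : Type*} [Preorder J] (i : ∀ x, A x ⟶ B x) (F : J ⥤ C) where
  /-- The cells that are attached at the stage `j`. -/
  E : J → Set ι
  mono : Monotone E
  /-- The attaching maps. -/
  a : ∀ j, ∀ x ∈ E j, A x ⟶ F.obj j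
  a_map : ∀ {j j' : J} (h : j ≤ j') (x : ι) (hx : x ∈ E j),
    a j x hx ≫ F.map (homOfLE h) = a j' x (mono h hx)

namespace CellDiagram

variable [HasColimits C] {J : Type*} [Preorder J] {F : J ⥤ C} (D : CellDiagram i F)

/-- The result of attaching the cells at the stage `j`. -/
noncomputable def obj (j : J) : C := (exists_isAttach i (D.E j) (D.a j)).choose

/-- The inclusion of `F`. -/
noncomputable def incl (j : J) : F.obj j ⟶ D.obj j :=
  (exists_isAttach i (D.E j) (D.a j)).choose_spec.choose

/-- The inclusion of the cells. -/
noncomputable def cell (j : J) : ∀ x ∈ D.E j, B x ⟶ D.obj j :=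
  (exists_isAttach i (D.E j) (D.a j)).choose_spec.choose_spec.choose

theorem isAttach (j : J) : IsAttach i (D.E j) (D.a j) (D.incl j) (D.cell j) :=
  (exists_isAttach i (D.E j) (D.a j)).choose_spec.choose_spec.choose_spec

theorem exists_map {j j' : J} (h : j ≤ j') : ∃ g : D.obj j ⟶ D.obj j',
    D.incl j ≫ g = F.map (homOfLE h) ≫ D.incl j' ∧
      ∀ x hx, D.cell j x hx ≫ g = D.cell j' x (D.mono h hx) :=
  (D.isAttach j).exists_desc _ _ fun x hx => by
    rw [(D.isAttach j').w, ← Category.assoc, D.a_map]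

/-- The functor obtained by attaching the cells. -/
noncomputable def functor : J ⥤ C where
  obj := D.obj
  map f := (D.exists_map (leOfHom f)).choose
  map_id j := (D.isAttach j).hom_ext
    ((D.exists_map (le_refl j)).choose_spec.1.trans ((congrArg (· ≫ _) (F.map_id j)).trans
      ((Category.id_comp _).trans (Category.comp_id _).symm)))
    fun x hx => ((D.exists_map (le_refl j)).choose_spec.2 x hx).trans (Category.comp_id _).symm
  map_comp {j j' j''} f g := by
    have h₁ := (D.exists_map (leOfHom f)).choose_spec
    have h₂ := (D.exists_map (leOfHom g)).choose_spec
    have h₃ := (D.exists_map (leOfHom (f ≫ g))).choose_spec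
    refine (D.isAttach j).hom_ext ?_ fun x hx => ?_
    · rw [h₃.1, reassoc_of% h₁.1, h₂.1, ← Category.assoc, ← F.map_comp]
      rfl
    · rw [h₃.2, ← Category.assoc, h₁.2, h₂.2]

theorem incl_map {j j' : J} (h : j ≤ j') :
    D.incl j ≫ D.functor.map (homOfLE h) = F.map (homOfLE h) ≫ D.incl j' :=
  (D.exists_map h).choose_spec.1

theorem cell_map {j j' : J} (h : j ≤ j') (x : ι) (hx : x ∈ D.E j) :
    D.cell j x hx ≫ D.functor.map (homOfLE h) = D.cell j' x (D.mono h hx) :=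
  (D.exists_map h).choose_spec.2 x hx

end CellDiagram

theorem CellDiagram.isWellOrderContinuous [HasColimits C] {J : Type*} [LinearOrder J] {F : J ⥤ C}
    [F.IsWellOrderContinuous] (D : CellDiagram i F)
    (hD : ∀ j, Order.IsSuccLimit j → ∀ x ∈ D.E j, ∃ j' < j, x ∈ D.E j') :
    D.functor.IsWellOrderContinuous where
  nonempty_isColimit m hm := by
    refine IsAttach.isColimit (F := (Set.principalSegIio m).monotone.functor ⋙ F)
      (G := (Set.principalSegIio m).monotone.functor ⋙ D.functor)
      (E := fun j => D.E j.1) (a := fun j => D.a j.1) (f := fun j => D.incl j.1)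
      (b := fun j => D.cell j.1) (fun j => D.isAttach j.1) (fun _ _ h => D.mono h)
      (fun h => D.incl_map h) (fun h x hx => D.cell_map h x hx)
      (F.isColimitOfIsWellOrderContinuous m hm) (D.isAttach m) (fun j => D.mono (le_of_lt j.2))
      (fun x hx => ?_) (fun j => D.incl_map (le_of_lt j.2))
      (fun j x hx => D.a_map (le_of_lt j.2) x hx) (fun j x hx => D.cell_map (le_of_lt j.2) x hx)
    obtain ⟨j, hj, hx'⟩ := hD m hm x hx
    exact ⟨⟨j, hj⟩, hx'⟩

end

/-! ### Attaching cells one at a time. -/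

instance CategoryTheory.Functor.isWellOrderContinuous_const {C : Type*} [Category* C] {K : Type*}
    [LinearOrder K] (X : C) : ((Functor.const K).obj X).IsWellOrderContinuous where
  nonempty_isColimit m hm := by
    have : Nonempty (Set.Iio m) := (not_isMin_iff.1 hm.1).elim fun k hk => ⟨⟨k, hk⟩⟩
    have : IsConnected (Set.Iio m) := IsFiltered.isConnected _
    exact ⟨isColimitConstCocone (Set.Iio m) X⟩

section

variable {C : Type u} [Category.{v} C]

/-- A refinement of a map `f` to a sequence of maps that are in `W` or isomorphisms. -/
structure MapRefinement (K : Type*) [LinearOrder K] [BoundedOrder K] (W : MorphismProperty C)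
    {X Z : C} (f : X ⟶ Z) where
  /-- The sequence. -/
  H : K ⥤ C
  /-- The map from the source. -/
  u : ∀ k, X ⟶ H.obj k
  /-- The map to the target. -/
  v : ∀ k, H.obj k ⟶ Z
  u_map : ∀ {k k' : K} (h : k ≤ k'), u k ≫ H.map (homOfLE h) = u k'
  map_v : ∀ {k k' : K} (h : k ≤ k'), H.map (homOfLE h) ≫ v k' = v k
  u_v : ∀ k, u k ≫ v k = f
  isIso_u : IsIso (u ⊥)
  isIso_v : IsIso (v ⊤)
  isWellOrderContinuous : H.IsWellOrderContinuous
  map_mem : ∀ (k k' : K) (hk : k ⋖ k'),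
    (W ⊔ MorphismProperty.isomorphisms C) (H.map (homOfLE hk.le))

theorem MapRefinement.transfiniteCompositions {K : Type v} [LinearOrder K] [BoundedOrder K]
    [WellFoundedLT K] {W : MorphismProperty C} [W.RespectsIso] {X Z : C} {f : X ⟶ Z}
    (R : MapRefinement K W f) : MorphismProperty.transfiniteCompositions.{v} W f := by
  let _ : SuccOrder K := SuccOrder.ofLinearWellFoundedLT _
  have := R.isIso_u
  have := R.isIso_v
  have := R.isWellOrderContinuous
  refine MorphismProperty.transfiniteCompositions_of_or_isIso W (J := K)
    { F := R.H
      isoBot := (asIso (R.u ⊥)).symm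
      incl :=
        { app := R.v
          naturality := fun _ _ h => (R.map_v (leOfHom h)).trans (Category.comp_id _).symm }
      isColimit := IsColimit.ofIsoColimit (colimitOfDiagramTerminal isTerminalTop R.H)
        (Cocone.ext (asIso (R.v ⊤)) fun k => R.map_v le_top)
      fac := R.u_v ⊥
      map_mem := fun k hk => R.map_mem _ _ (Order.covBy_succ_of_not_isMax hk) }

variable [HasColimits C] {ι : Type v} {A B : ι → C} {i : ∀ x, A x ⟶ B x}

/-- The cells are ordered by an injection `e` into `K`, and the stage `k` contains those with `e x <
k`. A covering step attaches the cell with index `k` if there is one, and is an isomorphism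
otherwise; the bound `e x < ⊤` ensures that the last stage contains all cells. -/
theorem IsAttach.nonempty_mapRefinement {K : Type*} [LinearOrder K] [BoundedOrder K]
    {X Z : C} {a : ∀ x ∈ Set.univ, A x ⟶ X} {f : X ⟶ Z} {b : ∀ x ∈ Set.univ, B x ⟶ Z}
    (H : IsAttach i Set.univ a f b) (I : MorphismProperty C) (hI : ∀ x, I (i x)) (e : ι → K)
    (he : Function.Injective e) (he' : ∀ x, e x < ⊤) :
    Nonempty (MapRefinement K I.pushouts f) := by
  let D : CellDiagram i ((Functor.const K).obj X) :=
    { E := fun k => {x | e x < k}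
      mono := fun k k' h x hx => lt_of_lt_of_le hx h
      a := fun _ x _ => a x trivial
      a_map := fun _ _ _ => Category.comp_id _ }
  have hv (k : K) := (D.isAttach k).exists_desc f (fun x _ => b x trivial) fun x _ =>
    H.w x trivial
  choose v hv hv' using hv
  have hincl {k k' : K} (h : k ≤ k') : D.incl k ≫ D.functor.map (homOfLE h) = D.incl k' :=
    (D.incl_map h).trans (Category.id_comp _)
  exact ⟨{
    H := D.functor
    u := D.incl
    v := v
    u_map := hincl
    map_v := fun {k k'} h => (D.isAttach k).hom_ext
      (((Category.assoc _ _ _).symm.trans (congrArg (· ≫ v k') (hincl h))).trans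
        ((hv k').trans (hv k).symm))
      fun x hx => ((Category.assoc _ _ _).symm.trans
        (congrArg (· ≫ v k') (D.cell_map h x hx))).trans ((hv' k' x _).trans (hv' k x _).symm)
    u_v := hv
    isIso_u := (D.isAttach ⊥).isIso_of_isEmpty fun x hx => not_lt_bot hx
    isIso_v := (D.isAttach ⊤).isIso_of_subset H (fun _ _ => trivial) (fun x _ => he' x)
      (g := 𝟙 ((Functor.const K).obj X |>.obj ⊤)) (fun x hx => Category.comp_id _) ((hv ⊤).trans (Category.id_comp f).symm) (hv' ⊤)
    isWellOrderContinuous := D.isWellOrderContinuous fun k hk x hx =>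
      (not_forall₂.1 fun h => hk.2 (e x) ⟨hx, h⟩).elim fun k' hk' =>
        ⟨k', not_not.1 hk'.2, hk'.1⟩
    map_mem := fun k k' hk => by
      by_cases hx₀ : ∃ x₀, e x₀ = k
      · obtain ⟨x₀, rfl⟩ := hx₀
        exact .inl (MorphismProperty.pushouts_mk I
          ((D.isAttach (e x₀)).isPushout_of_insert (D.isAttach k') (D.mono hk.le) (x₀ := x₀) hk.lt
            (fun x hx => (hk.le_of_lt hx).eq_or_lt.imp (fun h => he h) id) (lt_irrefl (e x₀))
            (fun _ _ => rfl) (hincl hk.le) (D.cell_map hk.le)) (hI x₀))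
      · exact .inr ((D.isAttach k).isIso_of_subset (D.isAttach k') (D.mono hk.le)
          (fun x hx => lt_of_le_of_ne (hk.le_of_lt hx) fun h => hx₀ ⟨x, h⟩)
          (g := 𝟙 ((Functor.const K).obj X |>.obj k)) (fun x hx => Category.comp_id _)
          ((hincl hk.le).trans (Category.id_comp _).symm) (D.cell_map hk.le)) }⟩

end

/-! ### Cell attachments are relative cell complexes. -/

section

variable {C : Type u} [Category.{v} C]

theorem HomotopicalAlgebra.AttachCells.isAttach {α : Type*} {A B : α → C} {g : ∀ a, A a ⟶ B a}
    {X Z : C} {f : X ⟶ Z} (c : AttachCells g f) :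
    IsAttach (fun x => g (c.π x)) Set.univ (fun x _ => c.cofan₁.inj x ≫ c.g₁) f
      fun x _ => c.cell x where
  w x _ := by
    rw [AttachCells.cell_def, ← c.hm_assoc, Category.assoc, c.isPushout.w]
  hom_ext h₁ h₂ := c.hom_ext h₁ fun x => h₂ x trivial
  exists_desc φ ψ h := by
    refine ⟨c.isPushout.desc φ (Cofan.IsColimit.desc c.isColimit₂ fun x => ψ x trivial)
      (Cofan.IsColimit.hom_ext c.isColimit₁ _ _ fun x => ?_), c.isPushout.inl_desc _ _ _,
      fun x _ => ?_⟩
    · rw [c.hm_assoc, Cofan.IsColimit.fac]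
      exact (Category.assoc _ _ _).symm.trans (h x trivial).symm
    · rw [AttachCells.cell_def, Category.assoc, c.isPushout.inr_desc, Cofan.IsColimit.fac]

theorem exists_injective_lt_top (S : Type v) :
    ∃ (K : Type v) (_ : LinearOrder K) (_ : BoundedOrder K) (_ : WellFoundedLT K) (e : S → K),
      Function.Injective e ∧ ∀ x, e x < ⊤ := by
  obtain ⟨_, _⟩ := exists_wellFoundedLT S
  exact ⟨WithBot (WithTop S), inferInstance, inferInstance, inferInstance,
    fun x => ((x : WithTop S) : WithBot (WithTop S)),
    fun x y h => WithTop.coe_injective (WithBot.coe_injective h),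
    fun x => WithBot.coe_lt_coe.2 (WithTop.coe_lt_top x)⟩

theorem isAttach_punit_iff {A B X Z : C} {i : A ⟶ B} {a : A ⟶ X} {f : X ⟶ Z} {b : B ⟶ Z} :
    IsAttach (fun _ : PUnit.{v + 1} => i) Set.univ (fun _ _ => a) f (fun _ _ => b) ↔
      IsPushout a i f b := by
  refine ⟨fun H => ?_, fun H => ?_⟩
  · refine .of_exists_desc (H.w ⟨⟩ trivial).symm (fun h₁ h₂ => H.hom_ext h₁ fun _ _ => h₂)
      fun p q h => ?_
    obtain ⟨g, hg, hg'⟩ := H.exists_desc p (fun _ _ => q) fun _ _ => h.symm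
    exact ⟨g, hg, hg' ⟨⟩ trivial⟩
  · exact
      { w := fun _ _ => H.w.symm
        hom_ext := fun h₁ h₂ => H.hom_ext h₁ (h₂ ⟨⟩ trivial)
        exists_desc := fun φ ψ h => ⟨H.desc φ (ψ ⟨⟩ trivial) (h ⟨⟩ trivial).symm,
          H.inl_desc _ _ _, fun _ _ => H.inr_desc _ _ _⟩ }

variable [HasColimits C]

theorem HomotopicalAlgebra.AttachCells.relativeCells {I : MorphismProperty C} {X Z : C} {f : X ⟶ Z}
    (c : AttachCells.{v} I.homFamily f) : relativeCells I f := by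
  obtain ⟨K, _, _, _, e, he, he'⟩ := exists_injective_lt_top c.ι
  exact (c.isAttach.nonempty_mapRefinement I (fun x => (c.π x).2) e he he').some
    |>.transfiniteCompositions

theorem HomotopicalAlgebra.RelativeCellComplex.relativeCells {I : MorphismProperty C} {J : Type v}
    [LinearOrder J] [OrderBot J] [SuccOrder J] [WellFoundedLT J] [NoMaxOrder J] {X Z : C}
    {f : X ⟶ Z} (c : RelativeCellComplex.{v} (fun _ : J => I.homFamily) f) :
    relativeCells I f := by
  -- A lexicographic refinement uses one index order for all rows, so the cells of all stages are
  -- indexed together.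
  obtain ⟨K, _, _, _, e, he, he'⟩ :=
    exists_injective_lt_top (Σ j, (c.attachCells j (not_isMax j)).ι)
  let R (j : J) : MapRefinement K I.pushouts (c.F.map (homOfLE (Order.le_succ j))) :=
    ((c.attachCells j (not_isMax j)).isAttach.nonempty_mapRefinement I
      (fun x => ((c.attachCells j (not_isMax j)).π x).2) (fun x => e ⟨j, x⟩)
      (fun x y h => by simpa using he h) fun x => he' _).some
  have (j : J) := (R j).isWellOrderContinuous
  exact StepRefinement.transfiniteCompositions (K := K) I.pushouts
    c.toTransfiniteCompositionOfShape
    { H := fun j => (R j).H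
      u := fun j => (R j).u
      v := fun j => (R j).v
      u_map := fun j => (R j).u_map
      map_v := fun j => (R j).map_v
      u_v := fun j => (R j).u_v
      isIso_u := fun j => (R j).isIso_u
      isIso_v := fun j => (R j).isIso_v } fun j => (R j).map_mem

/-- The map along which the cobase change is taken is attached, as a single cell, to every stage of
the composition. The initial stage becomes its target, each step is a pushout of the original step,
and the colimit is the pushout. -/
instance relativeCells.isStableUnderCobaseChange (I : MorphismProperty C) :
    (relativeCells I).IsStableUnderCobaseChange where
  of_isPushout {A A' B B' f g f' g'} sq hg := by
    rw [relativeCells, MorphismProperty.transfiniteCompositions_iff] at hg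
    obtain ⟨J, _, _, _, _, ⟨h⟩⟩ := hg
    have hincl {j j' : J} (hj : j ≤ j') :
        h.F.map (homOfLE hj) ≫ h.incl.app j' = h.incl.app j :=
      (h.incl.naturality _).trans (Category.comp_id _)
    let D : CellDiagram (fun _ : PUnit.{v + 1} => g) h.F :=
      { E := fun _ => Set.univ
        mono := fun _ _ _ => subset_rfl
        a := fun j _ _ => h.isoBot.inv ≫ h.F.map (homOfLE bot_le)
        a_map := fun h' _ _ => by
          rw [Category.assoc, ← h.F.map_comp]
          rfl }
    have ha (j : J) : (h.isoBot.inv ≫ h.F.map (homOfLE bot_le)) ≫ h.incl.app j = f := by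
      rw [Category.assoc, hincl, h.fac]
    have H : IsAttach (fun _ : PUnit.{v + 1} => g) Set.univ (fun _ _ => f) g' (fun _ _ => f') :=
      isAttach_punit_iff.2 sq.flip
    have ht (j : J) := (D.isAttach j).exists_desc (h.incl.app j ≫ g') (fun _ _ => f') fun _ _ =>
      sq.w.trans (by
        change f ≫ g' = (h.isoBot.inv ≫ h.F.map (homOfLE bot_le)) ≫ h.incl.app j ≫ g'
        rw [← Category.assoc, ha])
    choose t ht ht' using ht
    have hb : IsIso (D.cell ⊥ ⟨⟩ trivial) := by
      have : IsIso (h.isoBot.inv ≫ h.F.map (homOfLE (le_refl ⊥))) := by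
        have : IsIso (h.F.map (homOfLE (le_refl (⊥ : J)))) := h.F.map_isIso (𝟙 _)
        infer_instance
      exact IsPushout.isIso_inr_of_isIso (f := h.isoBot.inv ≫ h.F.map (homOfLE (le_refl ⊥)))
        (isAttach_punit_iff.1 (D.isAttach ⊥))
    have htn {j j' : J} (hj : j ≤ j') : D.functor.map (homOfLE hj) ≫ t j' = t j := by
      refine (D.isAttach j).hom_ext ?_ fun x hx => ?_
      · refine ((Category.assoc _ _ _).symm.trans (congrArg (· ≫ t j') (D.incl_map hj))).trans ?_
        rw [Category.assoc, ht, ht, ← Category.assoc, hincl]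
      · exact ((Category.assoc _ _ _).symm.trans (congrArg (· ≫ t j') (D.cell_map hj x hx))).trans
          ((ht' _ _ _).trans (ht' _ _ _).symm)
    let c : Cocone D.functor :=
      { pt := B'
        ι :=
          { app := t
            naturality := fun _ _ φ => (htn (leOfHom φ)).trans (Category.comp_id _).symm } }
    have := h.isWellOrderContinuous
    refine MorphismProperty.transfiniteCompositionsOfShape_le_transfiniteCompositions _ J _
      ⟨{ F := D.functor
         isoBot := (asIso (D.cell ⊥ ⟨⟩ trivial)).symm
         isWellOrderContinuous := D.isWellOrderContinuous fun j hj _ _ =>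
          ⟨⊥, hj.bot_lt, trivial⟩
         incl := c.ι
         isColimit := (IsAttach.isColimit (c := Cocone.mk _ h.incl) (t := c) D.isAttach D.mono
          D.incl_map D.cell_map h.isColimit H
          (fun _ => subset_rfl) (fun _ _ => ⟨⊥, trivial⟩) ht (fun j _ _ => ha j) ht').some
         fac := ht' ⊥ ⟨⟩ trivial
         map_mem := fun j hj => MorphismProperty.of_isPushout
          ((D.isAttach j).isPushout_of_subset (D.isAttach (Order.succ j)) subset_rfl subset_rfl
            (D.a_map (Order.le_succ j)) (D.incl_map (Order.le_succ j))
            (D.cell_map (Order.le_succ j))).flip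
            (h.map_mem j hj) }⟩

end

/-! ### Smallness relative to retracts of cell complexes. -/

theorem CategoryTheory.Limits.nonempty_isColimit_of_retract {C J : Type*} [Category* C]
    [Category* J] {F Y : J ⥤ C} {η : F ⟶ Y} {ρ : Y ⟶ F} (hηρ : η ≫ ρ = 𝟙 F) {c : Cocone F}
    {d : Cocone Y} (hd : IsColimit d) {i : c.pt ⟶ d.pt} {r : d.pt ⟶ c.pt} (hir : i ≫ r = 𝟙 _)
    (hi : ∀ j, c.ι.app j ≫ i = η.app j ≫ d.ι.app j)
    (hr : ∀ j, d.ι.app j ≫ r = ρ.app j ≫ c.ι.app j) : Nonempty (IsColimit c) :=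
  ⟨{
    desc := fun s => i ≫ hd.desc ((Cocone.precompose ρ).obj s)
    fac := fun s j => by
      have h : ρ.app j ≫ s.ι.app j = d.ι.app j ≫ hd.desc ((Cocone.precompose ρ).obj s) :=
        (hd.fac ((Cocone.precompose ρ).obj s) j).symm
      have h' : η.app j ≫ ρ.app j = 𝟙 _ := congrArg (fun φ => φ.app j) hηρ
      rw [← Category.assoc, hi, Category.assoc, ← h, ← Category.assoc, h', Category.id_comp]
    uniq := fun s m hm => by
      have : r ≫ m = hd.desc ((Cocone.precompose ρ).obj s) := 
        hd.uniq ((Cocone.precompose ρ).obj s) (r ≫ m) fun j => by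
          rw [← Category.assoc, hr, Category.assoc, hm]
          rfl
      rw [← this, ← Category.assoc, hir, Category.id_comp] }⟩

/-- The retraction of diagrams induces one of colimit cocones. The functor sends it to a retract of
a colimit cocone, which is again a colimit cocone. -/
theorem CategoryTheory.Limits.preservesColimit_of_retract {C D J : Type*} [Category* C]
    [Category* D] [Category* J] {F Y : J ⥤ C} [HasColimit Y] {η : F ⟶ Y} {ρ : Y ⟶ F}
    (hηρ : η ≫ ρ = 𝟙 F) (G : C ⥤ D) [PreservesColimit Y G] : PreservesColimit F G where
  preserves {c} hc := by
    let d := colimit.cocone Y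
    let hd : IsColimit d := colimit.isColimit Y
    let i : c.pt ⟶ d.pt := hc.desc ((Cocone.precompose η).obj d)
    let r : d.pt ⟶ c.pt := hd.desc ((Cocone.precompose ρ).obj c)
    have hi (j : J) : c.ι.app j ≫ i = η.app j ≫ d.ι.app j := hc.fac _ j
    have hr (j : J) : d.ι.app j ≫ r = ρ.app j ≫ c.ι.app j := hd.fac _ j
    have hηρ' (j : J) : η.app j ≫ ρ.app j = 𝟙 _ := congrArg (fun φ => φ.app j) hηρ
    have hir : i ≫ r = 𝟙 _ := hc.hom_ext fun j => by
      rw [← Category.assoc, hi, Category.assoc, hr, ← Category.assoc, hηρ', Category.id_comp,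
        Category.comp_id]
    refine nonempty_isColimit_of_retract (η := Functor.whiskerRight η G)
      (ρ := Functor.whiskerRight ρ G) ?_ (isColimitOfPreserves G hd) (i := G.map i) (r := G.map r)
      ?_ (fun j => ?_) fun j => ?_
    · rw [← Functor.whiskerRight_comp, hηρ]
      exact Functor.whiskerRight_id' G
    · exact (G.map_comp i r).symm.trans ((congrArg _ hir).trans (G.map_id _))
    · exact (G.map_comp _ _).symm.trans ((congrArg _ (hi j)).trans (G.map_comp _ _))
    · exact (G.map_comp _ _).symm.trans ((congrArg _ (hr j)).trans (G.map_comp _ _))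

section

variable {C : Type u} [Category.{v} C] {I : MorphismProperty C}

theorem exists_cardinal_of_isSmallRelativeTo [MorphismProperty.IsSmall.{v} I]
    {W : MorphismProperty C} (hI : ∀ {A B : C} (i : A ⟶ B), I i → IsSmallRelativeTo A W) :
    ∃ μ : Cardinal.{v}, μ.IsRegular ∧ ∀ {A B : C} (i : A ⟶ B), I i →
      ∀ F : μ.ord.ToType ⥤ C, F.IsWellOrderContinuous →
      (∀ (j j' : μ.ord.ToType) (h : j ⋖ j'), W (F.map (homOfLE h.le))) →
        PreservesColimit F (coyoneda.obj (Opposite.op A)) := by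
  choose κ hκ using fun i : I.toSet => hI i.1.hom i.2
  let κ' : Shrink.{v} I.toSet → Cardinal.{v} := fun x => κ ((equivShrink _).symm x)
  have hκ' (i : I.toSet) : κ i ≤ iSup κ' := by
    have := le_ciSup (Cardinal.bddAbove_of_small (s := Set.range κ')) (equivShrink _ i)
    rwa [show κ' (equivShrink _ i) = κ i by simp [κ']] at this
  refine ⟨Order.succ (max Cardinal.aleph0 (iSup κ')),
    Cardinal.isRegular_succ (le_max_left _ _), fun {A B} i hi => ?_⟩
  exact hκ ⟨Arrow.mk i, hi⟩ _ (Cardinal.isRegular_succ (le_max_left _ _))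
    (((hκ' _).trans (le_max_right _ _)).trans (Order.le_succ _))

variable [HasColimits C]

/-- A common regular cardinal serves all the domains, because `I` is a set up to size. The class `W`
need only contain the attachments of families of cells that occur in the construction. -/
theorem hasSmallObjectArgument_of_isSmallRelativeTo [MorphismProperty.IsSmall.{v} I]
    {W : MorphismProperty C} (hI : ∀ {A B : C} (i : A ⟶ B), I i → IsSmallRelativeTo A W)
    (hW : ∀ {X Y : C} (f : X ⟶ Y), AttachCells.{v} I.homFamily f → W f) :
    MorphismProperty.HasSmallObjectArgument.{v} I := by
  obtain ⟨μ, hμ, h⟩ := exists_cardinal_of_isSmallRelativeTo hI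
  have := Cardinal.noMaxOrder hμ.aleph0_le
  let bot : OrderBot μ.ord.ToType := 
    have : Nonempty μ.ord.ToType :=
      Ordinal.nonempty_toType_iff.2 fun h => hμ.ne_zero (by simpa using h)
    WellFoundedLT.toOrderBot _
  refine ⟨μ, ⟨hμ⟩, bot, @MorphismProperty.IsCardinalForSmallObjectArgument.mk _ _ _ _ ⟨hμ⟩ bot
    inferInstance inferInstance inferInstance inferInstance inferInstance
    fun {A B X Y} i hi f hf => h i hi hf.F hf.isWellOrderContinuous fun j j' hj => ?_⟩
  obtain rfl := hj.succ_eq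
  exact hW _ (hf.attachCells j (not_isMax j))

theorem PermitsSmallObjectArgument.hasSmallObjectArgument [MorphismProperty.IsSmall.{v} I]
    (hI : PermitsSmallObjectArgument I) : MorphismProperty.HasSmallObjectArgument.{v} I :=
  hasSmallObjectArgument_of_isSmallRelativeTo (fun i hi => hI i hi) fun _ c => c.relativeCells

theorem exists_relativeCells_fac [MorphismProperty.HasSmallObjectArgument.{v} I] {X Y : C}
    (f : X ⟶ Y) : ∃ (Z : C) (c : X ⟶ Z) (p : Z ⟶ Y), relativeCells I c ∧ I.rlp p ∧ c ≫ p = f := by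
  have hκ : I.smallObjectκ.IsRegular :=
    (MorphismProperty.HasSmallObjectArgument.exists_cardinal (I := I)).choose_spec.choose.out
  have : Fact I.smallObjectκ.IsRegular := ⟨hκ⟩
  have := Cardinal.noMaxOrder hκ.aleph0_le
  exact ⟨_, SmallObject.ιObj I I.smallObjectκ f, SmallObject.πObj I I.smallObjectκ f,
    (SmallObject.relativeCellComplexιObj I I.smallObjectκ f).relativeCells,
    SmallObject.rlp_πObj I I.smallObjectκ f, SmallObject.ιObj_πObj I I.smallObjectκ f⟩

/-- A sequence of maps in `I.rlp.llp` is a retract of a sequence of relative cell complexes. -/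
theorem exists_retract_relativeCells [MorphismProperty.HasSmallObjectArgument.{v} I] {J : Type v}
    [LinearOrder J] [SuccOrder J] [NoMaxOrder J] (F : J ⥤ C) [F.IsWellOrderContinuous]
    (hF : ∀ j, I.rlp.llp (F.map (homOfLE (Order.le_succ j)))) :
    ∃ (Y : J ⥤ C) (η : F ⟶ Y) (ρ : Y ⟶ F), η ≫ ρ = 𝟙 F ∧ Y.IsWellOrderContinuous ∧
      ∀ j, relativeCells I (Y.map (homOfLE (Order.le_succ j))) := by
  choose Z c p hc hp hcp using fun j =>
    exists_relativeCells_fac (I := I) (F.map (homOfLE (Order.le_succ j)))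
  -- The retract argument at each step: lifting against `p j` exhibits the step as a retract of the
  -- relative cell complex `c j`, through a section `s j` of `p j`.
  have hs (j : J) : ∃ s : F.obj (Order.succ j) ⟶ Z j,
      F.map (homOfLE (Order.le_succ j)) ≫ s = c j ∧ s ≫ p j = 𝟙 _ := by
    have := hF j (p j) (hp j)
    have sq : CommSq (c j) (F.map (homOfLE (Order.le_succ j))) (p j) (𝟙 _) :=
      ⟨by rw [hcp, Category.comp_id]⟩
    exact ⟨sq.lift, sq.fac_left, sq.fac_right⟩
  choose s hs hs' using hs
  -- These retractions must be made compatible along the sequence. The stage `j` of the new sequence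
  -- is `F.obj j` with the maps `s x`, for all `x < j`, attached; the maps `p x` retract it onto
  -- `F`. The cell new at `Order.succ j` is attached along an identity, so the step is a pushout of
  -- `c j`.
  let D : CellDiagram s F :=
    { E := Set.Iio
      mono := fun j j' h => Set.Iio_subset_Iio h
      a := fun j x hx => F.map (homOfLE (Order.succ_le_of_lt hx))
      a_map := fun h x hx => (F.map_comp _ _).symm }
  have hρ (j : J) := (D.isAttach j).exists_desc (𝟙 (F.obj j))
    (fun x hx => p x ≫ F.map (homOfLE (Order.succ_le_of_lt hx))) fun x hx => by
      rw [← Category.assoc, hs', Category.id_comp]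
      exact (Category.comp_id _).symm
  choose ρ hρ hρ' using hρ
  refine ⟨D.functor, { app := D.incl, naturality := fun j j' φ => (D.incl_map (leOfHom φ)).symm },
    { app := ρ, naturality := fun j j' φ => (D.isAttach j).hom_ext ?_ fun x hx => ?_ }, ?_,
    D.isWellOrderContinuous fun j hj x hx => ⟨Order.succ x, hj.succ_lt hx, Order.lt_succ x⟩,
    fun j => ?_⟩
  · refine ((Category.assoc _ _ _).symm.trans
      (congrArg (· ≫ ρ j') (D.incl_map (leOfHom φ)))).trans ?_
    rw [Category.assoc, hρ, Category.comp_id]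
    exact ((Category.assoc _ _ _).symm.trans
      ((congrArg (· ≫ F.map φ) (hρ j)).trans (Category.id_comp _))).symm
  · refine ((Category.assoc _ _ _).symm.trans
      (congrArg (· ≫ ρ j') (D.cell_map (leOfHom φ) x hx))).trans ?_
    refine (hρ' j' x _).trans ((Category.assoc _ _ _).symm.trans
      ((congrArg (· ≫ F.map φ) (hρ' j x hx)).trans ?_)).symm
    rw [Category.assoc, ← F.map_comp]
    rfl
  · ext j
    exact hρ j
  · have sq := (D.isAttach j).isPushout_of_insert_isIso (D.isAttach (Order.succ j))
      (D.mono (Order.le_succ j)) (x₀ := j) (Order.lt_succ j)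
      (fun x hx => (Order.le_of_lt_succ hx).eq_or_lt) (lt_irrefl j)
      (r := 𝟙 _) ((Category.id_comp _).trans (F.map_id _))
      ((Category.comp_id _).trans (F.map_id _)) (D.a_map (Order.le_succ j))
      (D.incl_map (Order.le_succ j)) (D.cell_map (Order.le_succ j))
    rw [Category.id_comp, hs] at sq
    exact MorphismProperty.of_isPushout sq (hc j)

theorem IsSmallRelativeTo.of_relativeCells [MorphismProperty.HasSmallObjectArgument.{v} I] {A : C}
    (hA : IsSmallRelativeTo A (relativeCells I)) : IsSmallRelativeTo A I.rlp.llp := by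
  obtain ⟨κ, hκ⟩ := hA
  refine ⟨κ, fun μ hμ hκμ F hF hF' => ?_⟩
  have := Cardinal.noMaxOrder hμ.aleph0_le
  obtain ⟨Y, η, ρ, hηρ, hY, hY'⟩ := exists_retract_relativeCells (I := I) F fun j =>
    hF' _ _ (Order.covBy_succ j)
  have := hκ μ hμ hκμ Y hY fun j j' hj => by
    obtain rfl := hj.succ_eq
    exact hY' j
  exact preservesColimit_of_retract hηρ _

end

/-! ### Transfer along a functor with adjoints on both sides. -/

theorem IsSmallRelativeTo.of_adjunction {C : Type*} {D : Type*} [Category.{v} C] [Category.{v} D]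
    {L : C ⥤ D} {U : D ⥤ C} (adj : L ⊣ U) [PreservesColimits U] {W : MorphismProperty C} {A : C}
    (hA : IsSmallRelativeTo A W) : IsSmallRelativeTo (L.obj A) (W.inverseImage U) := by
  obtain ⟨κ, hκ⟩ := hA
  refine ⟨κ, fun μ hμ hκμ F hF hF' => ?_⟩
  have : PreservesWellOrderContinuousOfShape μ.ord.ToType U := {}
  have := hκ μ hμ hκμ (F ⋙ U) inferInstance fun j j' hj => hF' j j' hj
  let e : U ⋙ coyoneda.obj (Opposite.op A) ≅ coyoneda.obj (Opposite.op (L.obj A)) :=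
    NatIso.ofComponents (fun X => (adj.homEquiv A X).symm.toIso) fun f => by
      ext g
      exact adj.homEquiv_naturality_right_symm g f
  exact preservesColimit_of_natIso F e

section

variable {C : Type*} {D : Type*} [Category.{v} C] [Category.{v} D] {L : C ⥤ D} {U : D ⥤ C}
  {R : C ⥤ D}

/-- A set of maps `I` of `C` induces a set of maps of `D` along a left adjoint. -/
theorem exists_isSmall_rlp_eq_inverseImage (adj : L ⊣ U) (I : MorphismProperty C)
    [MorphismProperty.IsSmall.{v} I] :
    ∃ I' : MorphismProperty D, MorphismProperty.IsSmall.{v} I' ∧ I'.rlp = I.rlp.inverseImage U ∧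
      ∀ {A B : D} (i : A ⟶ B), I' i → ∃ (A' B' : C) (i' : A' ⟶ B'), I i' ∧ L.obj A' = A := by
  obtain ⟨ι, A, B, f, rfl⟩ := (MorphismProperty.isSmall_iff_eq_ofHoms.{v} I).1 inferInstance
  refine ⟨.ofHoms fun x => L.map (f x), inferInstance, ?_, ?_⟩
  · ext X Y p
    refine ⟨fun h => ?_, fun h => ?_⟩
    · rintro _ _ _ ⟨x⟩
      exact (adj.hasLiftingProperty_iff _ _).1 (h _ ⟨x⟩)
    · rintro _ _ _ ⟨x⟩
      exact (adj.hasLiftingProperty_iff _ _).2 (h _ ⟨x⟩)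
  · rintro _ _ _ ⟨x⟩
    exact ⟨_, _, f x, ⟨x⟩, rfl⟩

/-- By adjunction, `U f` lifts against `p` as soon as `f` lifts against `R p`. The latter lies in
`I'.rlp`, which is detected by `U`, and `hR` says precisely that `U R p` is in `I.rlp`. -/
theorem rlp_llp_le_inverseImage (adj : U ⊣ R) {I : MorphismProperty C} {I' : MorphismProperty D}
    (hI' : I'.rlp = I.rlp.inverseImage U)
    (hR : ∀ {X Y : C} (p : X ⟶ Y), I.rlp p → I.rlp (U.map (R.map p))) :
    I'.rlp.llp ≤ I.rlp.llp.inverseImage U := by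
  intro A B f hf X Y p hp
  refine (adj.hasLiftingProperty_iff f p).2 (hf _ ?_)
  rw [hI']
  exact hR p hp

/-- Attached `I'`-cells lie in `I'.rlp.llp`, so `U` sends them into `I.rlp.llp`. The domains of `I`
are small relative to that class, and the adjunction carries this smallness to the domains of `I'`.
-/
theorem exists_hasSmallObjectArgument [HasColimits C] [HasColimits D] (adj : L ⊣ U) (adj' : U ⊣ R)
    {I : MorphismProperty C} [MorphismProperty.IsSmall.{v} I] (hI : PermitsSmallObjectArgument I)
    (hR : ∀ {X Y : C} (p : X ⟶ Y), I.rlp p → I.rlp (U.map (R.map p))) :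
    ∃ I' : MorphismProperty D, MorphismProperty.HasSmallObjectArgument.{v} I' ∧
      I'.rlp = I.rlp.inverseImage U ∧ I'.rlp.llp ≤ I.rlp.llp.inverseImage U := by
  obtain ⟨I', _, hI', h⟩ := exists_isSmall_rlp_eq_inverseImage adj I
  have hle := rlp_llp_le_inverseImage adj' hI' hR
  have := hI.hasSmallObjectArgument
  have := adj'.leftAdjoint_preservesColimits
  refine ⟨I', hasSmallObjectArgument_of_isSmallRelativeTo (W := I.rlp.llp.inverseImage U)
    (fun i hi => ?_) fun f c => hle f ?_, hI', hle⟩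
  · obtain ⟨A', B', i', hi', rfl⟩ := h i hi
    exact (hI i' hi').of_relativeCells.of_adjunction adj
  · have := c.pushouts_coproducts
    rw [MorphismProperty.ofHoms_homFamily] at this
    have := MorphismProperty.pushouts_monotone I'.coproducts_le_llp_rlp _ this
    exact (MorphismProperty.isStableUnderCobaseChange_iff_pushouts_le.1 inferInstance) _ this

/-- The transfer of a cofibrantly generated model structure along a functor `U` with adjoints on
both sides such that the composition with the right adjoint preserves fibrations and trivial
fibrations. -/
theorem exists_modelCategory_isRightInduced [HasColimits C] [HasLimits D] [HasColimits D]
    [ModelCategory C] (adj : L ⊣ U) (adj' : U ⊣ R) (hgen : IsCofibrantlyGenerated C)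
    (hfib : ∀ {X Y : C} (p : X ⟶ Y), fibrations C p → fibrations C (U.map (R.map p)))
    (htriv : ∀ {X Y : C} (p : X ⟶ Y), trivialFibrations C p →
      trivialFibrations C (U.map (R.map p))) :
    ∃ _ : ModelCategory D,
      (cofibrations D).HasFunctorialFactorization (trivialFibrations D) ∧
      (trivialCofibrations D).HasFunctorialFactorization (fibrations D) ∧ IsRightInduced U := by
  obtain ⟨I, J, _, _, hI, hJ, hfibJ, htrivI⟩ := hgen
  obtain ⟨I', _, hI', hle⟩ := exists_hasSmallObjectArgument adj adj' hI (by rwa [← htrivI])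
  obtain ⟨J', _, hJ', hle'⟩ := exists_hasSmallObjectArgument adj adj' hJ (by rwa [← hfibJ])
  let _ : CategoryWithFibrations D := ⟨(fibrations C).inverseImage U⟩
  let _ : CategoryWithWeakEquivalences D := ⟨(weakEquivalences C).inverseImage U⟩
  let _ : CategoryWithCofibrations D := ⟨I'.rlp.llp⟩
  have hw : (weakEquivalences D).HasTwoOutOfThreeProperty :=
    inferInstanceAs ((weakEquivalences C).inverseImage U).HasTwoOutOfThreeProperty
  have e₁ : trivialFibrations D = I'.rlp := by
    rw [hI', ← htrivI]
    rfl
  have e₂ : fibrations D = J'.rlp := by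
    rw [hJ', ← hfibJ]
    rfl
  have hJI : J'.rlp.llp ≤ I'.rlp.llp := by
    refine MorphismProperty.antitone_llp ?_
    rw [← e₁, ← e₂]
    exact trivialFibrations_sub_fibrations D
  have e₃ : trivialCofibrations D = J'.rlp.llp := by
    refine le_antisymm ?_ fun X Y f hf => ⟨hJI f hf, ?_⟩
    -- After factoring through `J'`, the first factor is a weak equivalence because `U` sends it to
    -- a trivial cofibration. The second is then a trivial fibration by two-out-of-three, and `f` is
    -- a retract of the first.
    · rintro X Y f ⟨hf, hf'⟩
      obtain ⟨Z, i, p, fac, hi, hp⟩ := MorphismProperty.factorizationData J'.rlp.llp J'.rlp f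
      have hp' : I'.rlp p := by
        rw [← e₁]
        refine ⟨e₂ ▸ hp, (weakEquivalences D).of_precomp (W' := weakEquivalences D) i p ?_ (fac.symm ▸ hf')⟩
        have := hle' i hi
        rw [← hfibJ, fibrations_llp] at this
        exact this.2
      have := hf p hp'
      exact MorphismProperty.of_retract (RetractArrow.ofLeftLiftingProperty fac) hi
    · have := hle' f hf
      rw [← hfibJ, fibrations_llp] at this
      exact this.2
  have w₁ : MorphismProperty.IsWeakFactorizationSystem (cofibrations D) (trivialFibrations D) := by
    rw [e₁]
    exact ⟨I'.rlp_llp_rlp, rfl,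
      inferInstanceAs (MorphismProperty.HasFactorization I'.rlp.llp I'.rlp)⟩
  have w₂ : MorphismProperty.IsWeakFactorizationSystem (trivialCofibrations D) (fibrations D) := by
    rw [e₂, e₃]
    exact ⟨J'.rlp_llp_rlp, rfl, inferInstance⟩
  have f₁ : (cofibrations D).HasFunctorialFactorization (trivialFibrations D) := by
    rw [e₁]
    exact inferInstanceAs (MorphismProperty.HasFunctorialFactorization I'.rlp.llp I'.rlp)
  have f₂ : (trivialCofibrations D).HasFunctorialFactorization (fibrations D) := by
    rw [e₂, e₃]
    infer_instance
  let _ : ModelCategory D := ModelCategory.mk' D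
  exact ⟨inferInstance, f₁, f₂, fun f => ⟨fun h => ⟨h.mem⟩, fun h => ⟨h.mem⟩⟩,
    fun f => ⟨fun h => ⟨h.mem⟩, fun h => ⟨h.mem⟩⟩⟩

end

/-! ### The model structure on cyclic operads. -/

variable {M : Type u} [Category.{v} M] [MonoidalCategory M] [SymmetricCategory M]

theorem IsRightInduced.comp {A B C : Type*} [Category* A] [Category* B] [Category* C]
    [ModelCategory A] [ModelCategory B] [ModelCategory C] {F : A ⥤ B} {G : B ⥤ C}
    (hF : IsRightInduced F) (hG : IsRightInduced G) : IsRightInduced (F ⋙ G) where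
  weakEquivalence_iff f := (hF.weakEquivalence_iff f).trans (hG.weakEquivalence_iff _)
  fibration_iff f := (hF.fibration_iff f).trans (hG.fibration_iff _)

theorem Operad.fibrations_iff [ModelCategory M] [ModelCategory (Operad M)]
    (hlift : IsRightInduced (Operad.forget M)) {P Q : Operad M} (f : P ⟶ Q) :
    fibrations (Operad M) f ↔ ∀ n, fibrations M (f.app n) := by
  rw [← fibration_iff, hlift.fibration_iff, NModule.fibration_iff]
  exact forall_congr' fun n => fibration_iff _

theorem Operad.weakEquivalences_iff [ModelCategory M] [ModelCategory (Operad M)]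
    (hlift : IsRightInduced (Operad.forget M)) {P Q : Operad M} (f : P ⟶ Q) :
    weakEquivalences (Operad M) f ↔ ∀ n, weakEquivalences M (f.app n) := by
  rw [← weakEquivalence_iff, hlift.weakEquivalence_iff, NModule.weakEquivalence_iff]
  exact forall_congr' fun n => weakEquivalence_iff _

theorem Operad.fibrations_cofree_map [HasFiniteProducts M] [ModelCategory M]
    [ModelCategory (Operad M)] (hlift : IsRightInduced (Operad.forget M)) {P Q : Operad M}
    (f : P ⟶ Q) (hf : fibrations (Operad M) f) :
    fibrations (Operad M) ((CyclicOperad.forget M).map ((cofree M).map f)) := by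
  rw [fibrations_iff hlift] at hf ⊢
  intro n
  refine (congrArg (fun g : (_ ⟶ _) => fibrations M g) (cofree_map_app f n)).mpr ?_
  exact MorphismProperty.limMap _ fun _ => hf n

/-- Weak equivalences need not be closed under products, but trivial fibrations are; so both
properties of `f` enter together, level by level. -/
theorem Operad.trivialFibrations_cofree_map [HasFiniteProducts M] [ModelCategory M]
    [ModelCategory (Operad M)] (hlift : IsRightInduced (Operad.forget M)) {P Q : Operad M}
    (f : P ⟶ Q) (hf : trivialFibrations (Operad M) f) :
    trivialFibrations (Operad M) ((CyclicOperad.forget M).map ((cofree M).map f)) := by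
  refine ⟨fibrations_cofree_map hlift f hf.1, ?_⟩
  rw [weakEquivalences_iff hlift]
  intro n
  refine (congrArg (fun g : (_ ⟶ _) => weakEquivalences M g) (cofree_map_app f n)).mpr ?_
  refine trivialFibrations_sub_weakEquivalences _ _ ?_
  exact MorphismProperty.limMap _ fun _ =>
    ⟨(fibrations_iff hlift f).1 hf.1 n, (weakEquivalences_iff hlift f).1 hf.2 n⟩

theorem mainTheorem7 {M : Type u} [Category.{v} M] [MonoidalCategory M] [SymmetricCategory M]
    [MonoidalClosed M] [HasLimits M] [HasColimits M] [ModelCategory M] [IsMonoidalModelCategory M]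
    [HasLimits (Operad M)] [HasColimits (Operad M)] [ModelCategory (Operad M)]
    (hgen : IsCofibrantlyGenerated (Operad M))
    (hlift : IsRightInduced (Operad.forget M)) :
    HasLimits (CyclicOperad M) ∧ HasColimits (CyclicOperad M) ∧
      ∃ _ : ModelCategory (CyclicOperad M),
        MorphismProperty.HasFunctorialFactorization
          (cofibrations (CyclicOperad M)) (trivialFibrations (CyclicOperad M)) ∧
        MorphismProperty.HasFunctorialFactorization
          (trivialCofibrations (CyclicOperad M)) (fibrations (CyclicOperad M)) ∧
        IsRightInduced (CyclicOperad.forget M) ∧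
        IsRightInduced (CyclicOperad.forget M ⋙ Operad.forget M) := by
  obtain ⟨h, h₁, h₂, h₃⟩ := exists_modelCategory_isRightInduced (Operad.freeAdjunction M)
    (Operad.cofreeAdjunction M) hgen (Operad.fibrations_cofree_map hlift)
    (Operad.trivialFibrations_cofree_map hlift)
  exact ⟨inferInstance, inferInstance, h, h₁, h₂, h₃, h₃.comp hlift⟩
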